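/- Let $(M,\omega)$ be a symplectic manifold and let $E=E^+\oplus E^-$ be a smooth complex superbundle over $M$ ($E^\pm$ smooth complex vector bundles of finite rank). Let $\Omega(M)$ be the space of smooth complex-valued differential forms on $M$, and let $\Omega(M,E)$, $\Omega(M,\mathrm{End}\,E)$ be the spaces of smooth forms with values in $E$ and $\mathrm{End}(E)$, with $\Omega^{\pm}$ the parts of even/odd total degree; $\alpha\otimes L\in\Omega(M,\mathrm{End}\,E)$ acts on $\Omega(M,E)$ by $(\alpha\otimes L)(\beta\otimes v)=(-1)^{|L||\beta|}(\alpha\wedge\beta)\otimes Lv$, and $\mathrm{Str}(\alpha\otimes L)=\mathrm{Str}(L)\,\alpha$. Put $$\partial(\alpha,\beta)=(d\alpha+\omega\wedge\beta,\,-d\beta)\qquad\text{on }\Omega(M)\oplus\Omega(M).$$ The primitive cohomology of $(M,\omega)$ is the cohomology of $\partial:\Omega^i(M)\oplus\Omega^{i-1}(M)\to\Omega^{i+1}(M)\oplus\Omega^i(M)$. A superconnection on $E$ is a linear operator $A$ on $\Omega(M,E)$ that exchanges $\Omega^+(M,E)$ and $\Omega^-(M,E)$ and satisfies $A(\alpha\wedge\theta)=d\alpha\wedge\theta+(-1)^{|\alpha|}\alpha\wedge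 A\theta$. A primitive superconnection is an operator on $\Omega(M,E)\oplus\Omega(M,E)$ of the form $$\mathbb A(\alpha,\beta)=(A\alpha+\omega\wedge\beta,\;B\alpha-A\beta)$$ with $A$ a superconnection and $B\in\Omega^+(M,\mathrm{End}\,E)$. An operator $\mathbb D$ on $\Omega(M,E)\oplus\Omega(M,E)$ is identified with the pair $(\gamma,\delta)\in\Omega(M,\mathrm{End}\,E)\oplus\Omega(M,\mathrm{End}\,E)$ if $\mathbb D(\alpha,\beta)=(\gamma\alpha,\ \delta\alpha+\varepsilon\gamma\varepsilon\beta)$, where $\varepsilon=\pm1$ on $\Omega^\pm(M,E)$; then $\mathbf{Str}(\mathbb D):=(\mathrm{Str}\,\gamma,\mathrm{Str}\,\delta)\in\Omega(M)\oplus\Omega(M)$. Let $f\in\mathbb C[z]$, let $\mathbb A_0,\mathbb A_1$ be primitive superconnections, and let $\mathbb A_t=t\mathbb A_1+(1-t)\mathbb A_0$ $(t\in\mathbb R)$. Then every $\mathbb A_t$ is a primitive superconnection; $f(\mathbb A_t^2)$ and $(\mathbb A_1-\mathbb A_0)f'(\mathbb A_t^2)$ are identified with unique pairs in $\Omega^+(M,\mathrm{End}\,E)\oplus\Omega^-(M,\mathrm{End}\,E)$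 and $\Omega^-(M,\mathrm{End}\,E)\oplus\Omega^+(M,\mathrm{End}\,E)$ respectively; and $$\mathbf{Str}(f(\mathbb A_1^2))-\mathbf{Str}(f(\mathbb A_0^2))=\partial\int_0^1\mathbf{Str}\big((\mathbb A_1-\mathbb A_0)f'(\mathbb A_t^2)\big)\,dt,$$ where the integral of forms exists pointwise and is a pair of smooth forms. Moreover $\partial\,\mathbf{Str}(f(\mathbb A_0^2))=\partial\,\mathbf{Str}(f(\mathbb A_1^2))=0$, and for every $i$ the components of $\mathbf{Str}(f(\mathbb A_0^2))$ and $\mathbf{Str}(f(\mathbb A_1^2))$ in $\Omega^i(M)\oplus\Omega^{i-1}(M)$ define the same class in the degree-$i$ primitive cohomology; that is, the primitive cohomology class of $\mathbf{Str}(f(\mathbb A^2))$ does not depend on $\mathbb A$. -/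

import Mathlib

open scoped Manifold ContDiff TensorProduct
open Bundle

namespace PrimitiveChernWeil

noncomputable section

/-! ### Linear algebra in one fibre -/

section Fibre

variable {W W' : Type*} [AddCommGroup W] [Module ℝ W] [AddCommGroup W'] [Module ℝ W']
  {P N P' N' : Type*} [AddCommGroup P] [Module ℂ P] [AddCommGroup N] [Module ℂ N]
  [AddCommGroup P'] [Module ℂ P'] [AddCommGroup N'] [Module ℂ N']

/-- `Λ(W*) ⊗ ℂ`, realised as the exterior algebra over `ℂ` of the complexified dual space
`Hom_ℝ(W, ℂ)`. Its product is the wedge product. -/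
abbrev Ext (W : Type*) [AddCommGroup W] [Module ℝ W] : Type _ :=
  ExteriorAlgebra ℂ (W →ₗ[ℝ] ℂ)

/-- Pullback of exterior forms along a real linear map. -/
def extPullback (u : W →ₗ[ℝ] W') : Ext W' →ₐ[ℂ] Ext W :=
  ExteriorAlgebra.map (LinearMap.lcomp ℂ ℂ u)

/-- The grading involution `α ↦ (-1)^{|α|} α`. -/
def extSign : Ext W →ₐ[ℂ] Ext W := CliffordAlgebra.involute

/-- The component of form degree `k`. -/
def extProj (k : ℕ) : Ext W →ₗ[ℂ] Ext W :=
  GradedAlgebra.proj (fun i : ℕ => ⋀[ℂ]^i (W →ₗ[ℝ] ℂ)) k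

/-- Interior multiplication by the vector `v`. -/
def extContract (v : W) : Ext W →ₗ[ℂ] Ext W :=
  CliffordAlgebra.contractLeft (Q := 0)
    ({ toFun := fun l => l v, map_add' := fun _ _ => rfl, map_smul' := fun _ _ => rfl } :
      Module.Dual ℂ (W →ₗ[ℝ] ℂ))

/-- The grading operator of the superspace `P ⊕ N` (`P` even, `N` odd). -/
def superSign : (P × N) →ₗ[ℂ] (P × N) := LinearMap.prodMap LinearMap.id (-LinearMap.id)

/-- The block-diagonal (even) part of an endomorphism of `P ⊕ N`, in
`Hom(P, P) ⊕ Hom(N, N)`. -/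
def endEven : Module.End ℂ (P × N) →ₗ[ℂ] Module.End ℂ (P × N) where
  toFun L := LinearMap.prodMap
    (LinearMap.fst ℂ P N ∘ₗ L ∘ₗ LinearMap.inl ℂ P N)
    (LinearMap.snd ℂ P N ∘ₗ L ∘ₗ LinearMap.inr ℂ P N)
  map_add' _ _ := by ext <;> simp
  map_smul' _ _ := by ext <;> simp

/-- The off-diagonal (odd) part of an endomorphism of `P ⊕ N`, in
`Hom(P, N) ⊕ Hom(N, P)`. -/
def endOdd : Module.End ℂ (P × N) →ₗ[ℂ] Module.End ℂ (P × N) := LinearMap.id - endEven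

/-- The supertrace of an endomorphism of `P ⊕ N`: the trace over `P` minus the trace over `N`. -/
def endStr : Module.End ℂ (P × N) →ₗ[ℂ] ℂ where
  toFun L := LinearMap.trace ℂ P (LinearMap.fst ℂ P N ∘ₗ L ∘ₗ LinearMap.inl ℂ P N) -
    LinearMap.trace ℂ N (LinearMap.snd ℂ P N ∘ₗ L ∘ₗ LinearMap.inr ℂ P N)
  map_add' _ _ := by
    simp only [LinearMap.add_comp, LinearMap.comp_add, map_add]; ring
  map_smul' _ _ := by
    simp only [LinearMap.smul_comp, LinearMap.comp_smul, map_smul, smul_eq_mul,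
      RingHom.id_apply]; ring

/-- Total parity on `Λ(W*) ⊗ (P ⊕ N)`: `α ⊗ v ↦ (-1)^{|α|+|v|} α ⊗ v`. -/
def totalSign : (Ext W ⊗[ℂ] (P × N)) →ₗ[ℂ] (Ext W ⊗[ℂ] (P × N)) :=
  TensorProduct.map extSign.toLinearMap superSign

/-- Total parity on `Λ(W*) ⊗ End(P ⊕ N)`: `α ⊗ L ↦ (-1)^{|α|+|L|} α ⊗ L`. -/
def totalSignEnd : (Ext W ⊗[ℂ] Module.End ℂ (P × N)) →ₗ[ℂ] (Ext W ⊗[ℂ] Module.End ℂ (P × N)) :=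
  TensorProduct.map extSign.toLinearMap (endEven - endOdd)

/-- Left multiplication by scalar forms: `α, β ⊗ v ↦ (α ∧ β) ⊗ v`. -/
def extWedge : Ext W →ₗ[ℂ] (Ext W ⊗[ℂ] (P × N)) →ₗ[ℂ] (Ext W ⊗[ℂ] (P × N)) :=
  LinearMap.rTensorHom (P × N) ∘ₗ LinearMap.mul ℂ (Ext W)

/-- The action `(α ⊗ L)(β ⊗ v) = (-1)^{|L||β|} (α ∧ β) ⊗ L v` of `Λ(W*) ⊗ End(P ⊕ N)` on
`Λ(W*) ⊗ (P ⊕ N)`. -/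
def extAct : (Ext W ⊗[ℂ] Module.End ℂ (P × N)) →ₗ[ℂ]
    (Ext W ⊗[ℂ] (P × N)) →ₗ[ℂ] (Ext W ⊗[ℂ] (P × N)) :=
  TensorProduct.lift (LinearMap.mk₂ ℂ
    (fun (a : Ext W) (L : Module.End ℂ (P × N)) =>
      TensorProduct.map (LinearMap.mulLeft ℂ a) (endEven L) +
        TensorProduct.map (LinearMap.mulLeft ℂ a ∘ₗ extSign.toLinearMap) (endOdd L))
    (fun a a' L => by ext <;> simp [add_mul, TensorProduct.add_tmul] <;> abel)
    (fun c a L => by ext <;> simp [TensorProduct.smul_tmul'])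
    (fun a L L' => by ext <;> simp [TensorProduct.tmul_add] <;> abel)
    (fun c a L => by ext <;> simp [TensorProduct.tmul_smul]))

/-- The supertrace `α ⊗ L ↦ Str(L) α`. -/
def extStr : (Ext W ⊗[ℂ] Module.End ℂ (P × N)) →ₗ[ℂ] Ext W :=
  (TensorProduct.rid ℂ (Ext W)).toLinearMap ∘ₗ LinearMap.lTensor (Ext W) endStr

end Fibre

/-! ### Naturality of the fibrewise operations -/

section Naturality

variable {W W' : Type*} [AddCommGroup W] [Module ℝ W] [AddCommGroup W'] [Module ℝ W']
  {P N P' N' : Type*} [AddCommGroup P] [Module ℂ P] [AddCommGroup N] [Module ℂ N]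
  [AddCommGroup P'] [Module ℂ P'] [AddCommGroup N'] [Module ℂ N']

/-- Conjugation `L ↦ c ∘ L ∘ c'`. -/
def conjMap (c : P →ₗ[ℂ] P') (c' : P' →ₗ[ℂ] P) : Module.End ℂ P →ₗ[ℂ] Module.End ℂ P' where
  toFun L := c ∘ₗ L ∘ₗ c'
  map_add' _ _ := by ext; simp
  map_smul' _ _ := by ext; simp

theorem extSign_ι (l : W →ₗ[ℝ] ℂ) :
    extSign (ExteriorAlgebra.ι ℂ l) = -ExteriorAlgebra.ι ℂ l :=
  CliffordAlgebra.involute_ι l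

theorem extPullback_ι (u : W →ₗ[ℝ] W') (l : W' →ₗ[ℝ] ℂ) :
    extPullback u (ExteriorAlgebra.ι ℂ l) = ExteriorAlgebra.ι ℂ (l ∘ₗ u) :=
  ExteriorAlgebra.map_apply_ι _ _

theorem extPullback_sign (u : W →ₗ[ℝ] W') (a : Ext W') :
    extPullback u (extSign a) = extSign (extPullback u a) := by
  induction a using ExteriorAlgebra.induction with
  | algebraMap r => simp only [AlgHom.commutes]
  | ι l => simp only [extSign_ι, extPullback_ι, map_neg]
  | mul a b ha hb => simp only [map_mul, ha, hb]
  | add a b ha hb => simp only [map_add, ha, hb]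

theorem extPullback_proj (u : W →ₗ[ℝ] W') (k : ℕ) (a : Ext W') :
    extPullback u (extProj k a) = extProj k (extPullback u a) := by
  classical
  have hmem : ∀ (i : ℕ) (b : Ext W'), b ∈ (⋀[ℂ]^i (W' →ₗ[ℝ] ℂ)) →
      extPullback u b ∈ (⋀[ℂ]^i (W →ₗ[ℝ] ℂ)) := by
    intro i b hb
    rw [← ExteriorAlgebra.ιMulti_span_fixedDegree] at hb ⊢
    induction hb using Submodule.span_induction with
    | mem x hx =>
      obtain ⟨m, rfl⟩ := hx
      exact Submodule.subset_span ⟨_, (ExteriorAlgebra.map_apply_ιMulti _ _).symm⟩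
    | zero => simp
    | add x y _ _ hx hy => rw [map_add]; exact add_mem hx hy
    | smul c x _ hx => rw [map_smul]; exact Submodule.smul_mem _ _ hx
  induction a using DirectSum.Decomposition.inductionOn
    (fun i : ℕ => ⋀[ℂ]^i (W' →ₗ[ℝ] ℂ)) with
  | zero => simp
  | homogeneous m =>
    rename_i i
    have h1 := hmem i m m.2
    simp only [extProj, GradedAlgebra.proj_apply]
    by_cases h : i = k
    · subst h
      rw [DirectSum.decompose_of_mem_same (fun i : ℕ => ⋀[ℂ]^i (W' →ₗ[ℝ] ℂ)) m.2,
        DirectSum.decompose_of_mem_same (fun i : ℕ => ⋀[ℂ]^i (W →ₗ[ℝ] ℂ)) h1]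
    · rw [DirectSum.decompose_of_mem_ne (fun i : ℕ => ⋀[ℂ]^i (W' →ₗ[ℝ] ℂ)) m.2 h,
        DirectSum.decompose_of_mem_ne (fun i : ℕ => ⋀[ℂ]^i (W →ₗ[ℝ] ℂ)) h1 h, map_zero]
  | add x y hx hy => simp only [map_add, hx, hy]

theorem map_extWedge (u : W →ₗ[ℝ] W') (c : (P × N) →ₗ[ℂ] (P' × N')) (a : Ext W')
    (t : Ext W' ⊗[ℂ] (P × N)) :
    TensorProduct.map (extPullback u).toLinearMap c (extWedge a t) =
      extWedge (extPullback u a) (TensorProduct.map (extPullback u).toLinearMap c t) := by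
  induction t with
  | zero => simp
  | tmul b v => simp [extWedge]
  | add x y hx hy => simp only [map_add, hx, hy]

theorem map_extAct (u : W →ₗ[ℝ] W') (c : P →ₗ[ℂ] P') (c' : P' →ₗ[ℂ] P)
    (hc : c' ∘ₗ c = LinearMap.id) (e : N →ₗ[ℂ] N') (e' : N' →ₗ[ℂ] N)
    (he : e' ∘ₗ e = LinearMap.id) (γ : Ext W' ⊗[ℂ] Module.End ℂ (P × N))
    (t : Ext W' ⊗[ℂ] (P × N)) :
    TensorProduct.map (extPullback u).toLinearMap (c.prodMap e) (extAct γ t) =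
      extAct (TensorProduct.map (extPullback u).toLinearMap
          (conjMap (c.prodMap e) (c'.prodMap e')) γ)
        (TensorProduct.map (extPullback u).toLinearMap (c.prodMap e) t) := by
  have hc' : ∀ v, c' (c v) = v := fun v => DFunLike.congr_fun hc v
  have he' : ∀ v, e' (e v) = v := fun v => DFunLike.congr_fun he v
  induction γ with
  | zero => simp
  | add x y hx hy => simp only [map_add, LinearMap.add_apply, hx, hy]
  | tmul a L =>
    induction t with
    | zero => simp
    | add x y hx hy => simp only [map_add, hx, hy]
    | tmul b v =>
      simp [extAct, conjMap, endEven, endOdd, extPullback_sign, hc', he']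

theorem extStr_map [Module.Finite ℂ P] [Module.Finite ℂ P'] [Module.Finite ℂ N]
    [Module.Finite ℂ N'] (u : W →ₗ[ℝ] W') (c : P →ₗ[ℂ] P') (c' : P' →ₗ[ℂ] P)
    (hc : c' ∘ₗ c = LinearMap.id) (e : N →ₗ[ℂ] N') (e' : N' →ₗ[ℂ] N)
    (he : e' ∘ₗ e = LinearMap.id) (γ : Ext W' ⊗[ℂ] Module.End ℂ (P × N)) :
    extPullback u (extStr γ) =
      extStr (TensorProduct.map (extPullback u).toLinearMap
          (conjMap (c.prodMap e) (c'.prodMap e')) γ) := by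
  induction γ with
  | zero => simp
  | add x y hx hy => simp only [map_add, hx, hy]
  | tmul a L =>
    have h : endStr (conjMap (c.prodMap e) (c'.prodMap e') L) = endStr L := by
      have h1 : LinearMap.fst ℂ P' N' ∘ₗ conjMap (c.prodMap e) (c'.prodMap e') L ∘ₗ
          LinearMap.inl ℂ P' N' =
          c ∘ₗ ((LinearMap.fst ℂ P N ∘ₗ L ∘ₗ LinearMap.inl ℂ P N) ∘ₗ c') := by
        ext; simp [conjMap]
      have h2 : LinearMap.snd ℂ P' N' ∘ₗ conjMap (c.prodMap e) (c'.prodMap e') L ∘ₗ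
          LinearMap.inr ℂ P' N' =
          e ∘ₗ ((LinearMap.snd ℂ P N ∘ₗ L ∘ₗ LinearMap.inr ℂ P N) ∘ₗ e') := by
        ext; simp [conjMap]
      have h3 : ∀ T : Module.End ℂ P, LinearMap.trace ℂ P' (c ∘ₗ (T ∘ₗ c')) =
          LinearMap.trace ℂ P T := fun T => by
        rw [← LinearMap.trace_comp_comm', LinearMap.comp_assoc, hc, LinearMap.comp_id]
      have h4 : ∀ T : Module.End ℂ N, LinearMap.trace ℂ N' (e ∘ₗ (T ∘ₗ e')) =
          LinearMap.trace ℂ N T := fun T => by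
        rw [← LinearMap.trace_comp_comm', LinearMap.comp_assoc, he, LinearMap.comp_id]
      simp only [endStr, LinearMap.coe_mk, AddHom.coe_mk, h1, h2, h3, h4]
    simp [extStr, h]

end Naturality

/-! ### Exterior derivative on `ℝⁿ` -/

section Euclidean

/-- The coordinate `1`-forms `dx¹, …, dxⁿ`, a basis of `Hom_ℝ(ℝⁿ, ℂ)`. -/
def dxBasis (n : ℕ) : Module.Basis (Fin n) ℂ (EuclideanSpace ℝ (Fin n) →ₗ[ℝ] ℂ) :=
  Module.Basis.ofEquivFun ((EuclideanSpace.basisFun (Fin n) ℝ).toBasis.constr ℂ).symm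

/-- The exterior derivative at `y` of a form on `ℝⁿ`:
`d (∑_J g_J dx^J) = ∑_i ∑_J (∂_i g_J) dx^i ∧ dx^J`. -/
def euclExtDeriv {n : ℕ} (g : EuclideanSpace ℝ (Fin n) → Ext (EuclideanSpace ℝ (Fin n)))
    (y : EuclideanSpace ℝ (Fin n)) : Ext (EuclideanSpace ℝ (Fin n)) :=
  ∑ i : Fin n, ∑ J : Finset (Fin n),
    (fderiv ℝ (fun z => (dxBasis n).ExteriorAlgebra.repr (g z) J) y (EuclideanSpace.single i 1)) •
      (ExteriorAlgebra.ι ℂ (dxBasis n i) * (dxBasis n).ExteriorAlgebra J)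

end Euclidean

instance (n : ℕ) : Module.Finite ℂ (Ext (EuclideanSpace ℝ (Fin n))) :=
  Module.Finite.of_basis (dxBasis n).ExteriorAlgebra

/-! ### Forms on a manifold -/

/-- A map into a finite-dimensional complex vector space is smooth at `p` if all its
coordinates (equivalently, its compositions with linear functionals) are. -/
def SmoothCoordAt {n : ℕ} {M : Type*} [TopologicalSpace M]
    [ChartedSpace (EuclideanSpace ℝ (Fin n)) M] {X : Type*} [AddCommGroup X] [Module ℂ X] (g : M → X) (p : M) : Prop :=
  ∀ φ : X →ₗ[ℂ] ℂ, ContMDiffAt (𝓡 n) 𝓘(ℝ, ℂ) ∞ (fun x => φ (g x)) p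

section SmoothCoord

variable {n : ℕ} {M : Type*} [TopologicalSpace M] [ChartedSpace (EuclideanSpace ℝ (Fin n)) M]
  {X Y Z : Type*} [AddCommGroup X] [Module ℂ X] [AddCommGroup Y] [Module ℂ Y]
  [AddCommGroup Z] [Module ℂ Z] {p : M}

theorem SmoothCoordAt.zero : SmoothCoordAt (n := n) (fun _ : M => (0 : X)) p :=
  fun φ => by simpa using contMDiffAt_const

theorem SmoothCoordAt.add {g h : M → X} (hg : SmoothCoordAt (n := n) g p)
    (hh : SmoothCoordAt (n := n) h p) : SmoothCoordAt (n := n) (fun x => g x + h x) p :=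
  fun φ => by
    have := (hg φ).add (hh φ)
    exact this.congr_of_eventuallyEq (Filter.Eventually.of_forall fun x => by simp)

theorem SmoothCoordAt.linear {g : M → X} (hg : SmoothCoordAt (n := n) g p) (T : X →ₗ[ℂ] Y) :
    SmoothCoordAt (n := n) (fun x => T (g x)) p :=
  fun φ => hg (φ ∘ₗ T)

theorem SmoothCoordAt.congr {g h : M → X} (hg : SmoothCoordAt (n := n) g p)
    (e : ∀ᶠ x in nhds p, h x = g x) : SmoothCoordAt (n := n) h p :=
  fun φ => (hg φ).congr_of_eventuallyEq (e.mono fun x hx => by simp [hx])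

theorem SmoothCoordAt.bilinear [Module.Finite ℂ X] [Module.Finite ℂ Y] {g : M → X} {h : M → Y}
    (hg : SmoothCoordAt (n := n) g p) (hh : SmoothCoordAt (n := n) h p)
    (T : X →ₗ[ℂ] Y →ₗ[ℂ] Z) : SmoothCoordAt (n := n) (fun x => T (g x) (h x)) p := by
  intro φ
  let b := Module.finBasis ℂ X
  let c := Module.finBasis ℂ Y
  have hmul : ContDiff ℝ ∞ (fun q : ℂ × ℂ => q.1 * q.2) := contDiff_fst.mul contDiff_snd
  have key : ∀ x, φ (T (g x) (h x)) =
      ∑ i, ∑ j, (b.coord i (g x) * c.coord j (h x)) * φ (T (b i) (c j)) := by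
    intro x
    have e := LinearMap.sum_repr_mul_repr_mul b c (B := T.compr₂ φ) (g x) (h x)
    rw [LinearMap.compr₂_apply] at e
    rw [← e, Finsupp.sum_fintype _ _ (by simp)]
    refine Finset.sum_congr rfl fun i _ => ?_
    rw [Finsupp.sum_fintype _ _ (by simp)]
    simp [mul_assoc]
  have hterm : ∀ i j, ContMDiffAt (𝓡 n) 𝓘(ℝ, ℂ) ∞
      (fun x => (b.coord i (g x) * c.coord j (h x)) * φ (T (b i) (c j))) p := by
    intro i j
    have h1 := hmul.contMDiff.contMDiffAt.comp p
      ((hg (b.coord i)).prodMk_space (hh (c.coord j)))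
    exact hmul.contMDiff.contMDiffAt.comp p (h1.prodMk_space contMDiffAt_const)
  refine ContMDiffAt.congr_of_eventuallyEq ?_ (Filter.Eventually.of_forall key)
  exact contMDiffAt_finsetSum fun i _ => contMDiffAt_finsetSum fun j _ => hterm i j

theorem SmoothCoordAt.differentiableAt {g : M → X}
    (hg : SmoothCoordAt (n := n) g p) (φ : X →ₗ[ℂ] ℂ) :
    DifferentiableAt ℝ (fun y => φ (g ((extChartAt (𝓡 n) p).symm y))) (extChartAt (𝓡 n) p p) := by
  have h := (contMDiffAt_iff.1 (hg φ)).2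
  simp only [modelWithCornersSelf_coe, Set.range_id, contDiffWithinAt_univ] at h
  exact h.differentiableAt (by simp)

end SmoothCoord

section Manifold

variable (n : ℕ) (M : Type*) [TopologicalSpace M] [ChartedSpace (EuclideanSpace ℝ (Fin n)) M]
  [IsManifold (𝓡 n) ∞ M]

/-- The identification `ℝⁿ → T_x M` given by the chart at `p`, for `x` in that chart. -/
def tangentFrame (p x : M) : EuclideanSpace ℝ (Fin n) →ₗ[ℝ] TangentSpace (𝓡 n) x :=
  (trivializationAt (EuclideanSpace ℝ (Fin n)) (TangentSpace (𝓡 n)) p).symmₗ ℝ x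

/-- The identification `T_x M → ℝⁿ` given by the chart at `p`, for `x` in that chart. -/
def tangentCoframe (p x : M) : TangentSpace (𝓡 n) x →ₗ[ℝ] EuclideanSpace ℝ (Fin n) :=
  (trivializationAt (EuclideanSpace ℝ (Fin n)) (TangentSpace (𝓡 n)) p).linearMapAt ℝ x

/-- All families `(α_x)_{x ∈ M}` with `α_x ∈ Λ(T_x^* M) ⊗ ℂ`, with no regularity. -/
abbrev RawForm : Type _ := ∀ x : M, Ext (TangentSpace (𝓡 n) x)

/-- The smooth complex-valued differential forms (of mixed degree), i.e. the families whose
coefficients in local coordinates are smooth. -/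
def formSubmodule : Submodule ℂ (RawForm n M) where
  carrier := {α | ∀ p : M, SmoothCoordAt (n := n)
    (fun x => extPullback (tangentFrame n M p x) (α x)) p}
  zero_mem' := fun p => by simpa using SmoothCoordAt.zero
  add_mem' := fun ha hb p => by simpa using (ha p).add (hb p)
  smul_mem' := fun c a ha p => by
    simpa using (ha p).linear (LinearMap.lsmul ℂ _ c)

/-- `Ω(M)`: the space of smooth complex-valued differential forms on `M`. -/
def Form : Type _ := formSubmodule n M

instance : AddCommGroup (Form n M) := inferInstanceAs (AddCommGroup (formSubmodule n M))

instance : Module ℂ (Form n M) := inferInstanceAs (Module ℂ (formSubmodule n M))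

/-- The inclusion of smooth forms in all families. -/
def formIncl : Form n M →ₗ[ℂ] RawForm n M := (formSubmodule n M).subtype

variable {n M} in
/-- The exterior derivative, computed at `p` in the chart at `p`. -/
def rawExtDeriv (α : RawForm n M) : RawForm n M := fun p =>
  extPullback (tangentCoframe n M p p)
    (euclExtDeriv
      (fun y => extPullback (tangentFrame n M p ((extChartAt (𝓡 n) p).symm y))
        (α ((extChartAt (𝓡 n) p).symm y)))
      (extChartAt (𝓡 n) p p))

/-- The exterior derivative `d` on `Ω(M)`. -/
def extDeriv : Form n M →ₗ[ℂ] RawForm n M where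
  toFun α := rawExtDeriv α.1
  map_add' α β := by
    funext p
    have hadd : (α + β).1 = α.1 + β.1 := rfl
    have hd : ∀ (γ : Form n M) (J : Finset (Fin n)), _ := fun γ J =>
      (γ.2 p).differentiableAt ((dxBasis n).ExteriorAlgebra.coord J)
    simp only [Module.Basis.coord_apply] at hd
    simp only [rawExtDeriv, Pi.add_apply, ← map_add, euclExtDeriv, ← Finset.sum_add_distrib,
      ← add_smul]
    congr 1
    refine Finset.sum_congr rfl fun i _ => Finset.sum_congr rfl fun J _ => ?_
    congr 1
    have := fderiv_add (hd α J) (hd β J)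
    rw [← add_apply, ← this]
    congr 2
    funext y
    simp only [Pi.add_apply, hadd, map_add, Finsupp.add_apply]
  map_smul' c α := by
    funext p
    have hsmul : (c • α).1 = c • α.1 := rfl
    have hd : ∀ (γ : Form n M) (J : Finset (Fin n)), _ := fun γ J =>
      (γ.2 p).differentiableAt ((dxBasis n).ExteriorAlgebra.coord J)
    simp only [Module.Basis.coord_apply] at hd
    simp only [rawExtDeriv, Pi.smul_apply, RingHom.id_apply, ← map_smul, euclExtDeriv,
      Finset.smul_sum, smul_smul]
    congr 1
    refine Finset.sum_congr rfl fun i _ => Finset.sum_congr rfl fun J _ => ?_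
    congr 1
    have := fderiv_const_mul (hd α J) c
    rw [← smul_eq_mul, ← smul_apply, ← this]
    congr 2
    funext y
    simp only [hsmul, Pi.smul_apply, map_smul, Finsupp.smul_apply, smul_eq_mul]

end Manifold

/-! ### Superbundle-valued forms -/

section VectorBundle

variable {M : Type*} [TopologicalSpace M] (F : Type*) [NormedAddCommGroup F] [NormedSpace ℂ F]
  (V : M → Type*) [∀ x, AddCommGroup (V x)] [∀ x, Module ℂ (V x)]
  [∀ x, TopologicalSpace (V x)] [TopologicalSpace (TotalSpace F V)]
  [FiberBundle F V] [VectorBundle ℂ F V]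

/-- The local trivialisation at `p` of a vector bundle, over `x`. -/
def fibreCoord (p x : M) : V x →ₗ[ℂ] F := (trivializationAt F V p).linearMapAt ℂ x

/-- The inverse of the local trivialisation at `p`, over `x`. -/
def fibreFrame (p x : M) : F →ₗ[ℂ] V x := (trivializationAt F V p).symmₗ ℂ x

theorem fibreFrame_comp_coord (p x : M) (hx : x ∈ (trivializationAt F V p).baseSet) :
    fibreFrame F V p x ∘ₗ fibreCoord F V p x = LinearMap.id := by
  ext v
  exact (trivializationAt F V p).symmₗ_linearMapAt hx v

end VectorBundle

theorem eventually_mem_baseSet {M : Type*} [TopologicalSpace M] (F : Type*) [TopologicalSpace F]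
    (V : M → Type*) [∀ x, TopologicalSpace (V x)] [TopologicalSpace (TotalSpace F V)]
    [FiberBundle F V] (p : M) : ∀ᶠ x in nhds p, x ∈ (trivializationAt F V p).baseSet :=
  (trivializationAt F V p).open_baseSet.mem_nhds (FiberBundle.mem_baseSet_trivializationAt' p)

section Superbundle

variable {n : ℕ} {M : Type*} [TopologicalSpace M] [ChartedSpace (EuclideanSpace ℝ (Fin n)) M]
  [IsManifold (𝓡 n) ∞ M]
  (Fp : Type*) [NormedAddCommGroup Fp] [NormedSpace ℂ Fp] [FiniteDimensional ℂ Fp]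
  (Ep : M → Type*) [∀ x, AddCommGroup (Ep x)] [∀ x, Module ℂ (Ep x)]
  [∀ x, TopologicalSpace (Ep x)] [TopologicalSpace (TotalSpace Fp Ep)]
  [FiberBundle Fp Ep] [VectorBundle ℂ Fp Ep]
  (Fm : Type*) [NormedAddCommGroup Fm] [NormedSpace ℂ Fm] [FiniteDimensional ℂ Fm]
  (Em : M → Type*) [∀ x, AddCommGroup (Em x)] [∀ x, Module ℂ (Em x)]
  [∀ x, TopologicalSpace (Em x)] [TopologicalSpace (TotalSpace Fm Em)]
  [FiberBundle Fm Em] [VectorBundle ℂ Fm Em]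

/-- The coordinate expression at `x` of an `E`-valued form, in the chart of `M` and the
trivialisations of `E⁺` and `E⁻` at `p`. -/
def eCoord (p x : M) : (Ext (TangentSpace (𝓡 n) x) ⊗[ℂ] (Ep x × Em x)) →ₗ[ℂ]
    (Ext (EuclideanSpace ℝ (Fin n)) ⊗[ℂ] (Fp × Fm)) :=
  TensorProduct.map (extPullback (tangentFrame n M p x)).toLinearMap
    ((fibreCoord Fp Ep p x).prodMap (fibreCoord Fm Em p x))

/-- The coordinate expression at `x` of an `End(E)`-valued form, in the chart of `M` and the
trivialisations of `E⁺` and `E⁻` at `p`. -/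
def endCoord (p x : M) : (Ext (TangentSpace (𝓡 n) x) ⊗[ℂ] Module.End ℂ (Ep x × Em x)) →ₗ[ℂ]
    (Ext (EuclideanSpace ℝ (Fin n)) ⊗[ℂ] Module.End ℂ (Fp × Fm)) :=
  TensorProduct.map (extPullback (tangentFrame n M p x)).toLinearMap
    (conjMap ((fibreCoord Fp Ep p x).prodMap (fibreCoord Fm Em p x))
      ((fibreFrame Fp Ep p x).prodMap (fibreFrame Fm Em p x)))

/-- The `E`-valued forms for the superbundle `E = E⁺ ⊕ E⁻`: smooth sections of `Λ T^*M ⊗ E`. -/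
def eFormSubmodule : Submodule ℂ (∀ x : M, Ext (TangentSpace (𝓡 n) x) ⊗[ℂ] (Ep x × Em x)) where
  carrier := {θ | ∀ p : M, SmoothCoordAt (n := n) (fun x => eCoord Fp Ep Fm Em p x (θ x)) p}
  zero_mem' := fun p => by simpa using SmoothCoordAt.zero
  add_mem' := fun ha hb p => by simpa using (ha p).add (hb p)
  smul_mem' := fun c a ha p => by
    simpa using (ha p).linear (LinearMap.lsmul ℂ _ c)

/-- The `End(E)`-valued forms: smooth sections of `Λ T^*M ⊗ End(E)`. -/
def endFormSubmodule :
    Submodule ℂ (∀ x : M, Ext (TangentSpace (𝓡 n) x) ⊗[ℂ] Module.End ℂ (Ep x × Em x)) where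
  carrier := {γ | ∀ p : M, SmoothCoordAt (n := n) (fun x => endCoord Fp Ep Fm Em p x (γ x)) p}
  zero_mem' := fun p => by simpa using SmoothCoordAt.zero
  add_mem' := fun ha hb p => by simpa using (ha p).add (hb p)
  smul_mem' := fun c a ha p => by
    simpa using (ha p).linear (LinearMap.lsmul ℂ _ c)

/-- `Ω(M, E)`: the space of smooth `E`-valued forms. -/
def EForm : Type _ := eFormSubmodule (n := n) Fp Ep Fm Em

instance : AddCommGroup (EForm (n := n) Fp Ep Fm Em) :=
  inferInstanceAs (AddCommGroup (eFormSubmodule (n := n) Fp Ep Fm Em))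

instance : Module ℂ (EForm (n := n) Fp Ep Fm Em) :=
  inferInstanceAs (Module ℂ (eFormSubmodule (n := n) Fp Ep Fm Em))

/-- `Ω(M, End E)`: the space of smooth `End(E)`-valued forms. -/
def EndForm : Type _ := endFormSubmodule (n := n) Fp Ep Fm Em

instance : AddCommGroup (EndForm (n := n) Fp Ep Fm Em) :=
  inferInstanceAs (AddCommGroup (endFormSubmodule (n := n) Fp Ep Fm Em))

instance : Module ℂ (EndForm (n := n) Fp Ep Fm Em) :=
  inferInstanceAs (Module ℂ (endFormSubmodule (n := n) Fp Ep Fm Em))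

variable {Fp Ep Fm Em}

/-- `α ∧ θ` for `α ∈ Ω(M)` and `θ ∈ Ω(M, E)`. -/
def wedge (α : Form n M) : EForm (n := n) Fp Ep Fm Em →ₗ[ℂ] EForm (n := n) Fp Ep Fm Em where
  toFun θ := ⟨fun x => extWedge (α.1 x) (θ.1 x), fun p =>
    ((α.2 p).bilinear (θ.2 p) extWedge).congr
      (Filter.Eventually.of_forall fun _ => map_extWedge _ _ _ _)⟩
  map_add' _ _ := Subtype.ext <| funext fun x => map_add (extWedge (α.1 x)) _ _
  map_smul' _ _ := Subtype.ext <| funext fun x => map_smul (extWedge (α.1 x)) _ _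

/-- The action of `Ω(M, End E)` on `Ω(M, E)`. -/
def act (γ : EndForm (n := n) Fp Ep Fm Em) :
    EForm (n := n) Fp Ep Fm Em →ₗ[ℂ] EForm (n := n) Fp Ep Fm Em where
  toFun θ := ⟨fun x => extAct (γ.1 x) (θ.1 x), fun p => by
    refine ((γ.2 p).bilinear (θ.2 p) extAct).congr ?_
    filter_upwards [eventually_mem_baseSet Fp Ep p, eventually_mem_baseSet Fm Em p] with x h1 h2
    exact map_extAct _ _ _ (fibreFrame_comp_coord Fp Ep p x h1) _ _
      (fibreFrame_comp_coord Fm Em p x h2) _ _⟩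
  map_add' _ _ := Subtype.ext <| funext fun x => map_add (extAct (γ.1 x)) _ _
  map_smul' _ _ := Subtype.ext <| funext fun x => map_smul (extAct (γ.1 x)) _ _

/-- The supertrace `Str : Ω(M, End E) → Ω(M)`. -/
def supertrace (γ : EndForm (n := n) Fp Ep Fm Em) : Form n M :=
  ⟨fun x => extStr (γ.1 x), fun p => by
    refine ((γ.2 p).linear extStr).congr ?_
    filter_upwards [eventually_mem_baseSet Fp Ep p, eventually_mem_baseSet Fm Em p] with x h1 h2
    have _f1 : Module.Finite ℂ (Ep x) :=
      Module.Finite.equiv ((trivializationAt Fp Ep p).linearEquivAt ℂ x h1).symm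
    have _f2 : Module.Finite ℂ (Em x) :=
      Module.Finite.equiv ((trivializationAt Fm Em p).linearEquivAt ℂ x h2).symm
    exact extStr_map _ _ _ (fibreFrame_comp_coord Fp Ep p x h1) _ _
      (fibreFrame_comp_coord Fm Em p x h2) _⟩

/-- `θ` lies in `Ω⁺(M, E)` (`s = 1`) or in `Ω⁻(M, E)` (`s = -1`): its total degree is even,
respectively odd. -/
def HasParity (s : ℤˣ) (θ : EForm (n := n) Fp Ep Fm Em) : Prop :=
  ∀ x, totalSign (θ.1 x) = (s : ℤ) • θ.1 x

/-- `γ` lies in `Ω⁺(M, End E)` (`s = 1`) or in `Ω⁻(M, End E)` (`s = -1`). -/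
def EndHasParity (s : ℤˣ) (γ : EndForm (n := n) Fp Ep Fm Em) : Prop :=
  ∀ x, totalSignEnd (γ.1 x) = (s : ℤ) • γ.1 x

/-- A superconnection on `E`: a `ℂ`-linear operator on `Ω(M, E)` exchanging `Ω⁺(M, E)` and
`Ω⁻(M, E)` and satisfying `A(α ∧ θ) = dα ∧ θ + (-1)^{|α|} α ∧ Aθ`. (By the Leibniz rule such an
operator is automatically a first-order differential operator.) -/
structure IsSuperconnection (A : Module.End ℂ (EForm (n := n) Fp Ep Fm Em)) : Prop where
  odd : ∀ (s : ℤˣ) (θ : EForm (n := n) Fp Ep Fm Em), HasParity s θ → HasParity (-s) (A θ)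
  leibniz : ∀ (α : Form n M) (θ : EForm (n := n) Fp Ep Fm Em) (x : M),
    (A (wedge α θ)).1 x =
      extWedge (extDeriv n M α x) (θ.1 x) + extWedge (extSign (α.1 x)) ((A θ).1 x)

/-- The map `(α, β) ↦ (Aα + σ ∧ β, Bα - Aβ)` on `Ω(M, E) ⊕ Ω(M, E)`. -/
def primitiveOp (σ : Form n M) (A : Module.End ℂ (EForm (n := n) Fp Ep Fm Em))
    (B : EndForm (n := n) Fp Ep Fm Em) :
    Module.End ℂ (EForm (n := n) Fp Ep Fm Em × EForm (n := n) Fp Ep Fm Em) :=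
  LinearMap.prod
    (A ∘ₗ LinearMap.fst ℂ _ _ + wedge σ ∘ₗ LinearMap.snd ℂ _ _)
    (act B ∘ₗ LinearMap.fst ℂ _ _ - A ∘ₗ LinearMap.snd ℂ _ _)

/-- A primitive superconnection on `E`: the operator `primitiveOp σ A B` of a superconnection
`A` and an element `B ∈ Ω⁺(M, End E)`. -/
def IsPrimitiveSuperconnection (σ : Form n M)
    (T : Module.End ℂ (EForm (n := n) Fp Ep Fm Em × EForm (n := n) Fp Ep Fm Em)) : Prop :=
  ∃ (A : Module.End ℂ (EForm (n := n) Fp Ep Fm Em)) (B : EndForm (n := n) Fp Ep Fm Em),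
    IsSuperconnection A ∧ EndHasParity 1 B ∧ T = primitiveOp σ A B

/-- The operator `T` is identified with the pair `(γ, δ)` of `End(E)`-valued forms:
`T(α, β) = (γ α, δ α + γ₁ β⁺ - γ₂ β⁻ - γ₃ β⁺ + γ₄ β⁻)`, where `γ₁, γ₄` are the parity-preserving
and `γ₂, γ₃` the parity-reversing blocks of the operator `γ`. The `β`-term is the conjugate of
`γ` by the total parity operator. -/
def IsIdentifiedWith
    (T : Module.End ℂ (EForm (n := n) Fp Ep Fm Em × EForm (n := n) Fp Ep Fm Em))
    (s : EndForm (n := n) Fp Ep Fm Em × EndForm (n := n) Fp Ep Fm Em) : Prop :=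
  ∀ (α β : EForm (n := n) Fp Ep Fm Em) (x : M),
    (T (α, β)).1.1 x = extAct (s.1.1 x) (α.1 x) ∧
    (T (α, β)).2.1 x = extAct (s.2.1 x) (α.1 x) +
      totalSign (extAct (s.1.1 x) (totalSign (β.1 x)))

open Classical in
/-- The supertrace `(Str γ, Str δ) ∈ Ω(M) ⊕ Ω(M)` of an operator on `Ω(M, E) ⊕ Ω(M, E)` that is
identified with the pair `(γ, δ)` (and `0` if there is no such pair). -/
def boldStr (T : Module.End ℂ (EForm (n := n) Fp Ep Fm Em × EForm (n := n) Fp Ep Fm Em)) :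
    Form n M × Form n M :=
  if h : ∃ s, IsIdentifiedWith T s then
    (supertrace h.choose.1, supertrace h.choose.2)
  else 0

end Superbundle

/-! ### Symplectic forms and the primitive cohomology -/

section Primitive

variable {n : ℕ} {M : Type*} [TopologicalSpace M] [ChartedSpace (EuclideanSpace ℝ (Fin n)) M]
  [IsManifold (𝓡 n) ∞ M]

/-- `Ω^k(M)` -/
def FormDeg (n : ℕ) (M : Type*) [TopologicalSpace M]
    [ChartedSpace (EuclideanSpace ℝ (Fin n)) M] [IsManifold (𝓡 n) ∞ M] (k : ℕ) :
    Submodule ℂ (Form n M) where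
  carrier := {α | ∀ x, α.1 x ∈ (⋀[ℂ]^k (TangentSpace (𝓡 n) x →ₗ[ℝ] ℂ))}
  zero_mem' := fun _ => Submodule.zero_mem _
  add_mem' := fun ha hb x => Submodule.add_mem _ (ha x) (hb x)
  smul_mem' := fun c _ ha x => Submodule.smul_mem _ c (ha x)

/-- A symplectic form: a closed, real, nondegenerate `2`-form. -/
structure IsSymplectic (σ : Form n M) : Prop where
  deg_two : σ ∈ FormDeg n M 2
  real : ∀ (x : M) (v w : TangentSpace (𝓡 n) x), ∃ r : ℝ,
    extContract w (extContract v (σ.1 x)) = algebraMap ℂ _ (r : ℂ)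
  closed : extDeriv n M σ = 0
  nondegenerate : ∀ (x : M) (v : TangentSpace (𝓡 n) x), extContract v (σ.1 x) = 0 → v = 0

/-- `∂(α, β) = (dα + σ ∧ β, -dβ)` on `Ω(M) ⊕ Ω(M)`. -/
def boundary (σ : Form n M) : (Form n M × Form n M) →ₗ[ℂ] (RawForm n M × RawForm n M) :=
  LinearMap.prod
    (extDeriv n M ∘ₗ LinearMap.fst ℂ _ _ +
      (LinearMap.mulLeft ℂ (formIncl n M σ) ∘ₗ formIncl n M) ∘ₗ LinearMap.snd ℂ _ _)
    (-(extDeriv n M ∘ₗ LinearMap.snd ℂ _ _))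

/-- The inclusion of pairs of smooth forms in pairs of families of fibre elements. -/
def inclPair (n : ℕ) (M : Type*) [TopologicalSpace M]
    [ChartedSpace (EuclideanSpace ℝ (Fin n)) M] [IsManifold (𝓡 n) ∞ M] :
    (Form n M × Form n M) →ₗ[ℂ] (RawForm n M × RawForm n M) :=
  (formIncl n M).prodMap (formIncl n M)

/-- The degree-`i` term `Ω^i(M) ⊕ Ω^{i-1}(M)` of the primitive complex
(with `Ω^{-1}(M) = 0`). -/
def primitiveChain (n : ℕ) (M : Type*) [TopologicalSpace M]
    [ChartedSpace (EuclideanSpace ℝ (Fin n)) M] [IsManifold (𝓡 n) ∞ M] :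
    ℕ → Submodule ℂ (Form n M × Form n M)
  | 0 => (FormDeg n M 0).prod ⊥
  | i + 1 => (FormDeg n M (i + 1)).prod (FormDeg n M i)

/-- The `∂`-closed elements of `Ω^i(M) ⊕ Ω^{i-1}(M)`. -/
def primitiveCocycle (σ : Form n M) (i : ℕ) : Submodule ℂ (Form n M × Form n M) :=
  primitiveChain n M i ⊓ LinearMap.ker (boundary σ)

/-- The image of `∂ : Ω^{i-1}(M) ⊕ Ω^{i-2}(M) → Ω^i(M) ⊕ Ω^{i-1}(M)`. -/
def primitiveCoboundary (σ : Form n M) : ℕ → Submodule ℂ (Form n M × Form n M)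
  | 0 => ⊥
  | i + 1 => ((primitiveChain n M i).map (boundary σ)).comap (inclPair n M)

/-- The primitive cohomology of `(M, σ)` in degree `i`. -/
abbrev PrimitiveCohomology (σ : Form n M) (i : ℕ) : Type _ :=
  primitiveCocycle σ i ⧸ (primitiveCoboundary σ i).comap (primitiveCocycle σ i).subtype

/-- The component in `Ω^k(M)` of a form. -/
def formComponent (k : ℕ) (α : Form n M) : Form n M :=
  ⟨fun x => extProj k (α.1 x), fun p =>
    ((α.2 p).linear (extProj k)).congr
      (Filter.Eventually.of_forall fun _ => extPullback_proj _ _ _)⟩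

/-- The component in `Ω^i(M) ⊕ Ω^{i-1}(M)` of a pair of forms. -/
def pairComponent : ℕ → Form n M × Form n M → Form n M × Form n M
  | 0, c => (formComponent 0 c.1, 0)
  | i + 1, c => (formComponent (i + 1) c.1, formComponent i c.2)

/-- `η = ∫_a^b F_t dt` for a family `F_t` of differential forms: at every point, the coordinates
of `F_t` are integrable in `t` and their integrals are the coordinates of `η`. -/
def IsFormIntegral (F : ℝ → Form n M) (a b : ℝ) (η : Form n M) : Prop :=
  ∀ (x : M) (φ : Ext (TangentSpace (𝓡 n) x) →ₗ[ℂ] ℂ),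
    IntervalIntegrable (fun t => φ ((F t).1 x)) MeasureTheory.volume a b ∧
      φ (η.1 x) = ∫ t in a..b, φ ((F t).1 x)

end Primitive

end

end PrimitiveChernWeil

/-!
The theorem is Quillen's transgression argument for the operators on `Ω(M, E) ⊕ Ω(M, E)`.

The local input is that an operator on `Ω(M, E)` with `T(α ∧ θ) = κ dα ∧ θ + s^{|α|} α ∧ Tθ` is, in
coordinates, `κ d` plus the action of an element of `Λ ⊗ End` (`IsLeibniz.exists_local`). For
`κ = 0` this identifies the operators that supercommute with the forms with the elements of
`Ω(M, End E)` (`IsLeibniz.exists_act`); they include the squares of superconnections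
(`IsLeibniz.square`) and the supercommutators of superconnections with elements of `Ω(M, End E)`
(`IsLeibniz.supercommutator`). That `A²` is linear over the forms needs `d² = 0`; as linearity is a
local property, it suffices to test it on the sums of products of functions and coordinate
differentials, for which `d² = 0` follows from the symmetry of second derivatives
(`exists_hasClosedDeriv`). Together with the vanishing of the pointwise supertrace on
supercommutators, the local form of a superconnection `A` gives `Str [A, γ] = d Str γ`
(`supertrace_superconnection`).

For pairs, the operators `(α, β) ↦ (γ α, δ α + s γ β)`, with `γ` of parity `s` and `δ` of parity
`-s`, form a `ℤ/2`-graded algebra `pairSpace` on which the supertrace vanishes on supercommutators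
(`boldStr_supercommutator`). It contains the curvature `𝔸²` and the difference `𝔸₁ - 𝔸₀`, is stable
under supercommutators with a primitive superconnection `𝔸`, and `Str [𝔸, x] = ∂ Str x`
(`IsPrimitiveSuperconnection.supercommutator`). In particular `∂ Str f(𝔸²) = Str [𝔸, f(𝔸²)] = 0`.

With `a = 𝔸₁ - 𝔸₀`, cyclicity of the supertrace gives
`d/dt Str f(𝔸_t²) = Str [𝔸_t, a f'(𝔸_t²)] = ∂ Str (a f'(𝔸_t²))`. All these expressions are
polynomials in `t`, so this is an identity between coefficients of polynomials over the algebra of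
operators, and integration over `[0, 1]` amounts to dividing the coefficient of `t^k` by `k + 1`
(`IsSupertrace.transgression`, `isFormIntegral_polynomial`). The cohomological statement follows
because `∂` is homogeneous of degree one (`boundary_pairComponent`).
-/

namespace PrimitiveChernWeil

noncomputable section

set_option linter.unusedSectionVars false

/-! ### Signs and the action in one fibre -/

section FibreAlgebra

variable {W : Type*} [AddCommGroup W] [Module ℝ W]
  {P N : Type*} [AddCommGroup P] [Module ℂ P] [AddCommGroup N] [Module ℂ N]

/-- The automorphism `a ↦ s^{|a|} a` of `Λ(W*) ⊗ ℂ`, for a sign `s`. -/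
def extSgn (s : ℤˣ) : Ext W →ₐ[ℂ] Ext W := if s = 1 then AlgHom.id ℂ _ else extSign

@[simp] theorem extSgn_one (a : Ext W) : extSgn 1 a = a := by simp [extSgn]

@[simp] theorem extSgn_neg_one (a : Ext W) : extSgn (-1) a = extSign a := by
  simp [extSgn]

@[simp] theorem extSign_extSign (a : Ext W) : extSign (extSign a) = a :=
  CliffordAlgebra.involute_involute a

theorem extSgn_extSgn (s t : ℤˣ) (a : Ext W) : extSgn s (extSgn t a) = extSgn (s * t) a := by
  rcases Int.units_eq_one_or s with rfl | rfl <;> rcases Int.units_eq_one_or t with rfl | rfl <;>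
    simp

theorem extSgn_mem {u : ℤˣ} {a : Ext W} (ha : extSign a = (u : ℤ) • a) (s : ℤˣ) :
    extSgn s a = if s = 1 then a else (u : ℤ) • a := by
  rcases Int.units_eq_one_or s with rfl | rfl <;> simp [ha]

theorem mul_ι_eq (l : W →ₗ[ℝ] ℂ) (b : Ext W) :
    b * ExteriorAlgebra.ι ℂ l = ExteriorAlgebra.ι ℂ l * extSign b := by
  induction b using ExteriorAlgebra.induction with
  | algebraMap r => simp only [AlgHom.commutes]; exact Algebra.commutes r _
  | ι m =>
    rw [extSign_ι, mul_neg]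
    exact eq_neg_of_add_eq_zero_left (ExteriorAlgebra.ι_add_mul_swap m l)
  | mul a b ha hb => rw [map_mul, mul_assoc, hb, ← mul_assoc, ha, mul_assoc]
  | add a b ha hb => rw [map_add, mul_add, add_mul, ha, hb]

/-- Graded commutativity of the wedge product. -/
theorem mul_eq_extSgn_mul {u : ℤˣ} {b : Ext W} (hb : extSign b = (u : ℤ) • b) (a : Ext W) :
    b * a = extSgn u a * b := by
  induction a using ExteriorAlgebra.induction with
  | algebraMap r => rw [AlgHom.commutes]; exact (Algebra.commutes r _).symm
  | ι m =>
    rw [mul_ι_eq, hb]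
    rcases Int.units_eq_one_or u with rfl | rfl
    · simp
    · simp [extSign_ι]
  | mul a a' ha hb => rw [map_mul, ← mul_assoc, ha, mul_assoc, hb, mul_assoc]
  | add a a' ha hb => rw [map_add, mul_add, add_mul, ha, hb]

theorem extAct_tmul (a b : Ext W) (L : Module.End ℂ (P × N)) (v : P × N) :
    extAct (a ⊗ₜ[ℂ] L) (b ⊗ₜ[ℂ] v) =
      (a * b) ⊗ₜ endEven L v + (a * extSign b) ⊗ₜ endOdd L v := by
  simp [extAct]

theorem extWedge_tmul (a b : Ext W) (v : P × N) :
    extWedge a (b ⊗ₜ[ℂ] v) = (a * b) ⊗ₜ[ℂ] v := by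
  simp [extWedge]

theorem extStr_tmul (a : Ext W) (L : Module.End ℂ (P × N)) :
    extStr (a ⊗ₜ[ℂ] L) = endStr L • a := by
  simp [extStr]

theorem extWedge_mul (a b : Ext W) (t : Ext W ⊗[ℂ] (P × N)) :
    extWedge (a * b) t = extWedge a (extWedge b t) := by
  induction t with
  | zero => simp
  | tmul c v => simp [extWedge_tmul, mul_assoc]
  | add x y hx hy => simp only [map_add, hx, hy]

@[simp] theorem extWedge_one (t : Ext W ⊗[ℂ] (P × N)) : extWedge 1 t = t := by
  induction t with
  | zero => simp
  | tmul c v => simp [extWedge_tmul]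
  | add x y hx hy => simp only [map_add, hx, hy]

theorem extWedge_algebraMap (c : ℂ) (t : Ext W ⊗[ℂ] (P × N)) :
    extWedge (algebraMap ℂ _ c) t = c • t := by
  rw [Algebra.algebraMap_eq_smul_one]; simp

theorem totalSign_extWedge (a : Ext W) (t : Ext W ⊗[ℂ] (P × N)) :
    totalSign (extWedge a t) = extWedge (extSign a) (totalSign t) := by
  induction t with
  | zero => simp
  | tmul c v => simp [extWedge_tmul, totalSign]
  | add x y hx hy => simp only [map_add, hx, hy]

@[simp] theorem superSign_superSign (v : P × N) : superSign (superSign v) = v := by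
  simp [superSign]

@[simp] theorem totalSign_totalSign (t : Ext W ⊗[ℂ] (P × N)) : totalSign (totalSign t) = t := by
  induction t with
  | zero => simp
  | tmul c v => simp [totalSign]
  | add x y hx hy => simp only [map_add, hx, hy]

/-! ### Homogeneous endomorphisms of the superspace `P ⊕ N` -/

theorem endEven_add_endOdd (L : Module.End ℂ (P × N)) : endEven L + endOdd L = L := by
  simp [endOdd]

theorem endParity_eq (L : Module.End ℂ (P × N)) :
    (endEven - endOdd : Module.End ℂ (P × N) →ₗ[ℂ] _) L = superSign ∘ₗ L ∘ₗ superSign := by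
  have e : ∀ x : N, ((0 : P), -x) = -(0, x) := fun x => by simp
  have e0 : L (0, 0) = 0 := map_zero L
  ext <;> simp [endOdd, endEven, superSign, e, e0, -Prod.neg_mk]

theorem endEven_endEven (L : Module.End ℂ (P × N)) : endEven (endEven L) = endEven L := by
  ext <;> simp [endEven]

theorem endEven_endOdd (L : Module.End ℂ (P × N)) : endEven (endOdd L) = 0 := by
  simp [endOdd, endEven_endEven]

theorem endOdd_endEven (L : Module.End ℂ (P × N)) : endOdd (endEven L) = 0 := by
  simp [endOdd, endEven_endEven]

theorem endOdd_endOdd (L : Module.End ℂ (P × N)) : endOdd (endOdd L) = endOdd L := by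
  have := endEven_add_endOdd (endOdd L)
  rwa [endEven_endOdd, zero_add] at this

/-- `L` is even (`r = 1`) or odd (`r = -1`). -/
def EndPar (r : ℤˣ) (L : Module.End ℂ (P × N)) : Prop :=
  (r = 1 ∧ endOdd L = 0) ∨ (r = -1 ∧ endEven L = 0)

theorem endPar_endEven (L : Module.End ℂ (P × N)) : EndPar 1 (endEven L) :=
  Or.inl ⟨rfl, endOdd_endEven L⟩

theorem endPar_endOdd (L : Module.End ℂ (P × N)) : EndPar (-1) (endOdd L) :=
  Or.inr ⟨rfl, endEven_endOdd L⟩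

theorem EndPar.conj {r : ℤˣ} {L : Module.End ℂ (P × N)} (h : EndPar r L) :
    superSign ∘ₗ L ∘ₗ superSign = (r : ℤ) • L := by
  rw [← endParity_eq]
  have := endEven_add_endOdd L
  rcases h with ⟨rfl, h⟩ | ⟨rfl, h⟩
  · rw [h, add_zero] at this; simp [h, this]
  · rw [h, zero_add] at this; simp [h, this]

theorem EndPar.superSign_apply {r : ℤˣ} {L : Module.End ℂ (P × N)} (h : EndPar r L) (v : P × N) :
    superSign (L v) = (r : ℤ) • L (superSign v) := by
  have := LinearMap.congr_fun h.conj (superSign v)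
  simpa using this

theorem endPar_of_conj {r : ℤˣ} {L : Module.End ℂ (P × N)}
    (h : superSign ∘ₗ L ∘ₗ superSign = (r : ℤ) • L) : EndPar r L := by
  rw [← endParity_eq] at h
  have h2 := endEven_add_endOdd L
  rcases Int.units_eq_one_or r with rfl | rfl
  · left
    refine ⟨rfl, ?_⟩
    have h1 : endEven L - endOdd L = L := by simpa using h
    have : (2 : ℂ) • endOdd L = 0 := by
      rw [two_smul]; nth_rw 1 [← sub_sub_self (endEven L) (endOdd L)]
      rw [h1]; nth_rw 2 [← h2]; abel
    simpa using this
  · right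
    refine ⟨rfl, ?_⟩
    have h1 : endEven L - endOdd L = -L := by simpa using h
    have : (2 : ℂ) • endEven L = 0 := by
      have h3 : endEven L = endOdd L - L := by rw [sub_eq_neg_add, ← h1]; abel
      rw [two_smul]; nth_rw 1 [h3]; nth_rw 2 [← h2]; abel
    simpa using this

theorem EndPar.mul {r r' : ℤˣ} {L L' : Module.End ℂ (P × N)} (h : EndPar r L)
    (h' : EndPar r' L') : EndPar (r * r') (L * L') := by
  apply endPar_of_conj
  ext1 <;> ext1 v <;>
  simp [h.superSign_apply, h'.superSign_apply, mul_smul, smul_comm (r : ℤ)]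

theorem EndPar.extAct_tmul {r : ℤˣ} {L : Module.End ℂ (P × N)} (h : EndPar r L) (a b : Ext W)
    (v : P × N) : extAct (a ⊗ₜ[ℂ] L) (b ⊗ₜ[ℂ] v) = (a * extSgn r b) ⊗ₜ L v := by
  rw [PrimitiveChernWeil.extAct_tmul]
  have := endEven_add_endOdd L
  rcases h with ⟨rfl, h⟩ | ⟨rfl, h⟩
  · rw [h, add_zero] at this; simp [h, this]
  · rw [h, zero_add] at this; simp [h, this]

/-! ### Homogeneous elements of `Λ(W*) ⊗ End(P ⊕ N)` -/

theorem totalSignEnd_tmul (a : Ext W) (L : Module.End ℂ (P × N)) :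
    totalSignEnd (a ⊗ₜ[ℂ] L) = extSign a ⊗ₜ[ℂ] (endEven L - endOdd L) := by
  simp [totalSignEnd]

/-- An element of total parity `s` is a sum of tensors of homogeneous elements, of parities whose
product is `s`. -/
theorem parity_induction {s : ℤˣ} {p : (Ext W ⊗[ℂ] Module.End ℂ (P × N)) → Prop}
    (h0 : p 0) (hadd : ∀ x y, p x → p y → p (x + y))
    (ht : ∀ (u r : ℤˣ) (a : Ext W) (L : Module.End ℂ (P × N)), u * r = s →
      extSign a = (u : ℤ) • a → EndPar r L → p (a ⊗ₜ L))
    {γ : Ext W ⊗[ℂ] Module.End ℂ (P × N)} (hγ : totalSignEnd γ = (s : ℤ) • γ) : p γ := by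
  -- the projection onto the part of parity `s`
  have key : ∀ γ : Ext W ⊗[ℂ] Module.End ℂ (P × N),
      p ((2⁻¹ : ℂ) • (γ + (s : ℤ) • totalSignEnd γ)) := by
    intro γ
    induction γ with
    | zero => simpa using h0
    | add x y hx hy =>
      convert hadd _ _ hx hy using 1
      rw [map_add, ← smul_add]; congr 1; rw [smul_add]; abel
    | tmul a L =>
      have e1 : extSign (a + extSign a) = ((1 : ℤˣ) : ℤ) • (a + extSign a) := by
        simp [add_comm]
      have e2 : extSign (a - extSign a) = ((-1 : ℤˣ) : ℤ) • (a - extSign a) := by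
        simp
      have p0 := endPar_endEven L
      have p1 := endPar_endOdd L
      have hL := endEven_add_endOdd L
      have hs : ∀ {u} {a : Ext W} (c : ℂ), extSign a = ((u : ℤˣ) : ℤ) • a →
          extSign (c • a) = (u : ℤ) • (c • a) := fun c h => by
        rw [map_smul, h, smul_comm]
      rcases Int.units_eq_one_or s with rfl | rfl
      · convert hadd _ _ (ht 1 1 _ _ (by simp) (hs 2⁻¹ e1) p0)
          (ht (-1) (-1) _ _ (by simp) (hs 2⁻¹ e2) p1) using 1
        rw [totalSignEnd_tmul]
        nth_rw 1 [← hL]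
        simp only [TensorProduct.tmul_add, TensorProduct.add_tmul, TensorProduct.tmul_sub,
          TensorProduct.sub_tmul, ← TensorProduct.smul_tmul', ← smul_add, Units.val_one,
          one_smul]
        congr 1; abel
      · convert hadd _ _ (ht 1 (-1) _ _ (by simp) (hs 2⁻¹ e1) p1)
          (ht (-1) 1 _ _ (by simp) (hs 2⁻¹ e2) p0) using 1
        rw [totalSignEnd_tmul]
        nth_rw 1 [← hL]
        simp only [TensorProduct.tmul_add, TensorProduct.add_tmul, TensorProduct.tmul_sub,
          TensorProduct.sub_tmul, ← TensorProduct.smul_tmul', ← smul_add, Units.val_neg,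
          Units.val_one, neg_smul, one_smul]
        congr 1; abel
  have := key γ
  rw [hγ, smul_smul, ← Units.val_mul, Int.units_mul_self, Units.val_one, one_smul,
    ← two_smul ℂ, smul_smul] at this
  simpa using this

/-- An element of total parity `s` commutes with multiplication by forms up to the sign `s`. -/
theorem extAct_extWedge {s : ℤˣ} {γ : Ext W ⊗[ℂ] Module.End ℂ (P × N)}
    (hγ : totalSignEnd γ = (s : ℤ) • γ) (c : Ext W) (t : Ext W ⊗[ℂ] (P × N)) :
    extAct γ (extWedge c t) = extWedge (extSgn s c) (extAct γ t) := by
  refine parity_induction (p := fun γ => extAct γ (extWedge c t) =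
    extWedge (extSgn s c) (extAct γ t)) (by simp) (fun x y hx hy => by simp [hx, hy]) ?_ hγ
  intro u r a L hs ha hL
  induction t with
  | zero => simp
  | add x y hx hy => simp only [map_add, hx, hy]
  | tmul b v =>
    rw [extWedge_tmul, hL.extAct_tmul, hL.extAct_tmul, extWedge_tmul, map_mul, ← mul_assoc,
      mul_eq_extSgn_mul ha, extSgn_extSgn, hs, mul_assoc]

theorem totalSign_extAct (γ : Ext W ⊗[ℂ] Module.End ℂ (P × N)) (t : Ext W ⊗[ℂ] (P × N)) :
    totalSign (extAct γ t) = extAct (totalSignEnd γ) (totalSign t) := by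
  induction γ with
  | zero => simp
  | add x y hx hy => simp only [map_add, LinearMap.add_apply, hx, hy]
  | tmul a L =>
    induction t with
    | zero => simp
    | add x y hx hy => simp only [map_add, hx, hy]
    | tmul b v =>
      have h0 := (endPar_endEven L).superSign_apply v
      have h1 := (endPar_endOdd L).superSign_apply v
      simp only [totalSign, totalSignEnd, extAct_tmul, map_add, TensorProduct.map_tmul, h0, h1]
      simp [endEven_endEven, endOdd_endEven, endEven_endOdd, endOdd_endOdd]

/-- The map `a ⊗ w ↦ a ⊗ L`, where `L` is the endomorphism `v ↦ f(v) w`. -/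
def rankOne (f : (P × N) →ₗ[ℂ] ℂ) :
    (Ext W ⊗[ℂ] (P × N)) →ₗ[ℂ] (Ext W ⊗[ℂ] Module.End ℂ (P × N)) :=
  LinearMap.lTensor (Ext W) (LinearMap.smulRightₗ f)

theorem rankOne_tmul (f : (P × N) →ₗ[ℂ] ℂ) (a : Ext W) (v : P × N) :
    rankOne f (a ⊗ₜ[ℂ] v) = a ⊗ₜ[ℂ] (f.smulRight v) := by
  simp [rankOne]

theorem extAct_tmul_one (a : Ext W) (L : Module.End ℂ (P × N)) (v : P × N) :
    extAct (a ⊗ₜ[ℂ] L) (1 ⊗ₜ[ℂ] v) = a ⊗ₜ L v := by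
  rw [extAct_tmul, map_one, mul_one, ← TensorProduct.tmul_add, ← LinearMap.add_apply,
    endEven_add_endOdd]

theorem extAct_rankOne (f : (P × N) →ₗ[ℂ] ℂ) (t : Ext W ⊗[ℂ] (P × N)) (v : P × N) :
    extAct (rankOne f t) (1 ⊗ₜ[ℂ] v) = f v • t := by
  induction t with
  | zero => simp
  | add x y hx hy => simp only [map_add, LinearMap.add_apply, hx, hy, smul_add]
  | tmul a w => rw [rankOne_tmul, extAct_tmul_one]; simp [TensorProduct.tmul_smul]

/-- An element of `Λ(W*) ⊗ End(V)` is recovered from its values on a basis of `V`. -/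
theorem sum_rankOne_extAct {κ : Type*} [Fintype κ] (b : Module.Basis κ ℂ (P × N))
    (γ : Ext W ⊗[ℂ] Module.End ℂ (P × N)) :
    ∑ k, rankOne (b.coord k) (extAct γ (1 ⊗ₜ[ℂ] b k)) = γ := by
  induction γ with
  | zero => simp
  | add x y hx hy =>
    simp only [map_add, LinearMap.add_apply, Finset.sum_add_distrib, hx, hy]
  | tmul a L =>
    simp only [extAct_tmul_one, rankOne_tmul, ← TensorProduct.tmul_sum]
    congr 1
    classical
    refine b.ext fun j => ?_
    simp [LinearMap.sum_apply, Finsupp.single_apply, ite_smul]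

theorem extAct_ext_basis {κ : Type*} [Fintype κ] (b : Module.Basis κ ℂ (P × N))
    {γ γ' : Ext W ⊗[ℂ] Module.End ℂ (P × N)}
    (h : ∀ k, extAct γ (1 ⊗ₜ[ℂ] b k) = extAct γ' (1 ⊗ₜ[ℂ] b k)) : γ = γ' := by
  rw [← sum_rankOne_extAct b γ, ← sum_rankOne_extAct b γ']
  simp only [h]

theorem extAct_sum_rankOne {κ : Type*} [Fintype κ] (b : Module.Basis κ ℂ (P × N))
    (t : κ → Ext W ⊗[ℂ] (P × N)) (k : κ) :
    extAct (∑ j, rankOne (b.coord j) (t j)) (1 ⊗ₜ[ℂ] b k) = t k := by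
  classical
  simp [LinearMap.sum_apply, extAct_rankOne, Finsupp.single_apply, ite_smul]

theorem endStr_of_odd {L : Module.End ℂ (P × N)} (h : endEven L = 0) : endStr L = 0 := by
  have h1 : LinearMap.fst ℂ P N ∘ₗ L ∘ₗ LinearMap.inl ℂ P N = 0 := by
    ext v; simpa [endEven] using congrArg Prod.fst (LinearMap.congr_fun h (v, 0))
  have h2 : LinearMap.snd ℂ P N ∘ₗ L ∘ₗ LinearMap.inr ℂ P N = 0 := by
    ext v; simpa [endEven] using congrArg Prod.snd (LinearMap.congr_fun h (0, v))
  simp [endStr, h1, h2]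

variable [Module.Finite ℂ P] [Module.Finite ℂ N]

variable (P N) in
/-- A homogeneous basis of the superspace `P ⊕ N`. -/
def superBasis : Module.Basis (Fin (Module.finrank ℂ P) ⊕ Fin (Module.finrank ℂ N)) ℂ (P × N) :=
  (Module.finBasis ℂ P).prod (Module.finBasis ℂ N)

variable (P N) in
/-- The parity of a vector of `superBasis P N`. -/
def superBasisSgn : Fin (Module.finrank ℂ P) ⊕ Fin (Module.finrank ℂ N) → ℤˣ :=
  Sum.elim (fun _ => 1) (fun _ => -1)

theorem superSign_superBasis (k) :
    superSign (superBasis P N k) = (superBasisSgn P N k : ℤ) • superBasis P N k := by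
  rcases k with k | k <;> simp [superBasis, superBasisSgn, superSign]

/-- The action of `Λ(W*) ⊗ End(V)` on `Λ(W*) ⊗ V` is faithful. -/
theorem extAct_injective {γ γ' : Ext W ⊗[ℂ] Module.End ℂ (P × N)}
    (h : ∀ t, extAct γ t = extAct γ' t) : γ = γ' :=
  extAct_ext_basis (superBasis P N) fun _ => h _

/-- An element of `Λ(W*) ⊗ End(V)` whose values on a homogeneous basis have the parity prescribed
by `s` has parity `s`. -/
theorem totalSignEnd_of_basis {s : ℤˣ} {γ : Ext W ⊗[ℂ] Module.End ℂ (P × N)}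
    (h : ∀ k, totalSign (extAct γ (1 ⊗ₜ[ℂ] superBasis P N k)) =
      ((s * superBasisSgn P N k : ℤˣ) : ℤ) • extAct γ (1 ⊗ₜ[ℂ] superBasis P N k)) :
    totalSignEnd γ = (s : ℤ) • γ := by
  refine extAct_ext_basis (superBasis P N) fun k => ?_
  have e : totalSign ((1 : Ext W) ⊗ₜ[ℂ] superBasis P N k) =
      (superBasisSgn P N k : ℤ) • ((1 : Ext W) ⊗ₜ[ℂ] superBasis P N k) := by
    simp [totalSign, superSign_superBasis]
  have h1 := totalSign_extAct γ ((1 : Ext W) ⊗ₜ[ℂ] superBasis P N k)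
  rw [h, e, map_zsmul] at h1
  have h2 := congrArg (fun z => (superBasisSgn P N k : ℤ) • z) h1
  simp only [smul_smul, ← Units.val_mul, Int.units_mul_self, Units.val_one, one_smul] at h2
  rw [← h2, mul_comm s, ← mul_assoc, Int.units_mul_self, one_mul, map_zsmul, LinearMap.smul_apply]

/-! ### Supercommutators and the supertrace in one fibre -/

/-- The sign `(-1)^{|x||y|}` of the Koszul rule, for parities `s` and `s'`. -/
def koszul (s s' : ℤˣ) : ℤˣ := if s = -1 ∧ s' = -1 then -1 else 1

theorem endStr_eq_trace (L : Module.End ℂ (P × N)) :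
    endStr L = LinearMap.trace ℂ (P × N) (superSign * L) := by
  have e : superSign * L = LinearMap.inl ℂ P N ∘ₗ (LinearMap.fst ℂ P N ∘ₗ L) -
      LinearMap.inr ℂ P N ∘ₗ (LinearMap.snd ℂ P N ∘ₗ L) := by
    refine LinearMap.ext fun v => ?_
    simp [superSign]
  rw [e, map_sub, LinearMap.trace_comp_comm',
    LinearMap.trace_comp_comm' (LinearMap.snd ℂ P N ∘ₗ L) (LinearMap.inr ℂ P N)]
  rfl

/-- The supertrace vanishes on supercommutators of endomorphisms. -/
theorem endStr_mul_comm {r r' : ℤˣ} {L L' : Module.End ℂ (P × N)} (h : EndPar r L)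
    (h' : EndPar r' L') : endStr (L * L') = (koszul r r' : ℤ) • endStr (L' * L) := by
  have e : superSign * L = (r : ℤ) • (L * superSign) := by
    refine LinearMap.ext fun v => ?_
    simp [h.superSign_apply]
  have e' : endStr (L * L') = (r : ℤ) • endStr (L' * L) := by
    rw [endStr_eq_trace, endStr_eq_trace, ← mul_assoc, e, smul_mul_assoc, map_zsmul, mul_assoc,
      LinearMap.trace_mul_comm, mul_assoc]
  rw [e']
  have h2 := h'.mul h
  rcases Int.units_eq_one_or r with rfl | rfl <;> rcases Int.units_eq_one_or r' with rfl | rfl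
  · simp [koszul]
  · simp [koszul]
  · rcases h2 with ⟨h2, -⟩ | ⟨-, h2⟩
    · simp at h2
    · simp [endStr_of_odd h2]
  · simp [koszul]

theorem koszul_str_tmul {u u' r r' : ℤˣ} {a b : Ext W} {L L' : Module.End ℂ (P × N)}
    (ha : extSign a = (u : ℤ) • a) (hb : extSign b = (u' : ℤ) • b) (hL : EndPar r L)
    (hL' : EndPar r' L') :
    endStr (L * L') • (a * extSgn r b) =
      (koszul (u * r) (u' * r') : ℤ) • endStr (L' * L) • (b * extSgn r' a) := by
  have hab := mul_eq_extSgn_mul ha b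
  have h2 := hL'.mul hL
  rw [endStr_mul_comm hL hL', extSgn_mem ha, extSgn_mem hb]
  rw [extSgn_mem hb] at hab
  -- the supertrace of `L' * L` vanishes unless `L` and `L'` have the same parity
  by_cases hr : r' * r = 1
  · obtain rfl : r = r' := by
      rcases Int.units_eq_one_or r with rfl | rfl <;>
      rcases Int.units_eq_one_or r' with rfl | rfl <;> simp_all
    rcases Int.units_eq_one_or u with rfl | rfl <;>
    rcases Int.units_eq_one_or u' with rfl | rfl <;>
    rcases Int.units_eq_one_or r with rfl | rfl <;>
    simp [koszul] at hab ⊢ <;> simp [hab]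
  · rcases h2 with ⟨h2, -⟩ | ⟨-, h2⟩
    · exact absurd h2 hr
    · simp [endStr_of_odd h2]

/-- Supercommutators in `Λ(W*) ⊗ End(V)` exist, and the supertrace vanishes on them. -/
theorem exists_supercommutator {s s' : ℤˣ} {γ γ' : Ext W ⊗[ℂ] Module.End ℂ (P × N)}
    (hγ : totalSignEnd γ = (s : ℤ) • γ) (hγ' : totalSignEnd γ' = (s' : ℤ) • γ') :
    ∃ ζ : Ext W ⊗[ℂ] Module.End ℂ (P × N), extStr ζ = 0 ∧ ∀ t, extAct ζ t =
      extAct γ (extAct γ' t) - (koszul s s' : ℤ) • extAct γ' (extAct γ t) := by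
  refine parity_induction (p := fun γ => ∃ ζ : Ext W ⊗[ℂ] Module.End ℂ (P × N), extStr ζ = 0 ∧
    ∀ t, extAct ζ t = extAct γ (extAct γ' t) - (koszul s s' : ℤ) • extAct γ' (extAct γ t))
    ⟨0, by simp⟩ ?_ ?_ hγ
  · rintro x y ⟨ζ, h, h'⟩ ⟨ξ, k, k'⟩
    refine ⟨ζ + ξ, by simp [h, k], fun t => ?_⟩
    simp only [map_add, LinearMap.add_apply, h', k', smul_add]; abel
  intro u r a L hs ha hL
  refine parity_induction (p := fun γ' => ∃ ζ : Ext W ⊗[ℂ] Module.End ℂ (P × N), extStr ζ = 0 ∧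
    ∀ t, extAct ζ t = extAct (a ⊗ₜ L) (extAct γ' t) -
      (koszul s s' : ℤ) • extAct γ' (extAct (a ⊗ₜ L) t))
    ⟨0, by simp⟩ ?_ ?_ hγ'
  · rintro x y ⟨ζ, h, h'⟩ ⟨ξ, k, k'⟩
    refine ⟨ζ + ξ, by simp [h, k], fun t => ?_⟩
    simp only [map_add, LinearMap.add_apply, h', k', smul_add]; abel
  intro u' r' b L' hs' hb hL'
  refine ⟨(a * extSgn r b) ⊗ₜ (L * L') - (koszul s s' : ℤ) • ((b * extSgn r' a) ⊗ₜ (L' * L)),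
    ?_, fun t => ?_⟩
  · subst hs hs'
    rw [map_sub, map_zsmul, extStr_tmul, extStr_tmul, koszul_str_tmul ha hb hL hL', sub_self]
  · rw [map_sub, map_zsmul, LinearMap.sub_apply, LinearMap.smul_apply]
    induction t with
    | zero => simp
    | add x y hx hy =>
      simp only [map_add, smul_add] at hx hy ⊢
      rw [add_sub_add_comm, hx, hy]; abel
    | tmul c v =>
      rw [(hL.mul hL').extAct_tmul, (hL'.mul hL).extAct_tmul, hL.extAct_tmul, hL'.extAct_tmul,
        hL.extAct_tmul, hL'.extAct_tmul, map_mul, map_mul, extSgn_extSgn, extSgn_extSgn]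
      simp only [mul_assoc, Module.End.mul_apply]

end FibreAlgebra

/-! ### Smooth functions and partial derivatives in charts -/

section Smooth

variable {n : ℕ} {M : Type*} [TopologicalSpace M] [ChartedSpace (EuclideanSpace ℝ (Fin n)) M]
  {X Y Z : Type*} [AddCommGroup X] [Module ℂ X] [AddCommGroup Y] [Module ℂ Y]
  [AddCommGroup Z] [Module ℂ Z] {p : M}

theorem SmoothCoordAt.scalar_smul {f : M → ℂ} (hf : ContMDiffAt (𝓡 n) 𝓘(ℝ, ℂ) ∞ f p) (w : X) :
    SmoothCoordAt (n := n) (fun x => f x • w) p := fun φ => by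
  have hmul : ContDiff ℝ ∞ (fun z : ℂ => z * φ w) := contDiff_id.mul contDiff_const
  simp only [map_smul, smul_eq_mul]
  exact hmul.contMDiff.contMDiffAt.comp p hf

theorem SmoothCoordAt.const (w : X) : SmoothCoordAt (n := n) (fun _ : M => w) p :=
  fun _ => contMDiffAt_const

theorem SmoothCoordAt.sum {κ : Type*} (s : Finset κ) {g : κ → M → X}
    (hg : ∀ k ∈ s, SmoothCoordAt (n := n) (g k) p) :
    SmoothCoordAt (n := n) (fun x => ∑ k ∈ s, g k x) p := fun φ => by
  simp only [map_sum]
  exact contMDiffAt_finsetSum fun k hk => hg k hk φ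

theorem SmoothCoordAt.of_scalar {f : M → ℂ} (hf : ContMDiffAt (𝓡 n) 𝓘(ℝ, ℂ) ∞ f p) :
    SmoothCoordAt (n := n) f p :=
  (SmoothCoordAt.scalar_smul hf (1 : ℂ)).congr (Filter.Eventually.of_forall fun x => by simp)

theorem SmoothCoordAt.smul [Module.Finite ℂ X] {f : M → ℂ} {g : M → X}
    (hf : ContMDiffAt (𝓡 n) 𝓘(ℝ, ℂ) ∞ f p)
    (hg : SmoothCoordAt (n := n) g p) : SmoothCoordAt (n := n) (fun x => f x • g x) p :=
  (SmoothCoordAt.of_scalar hf).bilinear hg (LinearMap.lsmul ℂ X)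

/-- A family of linear maps, smooth on every vector, maps smooth functions to smooth functions. -/
theorem SmoothCoordAt.family [Module.Finite ℂ X] [Module.Finite ℂ Y] {g : M → X}
    (hg : SmoothCoordAt (n := n) g p)
    (T : M → X →ₗ[ℂ] Y) (hT : ∀ w, SmoothCoordAt (n := n) (fun x => T x w) p) :
    SmoothCoordAt (n := n) (fun x => T x (g x)) p := by
  let b := Module.finBasis ℂ X
  refine (SmoothCoordAt.sum Finset.univ fun i _ =>
    SmoothCoordAt.smul (hg (b.coord i)) (hT (b i))).congr (Filter.Eventually.of_forall fun x => ?_)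
  have e := congrArg (T x) (b.sum_repr (g x))
  simp only [map_sum, map_smul] at e
  exact e.symm

/-- The function `g` has at `p` the partial derivatives `D i` in the chart at `p`, in the sense that
every linear functional of `g` is differentiable with the corresponding derivatives. -/
def HasPartials (g : M → X) (D : Fin n → X) (p : M) : Prop :=
  ∀ φ : X →ₗ[ℂ] ℂ,
    DifferentiableAt ℝ (fun y => φ (g ((extChartAt (𝓡 n) p).symm y))) (extChartAt (𝓡 n) p p) ∧
    ∀ i, fderiv ℝ (fun y => φ (g ((extChartAt (𝓡 n) p).symm y))) (extChartAt (𝓡 n) p p)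
      (EuclideanSpace.single i 1) = φ (D i)

theorem eventually_chart {q : M → Prop} (h : ∀ᶠ x in nhds p, q x) :
    ∀ᶠ y in nhds (extChartAt (𝓡 n) p p), q ((extChartAt (𝓡 n) p).symm y) := by
  have := (continuousAt_extChartAt_symm (I := 𝓡 n) p).tendsto
  rw [extChartAt_to_inv] at this
  exact this.eventually h

theorem HasPartials.congr {g h : M → X} {D : Fin n → X} (hg : HasPartials g D p)
    (e : ∀ᶠ x in nhds p, h x = g x) : HasPartials h D p := by
  intro φ
  have e' : (fun y => φ (h ((extChartAt (𝓡 n) p).symm y))) =ᶠ[nhds (extChartAt (𝓡 n) p p)]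
      (fun y => φ (g ((extChartAt (𝓡 n) p).symm y))) :=
    (eventually_chart e).mono fun y hy => by simp only [hy]
  exact ⟨(hg φ).1.congr_of_eventuallyEq e', fun i => by rw [e'.fderiv_eq]; exact (hg φ).2 i⟩

theorem HasPartials.const (w : X) : HasPartials (n := n) (fun _ => w) 0 p := fun φ =>
  ⟨differentiableAt_const _, fun i => by simp⟩

theorem HasPartials.linear {g : M → X} {D : Fin n → X} (hg : HasPartials g D p) (T : X →ₗ[ℂ] Y) :
    HasPartials (fun x => T (g x)) (fun i => T (D i)) p :=
  fun φ => hg (φ ∘ₗ T)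

theorem HasPartials.sum {κ : Type*} (s : Finset κ) {g : κ → M → X} {D : κ → Fin n → X}
    (hg : ∀ k ∈ s, HasPartials (g k) (D k) p) :
    HasPartials (fun x => ∑ k ∈ s, g k x) (fun i => ∑ k ∈ s, D k i) p := by
  intro φ
  simp only [map_sum]
  refine ⟨DifferentiableAt.fun_sum fun k hk => (hg k hk φ).1, fun i => ?_⟩
  rw [fderiv_fun_sum fun k hk => (hg k hk φ).1, sum_apply]
  exact Finset.sum_congr rfl fun k hk => (hg k hk φ).2 i

theorem HasPartials.bilinear [Module.Finite ℂ X] [Module.Finite ℂ Y] {g : M → X} {h : M → Y}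
    {D : Fin n → X} {D' : Fin n → Y} (hg : HasPartials g D p) (hh : HasPartials h D' p)
    (T : X →ₗ[ℂ] Y →ₗ[ℂ] Z) :
    HasPartials (fun x => T (g x) (h x)) (fun i => T (D i) (h p) + T (g p) (D' i)) p := by
  intro φ
  let b := Module.finBasis ℂ X
  let c := Module.finBasis ℂ Y
  have key : ∀ u v, φ (T u v) =
      ∑ i, ∑ j, (b.coord i u * c.coord j v) * φ (T (b i) (c j)) := by
    intro u v
    have e := LinearMap.sum_repr_mul_repr_mul b c (B := T.compr₂ φ) u v
    rw [LinearMap.compr₂_apply] at e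
    rw [← e, Finsupp.sum_fintype _ _ (by simp)]
    refine Finset.sum_congr rfl fun i _ => ?_
    rw [Finsupp.sum_fintype _ _ (by simp)]
    simp [mul_assoc]
  have hfun : (fun y => φ (T (g ((extChartAt (𝓡 n) p).symm y)) (h ((extChartAt (𝓡 n) p).symm y)))) =
      fun y => ∑ i, ∑ j, b.coord i (g ((extChartAt (𝓡 n) p).symm y)) *
      c.coord j (h ((extChartAt (𝓡 n) p).symm y)) * φ (T (b i) (c j)) := funext fun y => key _ _
  rw [hfun]
  have hd : ∀ i j, DifferentiableAt ℝ (fun y => b.coord i (g ((extChartAt (𝓡 n) p).symm y)) *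
      c.coord j (h ((extChartAt (𝓡 n) p).symm y)) * φ (T (b i) (c j))) (extChartAt (𝓡 n) p p) :=
    fun i j => ((hg _).1.fun_mul (hh _).1).mul_const _
  refine ⟨DifferentiableAt.fun_sum fun i _ => DifferentiableAt.fun_sum fun j _ => hd i j,
    fun k => ?_⟩
  rw [map_add, key (D k), key (g p), fderiv_fun_sum fun i _ => DifferentiableAt.fun_sum fun j _ => hd i j,
    sum_apply, ← Finset.sum_add_distrib]
  refine Finset.sum_congr rfl fun i _ => ?_
  rw [fderiv_fun_sum fun j _ => hd i j, sum_apply, ← Finset.sum_add_distrib]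
  refine Finset.sum_congr rfl fun j _ => ?_
  rw [fderiv_mul_const ((hg _).1.fun_mul (hh _).1), fderiv_fun_mul (hg _).1 (hh _).1]
  simp only [add_apply, smul_apply, (hg _).2, (hh _).2, extChartAt_to_inv, smul_eq_mul]
  ring

theorem SmoothCoordAt.exists_hasPartials [Module.Finite ℂ X] {g : M → X}
    (hg : SmoothCoordAt (n := n) g p) : ∃ D : Fin n → X, HasPartials g D p := by
  let b := Module.finBasis ℂ X
  let d : Fin n → Fin (Module.finrank ℂ X) → ℂ := fun i k =>
    fderiv ℝ (fun y => b.coord k (g ((extChartAt (𝓡 n) p).symm y))) (extChartAt (𝓡 n) p p)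
      (EuclideanSpace.single i 1)
  have h1 : HasPartials (fun x => ∑ k, LinearMap.toSpanSingleton ℂ X (b k) (b.coord k (g x)))
      (fun i => ∑ k, LinearMap.toSpanSingleton ℂ X (b k) (d i k)) p := by
    refine HasPartials.sum _ fun k _ => HasPartials.linear (fun φ => ?_) _
    have hφ : ∀ z, φ z = z * φ 1 := fun z => by
      rw [← smul_eq_mul, ← map_smul, smul_eq_mul, mul_one]
    have hd := hg.differentiableAt (b.coord k)
    simp only [hφ (b.coord k _)]
    refine ⟨hd.mul_const _, fun i => ?_⟩
    rw [fderiv_mul_const hd, hφ (d i k)]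
    simp [d, mul_comm]
  refine ⟨_, h1.congr (Filter.Eventually.of_forall fun x => ?_)⟩
  conv_lhs => rw [← b.sum_repr (g x)]
  simp

end Smooth

/-! ### Extending local sections -/

section Sections

variable {n : ℕ} {M : Type*} [TopologicalSpace M] [T2Space M]
  [ChartedSpace (EuclideanSpace ℝ (Fin n)) M] [IsManifold (𝓡 n) ∞ M]

theorem exists_bump {p : M} {U : Set M} (hU : U ∈ nhds p) :
    ∃ χ : M → ℂ, (∀ q, ContMDiffAt (𝓡 n) 𝓘(ℝ, ℂ) ∞ χ q) ∧ (∀ᶠ x in nhds p, χ x = 1) ∧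
      ∀ q ∉ U, ∀ᶠ x in nhds q, χ x = 0 := by
  obtain ⟨f, -, hf⟩ := (SmoothBumpFunction.nhds_basis_tsupport (I := 𝓡 n) p).mem_iff.1 hU
  refine ⟨fun x => (f x : ℂ), fun q => ?_, ?_, fun q hq => ?_⟩
  · exact Complex.ofRealCLM.contDiff.contMDiff.contMDiffAt.comp q f.contMDiffAt
  · filter_upwards [f.eventuallyEq_one] with x hx
    simp [hx]
  · have : q ∉ tsupport f := fun h => hq (hf h)
    filter_upwards [notMem_tsupport_iff_eventuallyEq.1 this] with x hx
    simp [hx]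

/-- Cutting off a local section of a bundle. The bundle has fibres `X x`, coordinates
`coord q x : X x → Y` with inverses `frame q x` over the open set `U q`, and smooth coordinate
changes. -/
theorem exists_cutoff {X : M → Type*} [∀ x, AddCommGroup (X x)] [∀ x, Module ℂ (X x)]
    {Y : Type*} [AddCommGroup Y] [Module ℂ Y] [Module.Finite ℂ Y]
    (coord : ∀ _ x : M, X x →ₗ[ℂ] Y) (frame : ∀ _ x : M, Y →ₗ[ℂ] X x) (U : M → Set M)
    (hU : ∀ q, U q ∈ nhds q)
    (hchange : ∀ (p q r : M), r ∈ U p → r ∈ U q → ∀ w,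
      SmoothCoordAt (n := n) (fun x => coord q x (frame p x w)) r)
    (p : M) {V : Set M} (hV : V ∈ nhds p) (hVU : V ⊆ U p) (g : M → Y)
    (hg : ∀ q ∈ V, SmoothCoordAt (n := n) g q) :
    ∃ χ : M → ℂ, (∀ᶠ x in nhds p, χ x = 1) ∧
      ∀ q, SmoothCoordAt (n := n) (fun x => coord q x (χ x • frame p x (g x))) q := by
  obtain ⟨χ, h1, h2, h3⟩ := exists_bump (n := n) hV
  refine ⟨χ, h2, fun q => ?_⟩
  by_cases hq : q ∈ V
  · have := SmoothCoordAt.smul (h1 q) ((hg q hq).family (fun x => coord q x ∘ₗ frame p x)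
      (hchange p q q (hVU hq) (mem_of_mem_nhds (hU q))))
    exact this.congr (Filter.Eventually.of_forall fun x => by simp)
  · refine SmoothCoordAt.zero.congr ?_
    filter_upwards [h3 q hq] with x hx
    simp [hx]

end Sections

/-! ### Coordinates of forms -/

section Pullback

variable {W W' W'' : Type*} [AddCommGroup W] [Module ℝ W] [AddCommGroup W'] [Module ℝ W']
  [AddCommGroup W''] [Module ℝ W'']

theorem extPullback_extPullback (u : W →ₗ[ℝ] W') (v : W' →ₗ[ℝ] W'') (a : Ext W'') :
    extPullback u (extPullback v a) = extPullback (v ∘ₗ u) a := by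
  induction a using ExteriorAlgebra.induction with
  | algebraMap r => simp only [AlgHom.commutes]
  | ι l => simp only [extPullback_ι, LinearMap.comp_assoc]
  | mul a b ha hb => simp only [map_mul, ha, hb]
  | add a b ha hb => simp only [map_add, ha, hb]

theorem extPullback_id (a : Ext W) : extPullback LinearMap.id a = a := by
  induction a using ExteriorAlgebra.induction with
  | algebraMap r => simp only [AlgHom.commutes]
  | ι l => simp only [extPullback_ι, LinearMap.comp_id]
  | mul a b ha hb => simp only [map_mul, ha, hb]
  | add a b ha hb => simp only [map_add, ha, hb]

end Pullback

section FormFrames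

variable {n : ℕ} {M : Type*} [TopologicalSpace M]
  [ChartedSpace (EuclideanSpace ℝ (Fin n)) M] [IsManifold (𝓡 n) ∞ M]

theorem tangentCoframe_frame {p x : M} (hx : x ∈ (chartAt (EuclideanSpace ℝ (Fin n)) p).source) :
    tangentCoframe n M p x ∘ₗ tangentFrame n M p x = LinearMap.id := by
  ext1 v
  exact (trivializationAt (EuclideanSpace ℝ (Fin n)) (TangentSpace (𝓡 n)) p).linearMapAt_symmₗ
    (by simpa using hx) v

theorem tangentFrame_coframe {p x : M} (hx : x ∈ (chartAt (EuclideanSpace ℝ (Fin n)) p).source) :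
    tangentFrame n M p x ∘ₗ tangentCoframe n M p x = LinearMap.id := by
  ext1 v
  exact (trivializationAt (EuclideanSpace ℝ (Fin n)) (TangentSpace (𝓡 n)) p).symmₗ_linearMapAt
    (by simpa using hx) v

/-- The coordinate expression at `x` of a form, in the chart at `p`. -/
def formCoord (p x : M) : Ext (TangentSpace (𝓡 n) x) →ₗ[ℂ] Ext (EuclideanSpace ℝ (Fin n)) :=
  (extPullback (tangentFrame n M p x)).toLinearMap

/-- The form at `x` with a given coordinate expression in the chart at `p`. -/
def formFrame (p x : M) : Ext (EuclideanSpace ℝ (Fin n)) →ₗ[ℂ] Ext (TangentSpace (𝓡 n) x) :=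
  (extPullback (tangentCoframe n M p x)).toLinearMap

theorem formCoord_apply (p x : M) (a : Ext (TangentSpace (𝓡 n) x)) :
    formCoord p x a = extPullback (tangentFrame n M p x) a := rfl

theorem formFrame_apply (p x : M) (a : Ext (EuclideanSpace ℝ (Fin n))) :
    formFrame p x a = extPullback (tangentCoframe n M p x) a := rfl

theorem formCoord_mul (p x : M) (a b : Ext (TangentSpace (𝓡 n) x)) :
    formCoord p x (a * b) = formCoord p x a * formCoord p x b :=
  map_mul (extPullback _) a b

theorem formCoord_frame {p x : M} (hx : x ∈ (chartAt (EuclideanSpace ℝ (Fin n)) p).source)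
    (w : Ext (EuclideanSpace ℝ (Fin n))) : formCoord p x (formFrame p x w) = w := by
  rw [formCoord_apply, formFrame_apply, extPullback_extPullback, tangentCoframe_frame hx,
    extPullback_id]

theorem formFrame_coord {p x : M} (hx : x ∈ (chartAt (EuclideanSpace ℝ (Fin n)) p).source)
    (a : Ext (TangentSpace (𝓡 n) x)) : formFrame p x (formCoord p x a) = a := by
  rw [formCoord_apply, formFrame_apply, extPullback_extPullback, tangentFrame_coframe hx,
    extPullback_id]

theorem formCoord_sign (p x : M) (a : Ext (TangentSpace (𝓡 n) x)) :
    formCoord p x (extSign a) = extSign (formCoord p x a) := extPullback_sign _ a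

theorem formCoord_sgn (s : ℤˣ) (p x : M) (a : Ext (TangentSpace (𝓡 n) x)) :
    formCoord p x (extSgn s a) = extSgn s (formCoord p x a) := by
  rcases Int.units_eq_one_or s with rfl | rfl <;> simp [formCoord_sign]

theorem chart_source_mem (p : M) : (chartAt (EuclideanSpace ℝ (Fin n)) p).source ∈ nhds p :=
  (chartAt (EuclideanSpace ℝ (Fin n)) p).open_source.mem_nhds (mem_chart_source _ p)

theorem tangent_change_smooth {p q r : M}
    (hp : r ∈ (chartAt (EuclideanSpace ℝ (Fin n)) p).source)
    (hq : r ∈ (chartAt (EuclideanSpace ℝ (Fin n)) q).source)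
    (l : EuclideanSpace ℝ (Fin n) →ₗ[ℝ] ℂ) (v : EuclideanSpace ℝ (Fin n)) :
    ContMDiffAt (𝓡 n) 𝓘(ℝ, ℂ) ∞
      (fun x => l (tangentCoframe n M p x (tangentFrame n M q x v))) r := by
  have h := contMDiffAt_coordChangeL (IB := 𝓡 n) (n := ∞) (F := EuclideanSpace ℝ (Fin n))
    (E := (TangentSpace (𝓡 n) : M → Type _))
    (e := trivializationAt (EuclideanSpace ℝ (Fin n)) (TangentSpace (𝓡 n)) q)
    (e' := trivializationAt (EuclideanSpace ℝ (Fin n)) (TangentSpace (𝓡 n)) p)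
    (x := r) (by simpa using hq) (by simpa using hp)
  let L : (EuclideanSpace ℝ (Fin n) →L[ℝ] EuclideanSpace ℝ (Fin n)) →L[ℝ] ℂ :=
    (LinearMap.toContinuousLinearMap l).comp (ContinuousLinearMap.apply ℝ _ v)
  refine (L.contDiff.contMDiff.contMDiffAt.comp r h).congr_of_eventuallyEq ?_
  filter_upwards [(chartAt (EuclideanSpace ℝ (Fin n)) p).open_source.mem_nhds hp,
    (chartAt (EuclideanSpace ℝ (Fin n)) q).open_source.mem_nhds hq] with x hxp hxq
  have hxp' : x ∈ (trivializationAt (EuclideanSpace ℝ (Fin n))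
    (TangentSpace (𝓡 n) : M → Type _) p).baseSet := by simpa using hxp
  have hxq' : x ∈ (trivializationAt (EuclideanSpace ℝ (Fin n))
    (TangentSpace (𝓡 n) : M → Type _) q).baseSet := by simpa using hxq
  simp only [Function.comp_apply, L, ContinuousLinearMap.comp_apply,
    ContinuousLinearMap.apply_apply, LinearMap.coe_toContinuousLinearMap']
  congr 1
  rw [ContinuousLinearEquiv.coe_coe, Trivialization.coordChangeL_apply _ _ ⟨hxq', hxp'⟩]
  rw [tangentCoframe, tangentFrame, Trivialization.coe_linearMapAt_of_mem _ hxp',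
    Trivialization.symmₗ_apply _ hxq']

theorem dxBasis_repr (l : EuclideanSpace ℝ (Fin n) →ₗ[ℝ] ℂ) :
    l = ∑ i, l (EuclideanSpace.single i 1) • dxBasis n i := by
  have e : ∀ i, (dxBasis n).repr l i = l (EuclideanSpace.single i 1) := fun i => by
    simp [dxBasis, Module.Basis.constr]
  conv_lhs => rw [← (dxBasis n).sum_repr l]
  simp only [e]

theorem form_change_smooth {p q r : M}
    (hp : r ∈ (chartAt (EuclideanSpace ℝ (Fin n)) p).source)
    (hq : r ∈ (chartAt (EuclideanSpace ℝ (Fin n)) q).source)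
    (w : Ext (EuclideanSpace ℝ (Fin n))) :
    SmoothCoordAt (n := n) (fun x => formCoord q x (formFrame p x w)) r := by
  simp only [formCoord_apply, formFrame_apply, extPullback_extPullback]
  induction w using ExteriorAlgebra.induction with
  | algebraMap c => simpa only [AlgHom.commutes] using SmoothCoordAt.const _
  | ι l =>
    have h : ∀ x, extPullback (tangentCoframe n M p x ∘ₗ tangentFrame n M q x)
        (ExteriorAlgebra.ι ℂ l) = ∑ i, l (tangentCoframe n M p x (tangentFrame n M q x
          (EuclideanSpace.single i 1))) • ExteriorAlgebra.ι ℂ (dxBasis n i) := fun x => by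
      rw [extPullback_ι, dxBasis_repr (l ∘ₗ _), map_sum]
      simp only [map_smul, LinearMap.comp_apply]
    simp only [h]
    exact SmoothCoordAt.sum _ fun i _ => SmoothCoordAt.scalar_smul (tangent_change_smooth hp hq l _) _
  | mul a b ha hb =>
    simp only [map_mul]
    exact ha.bilinear hb (LinearMap.mul ℂ _)
  | add a b ha hb =>
    simp only [map_add]
    exact ha.add hb

/-- A smooth form has smooth coordinate expressions in the chart at `p`, at all points of that
chart. -/
theorem form_smooth_at (α : Form n M) {p q : M}
    (hq : q ∈ (chartAt (EuclideanSpace ℝ (Fin n)) p).source) :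
    SmoothCoordAt (n := n) (fun x => formCoord p x (α.1 x)) q := by
  have h := (α.2 q).family (fun x => formCoord p x ∘ₗ formFrame q x)
    (fun w => form_change_smooth (mem_chart_source _ q) hq w)
  refine h.congr ?_
  filter_upwards [chart_source_mem (n := n) q] with x hx
  have := formFrame_coord hx (α.1 x)
  rw [formCoord_apply] at this
  simp [this]

theorem Form.ext {α β : Form n M} (h : ∀ x, α.1 x = β.1 x) : α = β := Subtype.ext (funext h)

theorem exists_form [T2Space M] (p : M) {V : Set M} (hV : V ∈ nhds p)
    (hVU : V ⊆ (chartAt (EuclideanSpace ℝ (Fin n)) p).source)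
    (g : M → Ext (EuclideanSpace ℝ (Fin n))) (hg : ∀ q ∈ V, SmoothCoordAt (n := n) g q) :
    ∃ α : Form n M, ∀ᶠ x in nhds p, α.1 x = formFrame p x (g x) := by
  obtain ⟨χ, h1, h2⟩ := exists_cutoff (n := n) (X := fun x : M => Ext (TangentSpace (𝓡 n) x))
    formCoord formFrame (fun p => (chartAt (EuclideanSpace ℝ (Fin n)) p).source)
    chart_source_mem (fun p q r h h' => form_change_smooth h h') p hV hVU g hg
  refine ⟨⟨fun x => χ x • formFrame p x (g x), h2⟩, ?_⟩
  filter_upwards [h1] with x hx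
  simp [hx]

/-- The product of forms. -/
def formMul (α β : Form n M) : Form n M :=
  ⟨fun x => α.1 x * β.1 x, fun p =>
    ((α.2 p).bilinear (β.2 p) (LinearMap.mul ℂ _)).congr
      (Filter.Eventually.of_forall fun x => map_mul _ (α.1 x) (β.1 x))⟩

/-- The `0`-form of a smooth function. -/
def funForm (f : M → ℂ) (hf : ∀ p, ContMDiffAt (𝓡 n) 𝓘(ℝ, ℂ) ∞ f p) : Form n M :=
  ⟨fun x => algebraMap ℂ _ (f x), fun p => by
    simp only [Algebra.algebraMap_eq_smul_one, map_smul, map_one]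
    exact SmoothCoordAt.scalar_smul (hf p) (1 : Ext _)⟩

/-- The form `s^{|α|} α`. -/
def formSgn (s : ℤˣ) (α : Form n M) : Form n M :=
  ⟨fun x => extSgn s (α.1 x), fun p =>
    ((α.2 p).linear (extSgn s).toLinearMap).congr
      (Filter.Eventually.of_forall fun x => formCoord_sgn s p x (α.1 x))⟩

end FormFrames

/-! ### Coordinates of bundle-valued forms -/

section EFrames

variable {n : ℕ} {M : Type*} [TopologicalSpace M] [ChartedSpace (EuclideanSpace ℝ (Fin n)) M]
  [IsManifold (𝓡 n) ∞ M]
  {Fp : Type*} [NormedAddCommGroup Fp] [NormedSpace ℂ Fp] [FiniteDimensional ℂ Fp]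
  {Ep : M → Type*} [∀ x, AddCommGroup (Ep x)] [∀ x, Module ℂ (Ep x)]
  [∀ x, TopologicalSpace (Ep x)] [TopologicalSpace (TotalSpace Fp Ep)]
  [FiberBundle Fp Ep] [VectorBundle ℂ Fp Ep]
  {Fm : Type*} [NormedAddCommGroup Fm] [NormedSpace ℂ Fm] [FiniteDimensional ℂ Fm]
  {Em : M → Type*} [∀ x, AddCommGroup (Em x)] [∀ x, Module ℂ (Em x)]
  [∀ x, TopologicalSpace (Em x)] [TopologicalSpace (TotalSpace Fm Em)]
  [FiberBundle Fm Em] [VectorBundle ℂ Fm Em]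

theorem fibreCoord_frame {p x : M} (hx : x ∈ (trivializationAt Fp Ep p).baseSet) :
    fibreCoord Fp Ep p x ∘ₗ fibreFrame Fp Ep p x = LinearMap.id := by
  ext v
  exact (trivializationAt Fp Ep p).linearMapAt_symmₗ hx v

theorem fibre_change_smooth [VectorBundle ℝ Fp Ep]
    [ContMDiffVectorBundle ∞ Fp Ep (𝓡 n)] {p q r : M}
    (hp : r ∈ (trivializationAt Fp Ep p).baseSet) (hq : r ∈ (trivializationAt Fp Ep q).baseSet)
    (v : Fp) :
    SmoothCoordAt (n := n) (fun x => fibreCoord Fp Ep q x (fibreFrame Fp Ep p x v)) r := by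
  intro φ
  have h := contMDiffAt_coordChangeL (IB := 𝓡 n) (n := ∞) (F := Fp) (E := Ep)
    (e := trivializationAt Fp Ep p) (e' := trivializationAt Fp Ep q) (x := r) hp hq
  let L : (Fp →L[ℝ] Fp) →L[ℝ] ℂ :=
    ((LinearMap.toContinuousLinearMap φ).restrictScalars ℝ).comp (ContinuousLinearMap.apply ℝ _ v)
  refine (L.contDiff.contMDiff.contMDiffAt.comp r h).congr_of_eventuallyEq ?_
  filter_upwards [(trivializationAt Fp Ep p).open_baseSet.mem_nhds hp,
    (trivializationAt Fp Ep q).open_baseSet.mem_nhds hq] with x hxp hxq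
  simp only [Function.comp_apply, L, ContinuousLinearMap.comp_apply,
    ContinuousLinearMap.apply_apply, LinearMap.coe_toContinuousLinearMap',
    ContinuousLinearMap.coe_restrictScalars']
  congr 1
  rw [ContinuousLinearEquiv.coe_coe, Trivialization.coordChangeL_apply _ _ ⟨hxp, hxq⟩]
  rw [fibreCoord, fibreFrame, Trivialization.coe_linearMapAt_of_mem _ hxq,
    Trivialization.symmₗ_apply _ hxp]

variable (n Fp Ep Fm Em) in
/-- The points at which the chart of `M` and the trivialisations of `E⁺` and `E⁻` at `p` are
defined. -/
def coordSet (p : M) : Set M := (chartAt (EuclideanSpace ℝ (Fin n)) p).source ∩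
  ((trivializationAt Fp Ep p).baseSet ∩ (trivializationAt Fm Em p).baseSet)

theorem coordSet_mem (p : M) : coordSet n Fp Ep Fm Em p ∈ nhds p :=
  Filter.inter_mem (chart_source_mem p)
    (Filter.inter_mem (eventually_mem_baseSet Fp Ep p) (eventually_mem_baseSet Fm Em p))

variable (Fp Ep Fm Em) in
/-- The element of `Λ T_x^*M ⊗ E_x` with a given coordinate expression. -/
def eFrame (p x : M) : (Ext (EuclideanSpace ℝ (Fin n)) ⊗[ℂ] (Fp × Fm)) →ₗ[ℂ]
    (Ext (TangentSpace (𝓡 n) x) ⊗[ℂ] (Ep x × Em x)) :=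
  TensorProduct.map (formFrame p x) ((fibreFrame Fp Ep p x).prodMap (fibreFrame Fm Em p x))

theorem eCoord_frame {p x : M} (hx : x ∈ coordSet n Fp Ep Fm Em p)
    (w : Ext (EuclideanSpace ℝ (Fin n)) ⊗[ℂ] (Fp × Fm)) :
    eCoord Fp Ep Fm Em p x (eFrame Fp Ep Fm Em p x w) = w := by
  induction w with
  | zero => simp
  | add x y hx hy => simp only [map_add, hx, hy]
  | tmul a v =>
    have h1 := LinearMap.congr_fun (fibreCoord_frame (Fp := Fp) (Ep := Ep) hx.2.1) v.1
    have h2 := LinearMap.congr_fun (fibreCoord_frame (Fp := Fm) (Ep := Em) hx.2.2) v.2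
    have h3 := formCoord_frame hx.1 a
    simp only [LinearMap.comp_apply, LinearMap.id_apply] at h1 h2
    rw [formCoord_apply] at h3
    simp [eFrame, eCoord, h1, h2, h3]

theorem eFrame_coord {p x : M} (hx : x ∈ coordSet n Fp Ep Fm Em p)
    (t : Ext (TangentSpace (𝓡 n) x) ⊗[ℂ] (Ep x × Em x)) :
    eFrame Fp Ep Fm Em p x (eCoord Fp Ep Fm Em p x t) = t := by
  induction t with
  | zero => simp
  | add x y hx hy => simp only [map_add, hx, hy]
  | tmul a v =>
    have h1 := LinearMap.congr_fun (fibreFrame_comp_coord Fp Ep p x hx.2.1) v.1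
    have h2 := LinearMap.congr_fun (fibreFrame_comp_coord Fm Em p x hx.2.2) v.2
    have h3 := formFrame_coord hx.1 a
    simp only [LinearMap.comp_apply, LinearMap.id_apply] at h1 h2
    rw [formCoord_apply] at h3
    simp [eFrame, eCoord, h1, h2, h3]

theorem eCoord_injective {p x : M} (hx : x ∈ coordSet n Fp Ep Fm Em p) :
    Function.Injective (eCoord (n := n) Fp Ep Fm Em p x) :=
  Function.LeftInverse.injective (eFrame_coord hx)

theorem eCoord_wedge (p x : M) (a : Ext (TangentSpace (𝓡 n) x))
    (t : Ext (TangentSpace (𝓡 n) x) ⊗[ℂ] (Ep x × Em x)) :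
    eCoord Fp Ep Fm Em p x (extWedge a t) =
      extWedge (formCoord p x a) (eCoord Fp Ep Fm Em p x t) := map_extWedge _ _ _ _

theorem eCoord_act {p x : M} (hx : x ∈ coordSet n Fp Ep Fm Em p)
    (γ : Ext (TangentSpace (𝓡 n) x) ⊗[ℂ] Module.End ℂ (Ep x × Em x))
    (t : Ext (TangentSpace (𝓡 n) x) ⊗[ℂ] (Ep x × Em x)) :
    eCoord Fp Ep Fm Em p x (extAct γ t) =
      extAct (endCoord Fp Ep Fm Em p x γ) (eCoord Fp Ep Fm Em p x t) :=
  map_extAct _ _ _ (fibreFrame_comp_coord Fp Ep p x hx.2.1) _ _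
      (fibreFrame_comp_coord Fm Em p x hx.2.2) _ _

theorem eCoord_totalSign (p x : M) (t : Ext (TangentSpace (𝓡 n) x) ⊗[ℂ] (Ep x × Em x)) :
    eCoord Fp Ep Fm Em p x (totalSign t) = totalSign (eCoord Fp Ep Fm Em p x t) := by
  induction t with
  | zero => simp
  | add x y hx hy => simp only [map_add, hx, hy]
  | tmul a v => simp [eCoord, totalSign, superSign, extPullback_sign]

theorem eFrame_totalSign (p x : M) (t : Ext (EuclideanSpace ℝ (Fin n)) ⊗[ℂ] (Fp × Fm)) :
    eFrame Fp Ep Fm Em p x (totalSign t) = totalSign (eFrame Fp Ep Fm Em p x t) := by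
  induction t with
  | zero => simp
  | add x y hx hy => simp only [map_add, hx, hy]
  | tmul a v => simp [eFrame, totalSign, superSign, extPullback_sign, formFrame_apply]

theorem EForm.ext {θ η : EForm (n := n) Fp Ep Fm Em} (h : ∀ x, θ.1 x = η.1 x) : θ = η :=
  Subtype.ext (funext h)

theorem EndForm.ext {γ δ : EndForm (n := n) Fp Ep Fm Em} (h : ∀ x, γ.1 x = δ.1 x) : γ = δ :=
  Subtype.ext (funext h)

variable [VectorBundle ℝ Fp Ep] [ContMDiffVectorBundle ∞ Fp Ep (𝓡 n)]
  [VectorBundle ℝ Fm Em] [ContMDiffVectorBundle ∞ Fm Em (𝓡 n)]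

theorem e_change_smooth {p q r : M} (hp : r ∈ coordSet n Fp Ep Fm Em p)
    (hq : r ∈ coordSet n Fp Ep Fm Em q) (w : Ext (EuclideanSpace ℝ (Fin n)) ⊗[ℂ] (Fp × Fm)) :
    SmoothCoordAt (n := n)
      (fun x => eCoord Fp Ep Fm Em q x (eFrame Fp Ep Fm Em p x w)) r := by
  induction w with
  | zero => simpa using SmoothCoordAt.zero
  | add x y hx hy => simpa only [map_add] using hx.add hy
  | tmul a v =>
    have h1 := form_change_smooth hp.1 hq.1 a
    have h2 := fibre_change_smooth (n := n) (Fp := Fp) (Ep := Ep) hp.2.1 hq.2.1 v.1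
    have h3 := fibre_change_smooth (n := n) (Fp := Fm) (Ep := Em) hp.2.2 hq.2.2 v.2
    have h4 := (h2.linear (LinearMap.inl ℂ Fp Fm)).add (h3.linear (LinearMap.inr ℂ Fp Fm))
    refine (h1.bilinear h4 (TensorProduct.mk ℂ _ _)).congr (Filter.Eventually.of_forall fun x => ?_)
    simp [eFrame, eCoord, formCoord_apply]

/-- A smooth `E`-valued form has smooth coordinate expressions, at all points where the
coordinates are defined. -/
theorem eForm_smooth_at (θ : EForm (n := n) Fp Ep Fm Em) {p q : M}
    (hq : q ∈ coordSet n Fp Ep Fm Em p) :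
    SmoothCoordAt (n := n) (fun x => eCoord Fp Ep Fm Em p x (θ.1 x)) q := by
  have h := (θ.2 q).family (fun x => eCoord Fp Ep Fm Em p x ∘ₗ eFrame Fp Ep Fm Em q x)
    (fun w => e_change_smooth (mem_of_mem_nhds (coordSet_mem q)) hq w)
  refine h.congr ?_
  filter_upwards [coordSet_mem (n := n) (Fp := Fp) (Ep := Ep) (Fm := Fm) (Em := Em) q] with x hx
  simp [eFrame_coord hx]

theorem exists_eForm [T2Space M] (p : M) (w : Ext (EuclideanSpace ℝ (Fin n)) ⊗[ℂ] (Fp × Fm)) :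
    ∃ θ : EForm (n := n) Fp Ep Fm Em, (∀ᶠ x in nhds p, θ.1 x = eFrame Fp Ep Fm Em p x w) ∧
      ∀ s : ℤˣ, totalSign w = (s : ℤ) • w → HasParity s θ := by
  obtain ⟨χ, h1, h2⟩ := exists_cutoff (n := n)
    (X := fun x : M => Ext (TangentSpace (𝓡 n) x) ⊗[ℂ] (Ep x × Em x))
    (eCoord Fp Ep Fm Em) (eFrame Fp Ep Fm Em) (coordSet n Fp Ep Fm Em)
    coordSet_mem (fun p q r h h' => e_change_smooth h h') p
    (coordSet_mem p) subset_rfl (fun _ => w)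
    (fun _ _ => SmoothCoordAt.const w)
  refine ⟨⟨fun x => χ x • eFrame Fp Ep Fm Em p x w, h2⟩, ?_, fun s hs x => ?_⟩
  · filter_upwards [h1] with x hx
    simp [hx]
  · change totalSign (χ x • _) = _ • χ x • _
    rw [map_smul, ← eFrame_totalSign, hs, map_zsmul, smul_comm]

/-- Every element of a fibre is the value of a global section. -/
theorem exists_eForm_eq [T2Space M] (p : M) (t : Ext (TangentSpace (𝓡 n) p) ⊗[ℂ] (Ep p × Em p)) :
    ∃ θ : EForm (n := n) Fp Ep Fm Em, θ.1 p = t := by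
  obtain ⟨θ, h, -⟩ := exists_eForm (n := n) (Ep := Ep) (Em := Em) p (eCoord Fp Ep Fm Em p p t)
  refine ⟨θ, ?_⟩
  rw [h.self_of_nhds, eFrame_coord (mem_of_mem_nhds (coordSet_mem p))]

end EFrames

/-! ### The exterior derivative on a manifold -/

section Deriv

variable {n : ℕ} {M : Type*} [TopologicalSpace M]
  [ChartedSpace (EuclideanSpace ℝ (Fin n)) M] [IsManifold (𝓡 n) ∞ M]

/-- The coordinate `1`-form `dx^i`. -/
def dx (i : Fin n) : Ext (EuclideanSpace ℝ (Fin n)) := ExteriorAlgebra.ι ℂ (dxBasis n i)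

theorem mul_dx (a : Ext (EuclideanSpace ℝ (Fin n))) (i : Fin n) : a * dx i = dx i * extSign a :=
  mul_ι_eq _ _

theorem dx_mul (a : Ext (EuclideanSpace ℝ (Fin n))) (i : Fin n) : dx i * a = extSign a * dx i := by
  rw [mul_dx, extSign_extSign]

theorem ι_eq_sum_dx (l : EuclideanSpace ℝ (Fin n) →ₗ[ℝ] ℂ) :
    ExteriorAlgebra.ι ℂ l = ∑ i, l (EuclideanSpace.single i 1) • dx i := by
  conv_lhs => rw [dxBasis_repr l, map_sum]
  simp only [map_smul, dx]

theorem formCoord_injective {p x : M} (hx : x ∈ (chartAt (EuclideanSpace ℝ (Fin n)) p).source) :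
    Function.Injective (formCoord (n := n) p x) :=
  Function.LeftInverse.injective (formFrame_coord hx)

theorem formCoord_rawExtDeriv {α : RawForm n M} {p : M}
    {D : Fin n → Ext (EuclideanSpace ℝ (Fin n))}
    (hD : HasPartials (fun x => formCoord p x (α x)) D p) :
    formCoord p p (rawExtDeriv α p) = ∑ i, dx i * D i := by
  rw [rawExtDeriv, ← formFrame_apply, formCoord_frame (mem_chart_source _ p), euclExtDeriv]
  refine Finset.sum_congr rfl fun i _ => ?_
  rw [← (dxBasis n).ExteriorAlgebra.sum_repr (D i), Finset.mul_sum]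
  refine Finset.sum_congr rfl fun J _ => ?_
  rw [mul_smul_comm]
  congr 1
  exact (hD ((dxBasis n).ExteriorAlgebra.coord J)).2 i

theorem formCoord_extDeriv {α : Form n M} {p : M} {D : Fin n → Ext (EuclideanSpace ℝ (Fin n))}
    (hD : HasPartials (fun x => formCoord p x (α.1 x)) D p) :
    formCoord p p (extDeriv n M α p) = ∑ i, dx i * D i :=
  formCoord_rawExtDeriv hD

theorem form_hasPartials (α : Form n M) (p : M) :
    ∃ D : Fin n → Ext (EuclideanSpace ℝ (Fin n)),
      HasPartials (fun x => formCoord p x (α.1 x)) D p :=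
  (α.2 p).exists_hasPartials

/-- The exterior derivative is an antiderivation. -/
theorem extDeriv_formMul (α β : Form n M) (p : M) :
    extDeriv n M (formMul α β) p =
      extDeriv n M α p * β.1 p + extSign (α.1 p) * extDeriv n M β p := by
  obtain ⟨D, hD⟩ := form_hasPartials α p
  obtain ⟨D', hD'⟩ := form_hasPartials β p
  refine formCoord_injective (mem_chart_source _ p) ?_
  have h := hD.bilinear hD' (LinearMap.mul ℂ _)
  rw [map_add, formCoord_mul, formCoord_mul, formCoord_sign, formCoord_extDeriv hD,
    formCoord_extDeriv hD', formCoord_extDeriv (α := formMul α β)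
      (h.congr (Filter.Eventually.of_forall fun x => formCoord_mul _ _ _ _))]
  simp only [LinearMap.mul_apply', mul_add, Finset.sum_add_distrib, Finset.sum_mul, Finset.mul_sum,
    ← mul_assoc]
  simp only [dx_mul (formCoord p p (α.1 p))]

theorem tangent_change_eq {p x : M} (hx : x ∈ (chartAt (EuclideanSpace ℝ (Fin n)) p).source)
    (v : EuclideanSpace ℝ (Fin n)) :
    tangentCoframe n M x x (tangentFrame n M p x v) = tangentCoordChange (𝓡 n) p x x v := by
  have h1 := TangentBundle.symmL_trivializationAt_eq_core (I := 𝓡 n) (𝕜 := ℝ) hx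
  have h2 := TangentBundle.continuousLinearMapAt_trivializationAt_eq_core (I := 𝓡 n) (𝕜 := ℝ)
    (mem_chart_source (EuclideanSpace ℝ (Fin n)) x)
  have e1 : tangentFrame n M p x v = tangentCoordChange (𝓡 n) p x x v := by
    have := DFunLike.congr_fun h1 v
    exact this
  rw [e1]
  have e2 := DFunLike.congr_fun h2 (tangentCoordChange (𝓡 n) p x x v)
  refine Eq.trans e2 ?_
  exact tangentCoordChange_self (I := 𝓡 n) (by simp)

/-- In the chart at `p`, the differential of a function is the differential of its coordinate
expression. -/
theorem formCoord_extDeriv_funForm (f : M → ℂ) (hf : ∀ p, ContMDiffAt (𝓡 n) 𝓘(ℝ, ℂ) ∞ f p)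
    {p x : M} (hx : x ∈ (chartAt (EuclideanSpace ℝ (Fin n)) p).source) :
    formCoord p x (extDeriv n M (funForm f hf) x) =
      ∑ i, (fderiv ℝ (fun y => f ((extChartAt (𝓡 n) p).symm y)) (extChartAt (𝓡 n) p x)
        (EuclideanSpace.single i 1)) • dx i := by
  -- the differential of the coordinate expression in the chart at `x`
  have hd := (SmoothCoordAt.of_scalar (hf x)).differentiableAt LinearMap.id
  simp only [LinearMap.id_apply] at hd
  set l : EuclideanSpace ℝ (Fin n) →ₗ[ℝ] ℂ :=
    (fderiv ℝ (fun y => f ((extChartAt (𝓡 n) x).symm y)) (extChartAt (𝓡 n) x x)).toLinearMap with hl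
  have hP : HasPartials (fun z => formCoord x z ((funForm f hf).1 z))
      (fun i => algebraMap ℂ _ (l (EuclideanSpace.single i 1))) x := by
    have h0 : HasPartials f (fun i => l (EuclideanSpace.single i 1)) x := fun φ => by
      have hφ : ∀ z, φ z = z * φ 1 := fun z => by
        rw [← smul_eq_mul, ← map_smul, smul_eq_mul, mul_one]
      simp only [hφ (f _)]
      refine ⟨hd.mul_const _, fun i => ?_⟩
      rw [fderiv_mul_const hd, hφ (l _)]
      simp [hl, mul_comm]
    have := h0.linear (LinearMap.toSpanSingleton ℂ _ (1 : Ext (EuclideanSpace ℝ (Fin n))))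
    simp only [LinearMap.toSpanSingleton_apply, ← Algebra.algebraMap_eq_smul_one] at this
    exact this.congr (Filter.Eventually.of_forall fun z =>
      AlgHom.commutes (extPullback (tangentFrame n M x z)) (f z))
  have h1 := formCoord_extDeriv hP
  have h2 : extDeriv n M (funForm f hf) x = formFrame x x (ExteriorAlgebra.ι ℂ l) := by
    rw [← formFrame_coord (mem_chart_source _ x) (extDeriv n M (funForm f hf) x), h1,
      ι_eq_sum_dx l]
    congr 1
    refine Finset.sum_congr rfl fun i _ => ?_
    rw [Algebra.algebraMap_eq_smul_one, mul_smul_comm, mul_one]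
  rw [h2, formCoord_apply, formFrame_apply, extPullback_extPullback, extPullback_ι,
    ι_eq_sum_dx]
  refine Finset.sum_congr rfl fun i _ => ?_
  congr 1
  rw [LinearMap.comp_apply, LinearMap.comp_apply, tangent_change_eq hx]
  -- the chain rule for the change of charts
  have hxp : x ∈ (extChartAt (𝓡 n) p).source ∩ (extChartAt (𝓡 n) x).source := by
    simpa using hx
  have hc := hasFDerivWithinAt_tangentCoordChange (I := 𝓡 n) hxp
  simp only [modelWithCornersSelf_coe, Set.range_id, hasFDerivWithinAt_univ] at hc
  have hx0 : (extChartAt (𝓡 n) p).symm (extChartAt (𝓡 n) p x) = x :=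
    (extChartAt (𝓡 n) p).left_inv hxp.1
  have hcomp := HasFDerivAt.comp (extChartAt (𝓡 n) p x) (g := fun y => f ((extChartAt (𝓡 n) x).symm y))
    (f := (extChartAt (𝓡 n) x) ∘ (extChartAt (𝓡 n) p).symm) (by
      rw [Function.comp_apply, hx0]; exact hd.hasFDerivAt) hc
  have heq : (fun y => f ((extChartAt (𝓡 n) p).symm y)) =ᶠ[nhds (extChartAt (𝓡 n) p x)]
      (fun y => f ((extChartAt (𝓡 n) x).symm y)) ∘
        ((extChartAt (𝓡 n) x) ∘ (extChartAt (𝓡 n) p).symm) := by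
    have hcont : ContinuousAt (extChartAt (𝓡 n) p).symm (extChartAt (𝓡 n) p x) :=
      continuousAt_extChartAt_symm' hxp.1
    have hmem : (extChartAt (𝓡 n) x).source ∈
        nhds ((extChartAt (𝓡 n) p).symm (extChartAt (𝓡 n) p x)) := by
      rw [hx0]; exact extChartAt_source_mem_nhds x
    filter_upwards [hcont.preimage_mem_nhds hmem] with y hy
    simp only [Function.comp_apply]
    rw [(extChartAt (𝓡 n) x).left_inv hy]
  rw [(hcomp.congr_of_eventuallyEq heq).fderiv]
  rfl

/-- The coordinate expression of a smooth function. -/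
theorem contDiffAt_chart {f : M → ℂ} {p : M} (hf : ContMDiffAt (𝓡 n) 𝓘(ℝ, ℂ) ∞ f p) :
    ContDiffAt ℝ ∞ (fun y => f ((extChartAt (𝓡 n) p).symm y)) (extChartAt (𝓡 n) p p) := by
  have h := (contMDiffAt_iff.1 hf).2
  simp only [modelWithCornersSelf_coe, Set.range_id, contDiffWithinAt_univ] at h
  exact h

/-- The differential of a smooth function, as a smooth form. -/
def dFun (f : M → ℂ) (hf : ∀ p, ContMDiffAt (𝓡 n) 𝓘(ℝ, ℂ) ∞ f p) : Form n M :=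
  ⟨extDeriv n M (funForm f hf), fun p => by
    have hs : ∀ i, ContMDiffAt (𝓡 n) 𝓘(ℝ, ℂ) ∞ (fun x =>
        fderiv ℝ (fun y => f ((extChartAt (𝓡 n) p).symm y)) (extChartAt (𝓡 n) p x)
        (EuclideanSpace.single i 1)) p := fun i => by
      have h1 : ContDiffAt ℝ ∞ (fun y => fderiv ℝ (fun y => f ((extChartAt (𝓡 n) p).symm y)) y
          (EuclideanSpace.single i 1)) (extChartAt (𝓡 n) p p) :=
        ((contDiffAt_chart (hf p)).fderiv_right (m := ∞) (by simp)).clm_apply contDiffAt_const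
      exact h1.contMDiffAt.comp p contMDiffAt_extChartAt
    refine (SmoothCoordAt.sum Finset.univ fun i _ =>
      SmoothCoordAt.scalar_smul (hs i) (dx i)).congr ?_
    filter_upwards [chart_source_mem (n := n) p] with x hx
    exact formCoord_extDeriv_funForm f hf hx⟩

theorem extDeriv_dFun (f : M → ℂ) (hf : ∀ p, ContMDiffAt (𝓡 n) 𝓘(ℝ, ℂ) ∞ f p) :
    extDeriv n M (dFun f hf) = 0 := by
  funext p
  set F := fun y => f ((extChartAt (𝓡 n) p).symm y) with hF
  have hc : ContDiffAt ℝ ∞ F (extChartAt (𝓡 n) p p) := contDiffAt_chart (hf p)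
  have hd : DifferentiableAt ℝ (fderiv ℝ F) (extChartAt (𝓡 n) p p) :=
    (hc.fderiv_right (m := 1) (by norm_cast)).differentiableAt (by simp)
  let H : Fin n → Fin n → ℂ := fun i j => fderiv ℝ (fderiv ℝ F) (extChartAt (𝓡 n) p p)
    (EuclideanSpace.single i 1) (EuclideanSpace.single j 1)
  have hsymm : ∀ i j, H i j = H j i := fun i j =>
    (hc.isSymmSndFDerivAt (by
      simpa using WithTop.coe_le_coe.2 (le_top : (2 : ℕ∞) ≤ ⊤))) _ _
  have hP : HasPartials (fun x => formCoord p x ((dFun f hf).1 x))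
      (fun i => ∑ j, H i j • dx j) p := by
    have h1 : ∀ j, HasPartials (fun x => fderiv ℝ F (extChartAt (𝓡 n) p x)
        (EuclideanSpace.single j 1)) (fun i => H i j) p := fun j φ => by
      have hφ : ∀ z, φ z = z * φ 1 := fun z => by
        rw [← smul_eq_mul, ← map_smul, smul_eq_mul, mul_one]
      have hdj : HasFDerivAt (fun y => φ (fderiv ℝ F y (EuclideanSpace.single j 1)))
          ((φ 1) • (ContinuousLinearMap.apply ℝ ℂ (EuclideanSpace.single j (1 : ℝ))).comp
            (fderiv ℝ (fderiv ℝ F) (extChartAt (𝓡 n) p p))) (extChartAt (𝓡 n) p p) := by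
        simp only [hφ (fderiv ℝ F _ _)]
        exact ((ContinuousLinearMap.apply ℝ ℂ (EuclideanSpace.single j (1 : ℝ))).hasFDerivAt.comp _
          hd.hasFDerivAt).mul_const (φ 1)
      have heq : (fun y => φ (fderiv ℝ F (extChartAt (𝓡 n) p ((extChartAt (𝓡 n) p).symm y))
          (EuclideanSpace.single j 1))) =ᶠ[nhds (extChartAt (𝓡 n) p p)]
          (fun y => φ (fderiv ℝ F y (EuclideanSpace.single j 1))) := by
        filter_upwards [extChartAt_target_mem_nhds (I := 𝓡 n) p] with y hy
        rw [(extChartAt (𝓡 n) p).right_inv hy]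
      have := hdj.congr_of_eventuallyEq heq
      refine ⟨this.differentiableAt, fun i => ?_⟩
      rw [this.fderiv, hφ (H i j)]
      simp [H, mul_comm]
    have h2 := HasPartials.sum Finset.univ fun j _ =>
      (h1 j).linear (LinearMap.toSpanSingleton ℂ _ (dx j))
    refine h2.congr ?_
    filter_upwards [chart_source_mem (n := n) p] with x hx
    exact formCoord_extDeriv_funForm f hf hx
  refine formCoord_injective (mem_chart_source _ p) ?_
  rw [formCoord_extDeriv hP, Pi.zero_apply, map_zero]
  simp only [Finset.mul_sum, mul_smul_comm]
  -- the sum is antisymmetric under exchange of the indices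
  have hanti : ∀ i j, dx i * dx j = -(dx j * dx i : Ext (EuclideanSpace ℝ (Fin n))) := fun i j =>
    eq_neg_of_add_eq_zero_left (ExteriorAlgebra.ι_add_mul_swap _ _)
  have h3 : (∑ i, ∑ j, H i j • (dx i * dx j : Ext (EuclideanSpace ℝ (Fin n)))) =
      -∑ i, ∑ j, H i j • (dx i * dx j : Ext (EuclideanSpace ℝ (Fin n))) := by
    conv_lhs => rw [Finset.sum_comm]
    rw [← Finset.sum_neg_distrib]
    refine Finset.sum_congr rfl fun i _ => ?_
    rw [← Finset.sum_neg_distrib]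
    refine Finset.sum_congr rfl fun j _ => ?_
    rw [hsymm j i, hanti j i, smul_neg]
  have h4 : (2 : ℂ) • (∑ i, ∑ j, H i j • (dx i * dx j : Ext (EuclideanSpace ℝ (Fin n)))) = 0 := by
    rw [two_smul]; nth_rw 1 [h3]; exact neg_add_cancel _
  simpa using h4

/-- The forms whose exterior derivative is a smooth closed form. -/
def HasClosedDeriv (α : Form n M) : Prop :=
  ∃ β : Form n M, β.1 = extDeriv n M α ∧ extDeriv n M β = 0

theorem formAdd_val (α β : Form n M) (x : M) : (α + β).1 x = α.1 x + β.1 x := rfl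

theorem HasClosedDeriv.zero : HasClosedDeriv (0 : Form n M) :=
  ⟨0, by rw [map_zero]; rfl, map_zero _⟩

theorem HasClosedDeriv.add {α β : Form n M} (hα : HasClosedDeriv α) (hβ : HasClosedDeriv β) :
    HasClosedDeriv (α + β) := by
  obtain ⟨α', h1, h2⟩ := hα
  obtain ⟨β', h3, h4⟩ := hβ
  refine ⟨α' + β', ?_, by rw [map_add, h2, h4, add_zero]⟩
  rw [map_add, ← h1, ← h3]; rfl

theorem HasClosedDeriv.sum {κ : Type*} (s : Finset κ) {α : κ → Form n M}
    (h : ∀ k ∈ s, HasClosedDeriv (α k)) : HasClosedDeriv (∑ k ∈ s, α k) :=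
  Finset.sum_induction _ _ (fun _ _ => HasClosedDeriv.add) HasClosedDeriv.zero h

theorem extDeriv_sign {α β : Form n M} (h : ∀ x, β.1 x = extSign (α.1 x)) (x : M) :
    extDeriv n M β x = -extSign (extDeriv n M α x) := by
  obtain ⟨D, hD⟩ := form_hasPartials α x
  refine formCoord_injective (mem_chart_source _ x) ?_
  rw [formCoord_extDeriv ((hD.linear extSign.toLinearMap).congr
    (Filter.Eventually.of_forall fun z => by rw [h, formCoord_sign]; rfl)), map_neg, formCoord_sign,
    formCoord_extDeriv hD, map_sum, ← Finset.sum_neg_distrib]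
  refine Finset.sum_congr rfl fun i _ => ?_
  rw [map_mul, dx, extSign_ι, neg_mul, neg_neg]; rfl

theorem HasClosedDeriv.mul {α β : Form n M} (hα : HasClosedDeriv α) (hβ : HasClosedDeriv β) :
    HasClosedDeriv (formMul α β) := by
  obtain ⟨α', h1, h2⟩ := hα
  obtain ⟨β', h3, h4⟩ := hβ
  refine ⟨formMul α' β + formMul (formSgn (-1) α) β', ?_, ?_⟩
  · funext x
    rw [extDeriv_formMul, ← h1, ← h3]
    change α'.1 x * β.1 x + extSgn (-1) (α.1 x) * β'.1 x = _
    rw [extSgn_neg_one]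
  · funext x
    rw [map_add, Pi.add_apply, extDeriv_formMul, extDeriv_formMul, h2, h4, ← h3,
      extDeriv_sign (α := α) (fun x => by simp [formSgn]), ← h1]
    simp

theorem HasClosedDeriv.funForm (f : M → ℂ) (hf : ∀ p, ContMDiffAt (𝓡 n) 𝓘(ℝ, ℂ) ∞ f p) :
    HasClosedDeriv (funForm f hf) := ⟨dFun f hf, rfl, extDeriv_dFun f hf⟩

theorem HasClosedDeriv.dFun (f : M → ℂ) (hf : ∀ p, ContMDiffAt (𝓡 n) 𝓘(ℝ, ℂ) ∞ f p) :
    HasClosedDeriv (dFun f hf) := by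
  refine ⟨0, ?_, map_zero _⟩
  rw [extDeriv_dFun]; rfl

theorem exists_function [T2Space M] (p : M) (g : M → ℂ)
    (hg : ∀ q ∈ (chartAt (EuclideanSpace ℝ (Fin n)) p).source,
      ContMDiffAt (𝓡 n) 𝓘(ℝ, ℂ) ∞ g q) :
    ∃ f : M → ℂ, (∀ q, ContMDiffAt (𝓡 n) 𝓘(ℝ, ℂ) ∞ f q) ∧ ∀ᶠ x in nhds p, f x = g x := by
  obtain ⟨χ, h1, h2⟩ := exists_cutoff (n := n) (X := fun _ : M => ℂ)
    (fun _ _ => LinearMap.id) (fun _ _ => LinearMap.id)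
    (fun p => (chartAt (EuclideanSpace ℝ (Fin n)) p).source)
    chart_source_mem (fun p q r h h' w => SmoothCoordAt.const w) p
    (chart_source_mem p) subset_rfl g
    (fun q hq => SmoothCoordAt.of_scalar (hg q hq))
  refine ⟨fun x => χ x * g x, fun q => h2 q LinearMap.id, ?_⟩
  filter_upwards [h1] with x hx
  simp [hx]

/-- Forms with constant coefficients in the chart at `p`, near `p`. -/
theorem exists_const_hasClosedDeriv [T2Space M] (p : M) (w : Ext (EuclideanSpace ℝ (Fin n))) :
    ∃ α : Form n M, HasClosedDeriv α ∧ ∀ᶠ x in nhds p, formCoord p x (α.1 x) = w := by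
  induction w using ExteriorAlgebra.induction with
  | algebraMap c =>
    refine ⟨funForm (fun _ => c) fun _ => contMDiffAt_const, HasClosedDeriv.funForm _ _,
      Filter.Eventually.of_forall fun x => ?_⟩
    exact AlgHom.commutes _ _
  | ι l =>
    -- the differential of a cut-off of the linear function `l` of the coordinates
    obtain ⟨f, hf, hfl⟩ := exists_function (n := n) p (fun x => l (extChartAt (𝓡 n) p x))
      (fun q hq => (LinearMap.toContinuousLinearMap l).contDiff.contMDiff.contMDiffAt.comp q
        (contMDiffAt_extChartAt' hq))
    refine ⟨dFun f hf, HasClosedDeriv.dFun f hf, ?_⟩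
    filter_upwards [chart_source_mem (n := n) p, hfl.eventually_nhds] with x hx hxl
    refine (formCoord_extDeriv_funForm f hf hx).trans ?_
    rw [ι_eq_sum_dx l]
    refine Finset.sum_congr rfl fun i _ => ?_
    congr 1
    have hxs : x ∈ (extChartAt (𝓡 n) p).source := by simpa using hx
    have heq : (fun y => f ((extChartAt (𝓡 n) p).symm y)) =ᶠ[nhds (extChartAt (𝓡 n) p x)]
        LinearMap.toContinuousLinearMap l := by
      have hcont := (continuousAt_extChartAt_symm' (I := 𝓡 n) hxs).tendsto
      rw [(extChartAt (𝓡 n) p).left_inv hxs] at hcont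
      have htar : (extChartAt (𝓡 n) p).target ∈ nhds (extChartAt (𝓡 n) p x) :=
        extChartAt_target_mem_nhds' ((extChartAt (𝓡 n) p).map_source hxs)
      filter_upwards [hcont.eventually hxl, htar] with y hy hyt
      rw [hy, (extChartAt (𝓡 n) p).right_inv hyt]
      rfl
    rw [heq.fderiv_eq, ContinuousLinearMap.fderiv]
    rfl
  | mul a b ha hb =>
    obtain ⟨α, h1, h2⟩ := ha
    obtain ⟨β, h3, h4⟩ := hb
    refine ⟨formMul α β, h1.mul h3, ?_⟩
    filter_upwards [h2, h4] with x hx hy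
    rw [← hx, ← hy]
    exact formCoord_mul _ _ _ _
  | add a b ha hb =>
    obtain ⟨α, h1, h2⟩ := ha
    obtain ⟨β, h3, h4⟩ := hb
    refine ⟨α + β, h1.add h3, ?_⟩
    filter_upwards [h2, h4] with x hx hy
    rw [← hx, ← hy]
    exact map_add _ _ _

/-- Every form coincides near `p` with one whose exterior derivative is smooth and closed. -/
theorem exists_hasClosedDeriv [T2Space M] (α : Form n M) (p : M) :
    ∃ β : Form n M, HasClosedDeriv β ∧ ∀ᶠ x in nhds p, β.1 x = α.1 x := by
  let b := (dxBasis n).ExteriorAlgebra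
  choose f hf hfe using fun J => exists_function (n := n) p
    (fun x => b.coord J (formCoord p x (α.1 x))) (fun q hq => form_smooth_at α hq (b.coord J))
  choose β hβ hβe using fun J => exists_const_hasClosedDeriv (n := n) p (b J)
  refine ⟨∑ J, formMul (funForm (f J) (hf J)) (β J),
    HasClosedDeriv.sum _ fun J _ => (HasClosedDeriv.funForm _ _).mul (hβ J), ?_⟩
  have hsum : ∀ x, (∑ J, formMul (funForm (f J) (hf J)) (β J) : Form n M).1 x =
      ∑ J, f J x • (β J).1 x := fun x => by
    have : ∀ s : Finset (Finset (Fin n)), (∑ J ∈ s, formMul (funForm (f J) (hf J)) (β J) :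
        Form n M).1 x = ∑ J ∈ s, f J x • (β J).1 x := fun s => by
      classical
      induction s using Finset.induction_on with
      | empty => rfl
      | insert J s hJ ih =>
        rw [Finset.sum_insert hJ, Finset.sum_insert hJ, formAdd_val, ih]
        congr 1
    exact this _
  filter_upwards [Filter.eventually_all.2 hfe, Filter.eventually_all.2 hβe,
    chart_source_mem (n := n) p] with x hx hy hxs
  refine formCoord_injective hxs ?_
  rw [hsum, map_sum]
  simp only [map_smul, hx, hy]
  exact b.sum_repr _

end Deriv

/-! ### Form degrees -/

section Degrees

variable {W : Type*} [AddCommGroup W] [Module ℝ W]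

theorem extProj_mem (k : ℕ) (a : Ext W) : extProj k a ∈ (⋀[ℂ]^k (W →ₗ[ℝ] ℂ)) :=
  SetLike.coe_mem (DirectSum.decompose (fun i : ℕ => ⋀[ℂ]^i (W →ₗ[ℝ] ℂ)) a k)

theorem extProj_mul {j : ℕ} {b : Ext W} (hb : b ∈ (⋀[ℂ]^j (W →ₗ[ℝ] ℂ))) (k : ℕ) (a : Ext W) :
    extProj (j + k) (b * a) = b * extProj k a := by
  simp only [extProj, GradedAlgebra.proj_apply]
  exact DirectSum.coe_decompose_mul_add_of_left_mem (fun i : ℕ => ⋀[ℂ]^i (W →ₗ[ℝ] ℂ)) hb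

theorem extProj_mul_of_lt {j k : ℕ} {b : Ext W} (hb : b ∈ (⋀[ℂ]^j (W →ₗ[ℝ] ℂ))) (h : k < j)
    (a : Ext W) : extProj k (b * a) = 0 := by
  simp only [extProj, GradedAlgebra.proj_apply]
  exact DirectSum.coe_decompose_mul_of_left_mem_of_not_le (fun i : ℕ => ⋀[ℂ]^i (W →ₗ[ℝ] ℂ)) hb
    (by omega)

theorem extSign_of_mem_two {b : Ext W} (hb : b ∈ (⋀[ℂ]^2 (W →ₗ[ℝ] ℂ))) : extSign b = b := by
  have hb' : b ∈ LinearMap.range (ExteriorAlgebra.ι ℂ : (W →ₗ[ℝ] ℂ) →ₗ[ℂ] Ext W) ^ 2 := hb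
  clear hb
  rw [sq] at hb'
  induction hb' using Submodule.mul_induction_on' with
  | mem_mul_mem x hx y hy =>
    obtain ⟨l, rfl⟩ := hx
    obtain ⟨m, rfl⟩ := hy
    rw [map_mul, extSign_ι, extSign_ι, neg_mul_neg]
  | add x _ y _ hx hy => rw [map_add, hx, hy]

variable {n : ℕ} {M : Type*} [TopologicalSpace M]
  [ChartedSpace (EuclideanSpace ℝ (Fin n)) M] [IsManifold (𝓡 n) ∞ M]

theorem dx_mem (i : Fin n) : dx i ∈ (⋀[ℂ]^1 (EuclideanSpace ℝ (Fin n) →ₗ[ℝ] ℂ)) := by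
  change _ ∈ LinearMap.range (ExteriorAlgebra.ι ℂ) ^ 1
  rw [pow_one]
  exact LinearMap.mem_range_self _ _

theorem formCoord_proj (k : ℕ) (p x : M) (a : Ext (TangentSpace (𝓡 n) x)) :
    formCoord p x (extProj k a) = extProj k (formCoord p x a) := extPullback_proj _ k a

/-- The exterior derivative raises the degree by one. -/
theorem extDeriv_formComponent (k : ℕ) (α : Form n M) (x : M) :
    extDeriv n M (formComponent k α) x = extProj (k + 1) (extDeriv n M α x) := by
  obtain ⟨D, hD⟩ := form_hasPartials α x
  have hD' : HasPartials (fun y => formCoord x y ((formComponent k α).1 y))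
      (fun i => extProj k (D i)) x :=
    (hD.linear (extProj k)).congr
      (Filter.Eventually.of_forall fun y => formCoord_proj k x y (α.1 y))
  refine formCoord_injective (mem_chart_source _ x) ?_
  rw [formCoord_extDeriv hD', formCoord_proj, formCoord_extDeriv hD, map_sum]
  exact Finset.sum_congr rfl fun i _ => by rw [add_comm, extProj_mul (dx_mem i)]

theorem extProj_zero_extDeriv (α : Form n M) (x : M) : extProj 0 (extDeriv n M α x) = 0 := by
  obtain ⟨D, hD⟩ := form_hasPartials α x
  refine formCoord_injective (mem_chart_source _ x) ?_
  rw [formCoord_proj, formCoord_extDeriv hD, map_sum, map_zero]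
  exact Finset.sum_eq_zero fun i _ => extProj_mul_of_lt (dx_mem i) one_pos _

theorem formComponent_mem (k : ℕ) (α : Form n M) : formComponent k α ∈ FormDeg n M k :=
  fun x => extProj_mem k (α.1 x)

theorem formComponent_sub (k : ℕ) (α β : Form n M) :
    formComponent k (α - β) = formComponent k α - formComponent k β :=
  Form.ext fun x => map_sub (extProj k) (α.1 x) (β.1 x)

theorem pairComponent_mem (i : ℕ) (c : Form n M × Form n M) :
    pairComponent i c ∈ primitiveChain n M i := by
  cases i with
  | zero => exact ⟨formComponent_mem 0 c.1, rfl⟩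
  | succ i => exact ⟨formComponent_mem (i + 1) c.1, formComponent_mem i c.2⟩

theorem pairComponent_sub (i : ℕ) (c c' : Form n M × Form n M) :
    pairComponent i (c - c') = pairComponent i c - pairComponent i c' := by
  cases i with
  | zero => exact Prod.ext (formComponent_sub 0 c.1 c'.1) (sub_zero (0 : Form n M)).symm
  | succ i => exact Prod.ext (formComponent_sub (i + 1) c.1 c'.1) (formComponent_sub i c.2 c'.2)

theorem boundary_fst (σ : Form n M) (c : Form n M × Form n M) (x : M) :
    (boundary σ c).1 x = extDeriv n M c.1 x + σ.1 x * c.2.1 x := rfl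

theorem boundary_snd (σ : Form n M) (c : Form n M × Form n M) (x : M) :
    (boundary σ c).2 x = -extDeriv n M c.2 x := rfl

/-- The boundary operator of the primitive complex has degree one. -/
theorem boundary_pairComponent {σ : Form n M} (hσ : σ ∈ FormDeg n M 2) (i : ℕ)
    (c : Form n M × Form n M) :
    (∀ x, (boundary σ (pairComponent i c)).1 x = extProj (i + 1) ((boundary σ c).1 x)) ∧
      ∀ x, (boundary σ (pairComponent i c)).2 x = extProj i ((boundary σ c).2 x) := by
  cases i with
  | zero =>
    refine ⟨fun x => ?_, fun x => ?_⟩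
    · rw [boundary_fst, boundary_fst, map_add, extProj_mul_of_lt (hσ x) (by norm_num)]
      refine congrArg₂ (· + ·) (extDeriv_formComponent 0 c.1 x) ?_
      exact mul_zero _
    · rw [boundary_snd, boundary_snd, map_neg, extProj_zero_extDeriv]
      refine congrArg Neg.neg ?_
      exact congrFun (map_zero (extDeriv n M)) x
  | succ i =>
    refine ⟨fun x => ?_, fun x => ?_⟩
    · rw [boundary_fst, boundary_fst, map_add, show i + 1 + 1 = 2 + i by ring,
        extProj_mul (hσ x), show 2 + i = i + 1 + 1 by ring]
      exact congrArg (· + _) (extDeriv_formComponent (i + 1) c.1 x)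
    · rw [boundary_snd, boundary_snd, map_neg]
      exact congrArg Neg.neg (extDeriv_formComponent i c.2 x)

theorem pairComponent_mem_cocycle {σ : Form n M} (hσ : σ ∈ FormDeg n M 2) (i : ℕ)
    {c : Form n M × Form n M} (hc : boundary σ c = 0) :
    pairComponent i c ∈ primitiveCocycle σ i := by
  refine ⟨pairComponent_mem i c, LinearMap.mem_ker.2 ?_⟩
  obtain ⟨h1, h2⟩ := boundary_pairComponent hσ i c
  rw [hc] at h1 h2
  exact Prod.ext (funext fun x => (h1 x).trans (map_zero _))
    (funext fun x => (h2 x).trans (map_zero _))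

/-- The components of a boundary are coboundaries. -/
theorem pairComponent_mem_coboundary {σ : Form n M} (hσ : σ ∈ FormDeg n M 2) (i : ℕ)
    {c η : Form n M × Form n M} (h : inclPair n M c = boundary σ η) :
    pairComponent i c ∈ primitiveCoboundary σ i := by
  have h1 : ∀ x, c.1.1 x = (boundary σ η).1 x := fun x => congrArg (fun u => u.1 x) h
  have h2 : ∀ x, c.2.1 x = (boundary σ η).2 x := fun x => congrArg (fun u => u.2 x) h
  cases i with
  | zero =>
    refine Prod.ext (Form.ext fun x => ?_) rfl
    refine (congrArg (extProj 0) (h1 x)).trans ?_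
    rw [boundary_fst, map_add, extProj_zero_extDeriv, extProj_mul_of_lt (hσ x) (by norm_num),
      add_zero]
    rfl
  | succ i =>
    obtain ⟨h3, h4⟩ := boundary_pairComponent hσ i η
    refine ⟨pairComponent i η, pairComponent_mem i η, Prod.ext (funext fun x => ?_)
      (funext fun x => ?_)⟩
    · exact (h3 x).trans (congrArg (extProj (i + 1)) (h1 x)).symm
    · exact (h4 x).trans (congrArg (extProj i) (h2 x)).symm

/-- Two pairs of forms whose difference is a boundary have cohomologous components. -/
theorem primitive_class_eq {σ : Form n M} (hσ : σ ∈ FormDeg n M 2)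
    {c c' η : Form n M × Form n M} (hc : boundary σ c = 0) (hc' : boundary σ c' = 0)
    (h : inclPair n M (c' - c) = boundary σ η) (i : ℕ) :
    ∃ (h₀ : pairComponent i c ∈ primitiveCocycle σ i)
      (h₁ : pairComponent i c' ∈ primitiveCocycle σ i),
      (Submodule.Quotient.mk ⟨_, h₁⟩ : PrimitiveCohomology σ i) = Submodule.Quotient.mk ⟨_, h₀⟩ := by
  refine ⟨pairComponent_mem_cocycle hσ i hc, pairComponent_mem_cocycle hσ i hc', ?_⟩
  refine (Submodule.Quotient.eq _).2 ?_
  have := pairComponent_mem_coboundary hσ i h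
  rw [pairComponent_sub] at this
  exact this

/-- The integral over `[0, 1]` of a polynomial family of forms. -/
theorem isFormIntegral_polynomial {F : ℝ → Form n M} {N : ℕ} {c : ℕ → Form n M}
    (hF : ∀ t, F t = ∑ k ∈ Finset.range N, (t : ℂ) ^ k • c k) :
    IsFormIntegral F 0 1 (∑ k ∈ Finset.range N, ((k : ℂ) + 1)⁻¹ • c k) := by
  intro x φ
  let L : Form n M →ₗ[ℂ] ℂ := φ ∘ₗ LinearMap.proj x ∘ₗ formIncl n M
  have h1 : ∀ t, φ ((F t).1 x) = ∑ k ∈ Finset.range N, (t : ℂ) ^ k * L (c k) := fun t => by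
    change L (F t) = _
    rw [hF, map_sum]
    exact Finset.sum_congr rfl fun k _ => by rw [map_smul, smul_eq_mul]
  have hcont : ∀ k, Continuous fun t : ℝ => (t : ℂ) ^ k * L (c k) := fun k => by fun_prop
  simp only [h1]
  refine ⟨(continuous_finsetSum _ fun k _ => hcont k).intervalIntegrable 0 1, ?_⟩
  rw [intervalIntegral.integral_finsetSum fun k _ => (hcont k).intervalIntegrable 0 1]
  change L _ = _
  rw [map_sum]
  refine Finset.sum_congr rfl fun k _ => ?_
  have h2 : ∫ t in (0 : ℝ)..1, (t : ℂ) ^ k = ((k : ℂ) + 1)⁻¹ := by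
    have h3 : ∀ t : ℝ, (t : ℂ) ^ k = ((t ^ k : ℝ) : ℂ) := fun t => by push_cast; rfl
    simp only [h3]
    rw [intervalIntegral.integral_ofReal, integral_pow]
    simp
  rw [intervalIntegral.integral_mul_const, h2, map_smul, smul_eq_mul]

end Degrees

/-! ### The transgression formula for polynomials in a noncommutative algebra -/

section Transgression

open Polynomial

variable {R V V' : Type*} [Ring R] [Algebra ℂ R] [AddCommGroup V] [Module ℂ V] [AddCommGroup V']
  [Module ℂ V']

/-- The data of a supertrace `τ` on a graded subalgebra `G 1 ⊕ G (-1)` of `R`. -/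
structure IsSupertrace (G : ℤˣ → Submodule ℂ R) (τ : R →ₗ[ℂ] V) : Prop where
  one_mem : 1 ∈ G 1
  mul_mem : ∀ {s s' x y}, x ∈ G s → y ∈ G s' → x * y ∈ G (s * s')
  comm : ∀ {s s' x y}, x ∈ G s → y ∈ G s' → τ (x * y) = ((koszul s s' : ℤ) : ℂ) • τ (y * x)

variable {G : ℤˣ → Submodule ℂ R} {τ : R →ₗ[ℂ] V}

/-- The polynomials with all coefficients in `G s`. -/
def HasCoeffsIn (G : ℤˣ → Submodule ℂ R) (s : ℤˣ) (p : R[X]) : Prop := ∀ k, p.coeff k ∈ G s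

theorem IsSupertrace.coeffs_mul (h : IsSupertrace G τ) {s s' : ℤˣ} {p q : R[X]}
    (hp : HasCoeffsIn G s p) (hq : HasCoeffsIn G s' q) : HasCoeffsIn G (s * s') (p * q) := fun k => by
  rw [coeff_mul]
  exact Submodule.sum_mem _ fun i _ => h.mul_mem (hp _) (hq _)

theorem IsSupertrace.coeffs_pow (h : IsSupertrace G τ) {q : R[X]} (hq : HasCoeffsIn G 1 q) (m : ℕ) :
    HasCoeffsIn G 1 (q ^ m) := by
  induction m with
  | zero =>
    intro k
    rw [pow_zero, coeff_one]
    split_ifs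
    · exact h.one_mem
    · exact Submodule.zero_mem _
  | succ m ih => simpa [pow_succ] using h.coeffs_mul ih hq

theorem HasCoeffsIn.derivative {s : ℤˣ} {p : R[X]} (hp : HasCoeffsIn G s p) :
    HasCoeffsIn G s (derivative p) := fun k => by
  rw [coeff_derivative]
  have h : p.coeff (k + 1) * ((k : R) + 1) = ((k : ℂ) + 1) • p.coeff (k + 1) := by
    rw [Algebra.smul_def, map_add, map_natCast, map_one]
    exact ((Nat.cast_commute k _).add_left (Commute.one_left _)).eq.symm
  rw [h]
  exact Submodule.smul_mem _ _ (hp _)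

theorem IsSupertrace.coeff_comm (h : IsSupertrace G τ) {s s' : ℤˣ} {p q : R[X]}
    (hp : HasCoeffsIn G s p) (hq : HasCoeffsIn G s' q) (k : ℕ) :
    τ ((p * q).coeff k) = ((koszul s s' : ℤ) : ℂ) • τ ((q * p).coeff k) := by
  rw [coeff_mul, coeff_mul, map_sum, map_sum, Finset.smul_sum,
    ← Finset.Nat.sum_antidiagonal_swap]
  exact Finset.sum_congr rfl fun i _ => h.comm (hp _) (hq _)

theorem koszul_one_left (s : ℤˣ) : koszul 1 s = 1 := by simp [koszul]

/-- `τ((Q^m)' Q^j) = m τ(Q' Q^{m-1+j})`, by cyclicity of the supertrace. -/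
theorem IsSupertrace.derivative_pow (h : IsSupertrace G τ) {q : R[X]} (hq : HasCoeffsIn G 1 q)
    (m j k : ℕ) : τ ((derivative (q ^ (m + 1)) * q ^ j).coeff k) =
      ((m : ℂ) + 1) • τ ((derivative q * q ^ (m + j)).coeff k) := by
  induction m generalizing j with
  | zero => simp
  | succ m ih =>
    have e1 : derivative (q ^ (m + 1 + 1)) * q ^ j = derivative (q ^ (m + 1)) * q ^ (j + 1) +
        q ^ (m + 1) * (derivative q * q ^ j) := by
      rw [pow_succ q (m + 1), derivative_mul, add_mul, mul_assoc, mul_assoc, ← pow_succ']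
    have e2 : HasCoeffsIn G 1 (derivative q * q ^ j) := by
      simpa using h.coeffs_mul hq.derivative (h.coeffs_pow hq j)
    rw [e1, coeff_add, map_add, ih, h.coeff_comm (h.coeffs_pow hq (m + 1)) e2, koszul_one_left,
      mul_assoc, ← pow_add, Units.val_one, Int.cast_one, one_smul, show m + (j + 1) = m + 1 + j by ring,
      show j + (m + 1) = m + 1 + j by ring, Nat.cast_succ]
    module

/-- The square of `z ↦ A₀ + z a`. -/
def lineSquare (A₀ a : R) : R[X] := (C A₀ + C a * X) * (C A₀ + C a * X)

theorem derivative_lineSquare (A₀ a : R) : derivative (lineSquare A₀ a) =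
    C a * (C A₀ + C a * X) + (C A₀ + C a * X) * C a := by
  simp [lineSquare, derivative_mul]

/-- The derivative of `τ(f(𝒜²))` along the line `𝒜 = A₀ + z a` is the supertrace of the
anticommutator of `𝒜` with `a f'(𝒜²)`. -/
theorem IsSupertrace.derivative_aeval (h : IsSupertrace G τ) {A₀ a : R}
    (hQ : HasCoeffsIn G 1 (lineSquare A₀ a)) (f : ℂ[X]) (k : ℕ) :
    τ ((derivative (aeval (lineSquare A₀ a) f)).coeff k) =
      τ (((C A₀ + C a * X) * (C a * aeval (lineSquare A₀ a) (derivative f)) +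
        C a * aeval (lineSquare A₀ a) (derivative f) * (C A₀ + C a * X)).coeff k) := by
  set L : R[X] := C A₀ + C a * X with hL
  set q := lineSquare A₀ a with hq
  have hqL : q = L * L := rfl
  have hcomm : ∀ m, Commute (q ^ m) L := fun m =>
    Commute.pow_left (by rw [hqL]; exact (Commute.refl L).mul_left (Commute.refl L)) m
  induction f using Polynomial.induction_on' with
  | add f g hf hg =>
    simp only [map_add, coeff_add, mul_add, add_mul] at hf hg ⊢
    rw [hf, hg]
    abel
  | monomial m c =>
    rw [derivative_monomial, aeval_monomial, aeval_monomial]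
    rcases m with _ | m
    · simp [Polynomial.algebraMap_apply]
    · have e0 : τ ((derivative (q ^ (m + 1))).coeff k) =
          ((m : ℂ) + 1) • τ ((derivative q * q ^ m).coeff k) := by
        simpa using h.derivative_pow hQ m 0 k
      have e1 : derivative q * q ^ m = L * (C a * q ^ m) + C a * q ^ m * L := by
        rw [hq, derivative_lineSquare, add_mul, ← hq, mul_assoc, mul_assoc, mul_assoc,
          (hcomm m).eq, add_comm]
      have e2 : L * (C a * (algebraMap ℂ R[X] (c * ((m + 1 : ℕ) : ℂ)) * q ^ m)) +
          C a * (algebraMap ℂ R[X] (c * ((m + 1 : ℕ) : ℂ)) * q ^ m) * L =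
          (c * ((m : ℂ) + 1)) • (L * (C a * q ^ m) + C a * q ^ m * L) := by
        rw [← Algebra.smul_def, mul_smul_comm, mul_smul_comm, smul_mul_assoc, ← smul_add,
          Nat.cast_succ]
      rw [Nat.add_sub_cancel, e2, ← e1, ← Algebra.smul_def, derivative_smul, coeff_smul,
        coeff_smul, map_smul, map_smul, e0, smul_smul]

theorem IsSupertrace.coeffs_aeval (h : IsSupertrace G τ) {q : R[X]} (hq : HasCoeffsIn G 1 q)
    (f : ℂ[X]) : HasCoeffsIn G 1 (aeval q f) := by
  induction f using Polynomial.induction_on' with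
  | add f g hf hg =>
    intro k
    rw [map_add, coeff_add]
    exact Submodule.add_mem _ (hf k) (hg k)
  | monomial m c =>
    intro k
    rw [aeval_monomial, ← Algebra.smul_def, coeff_smul]
    exact Submodule.smul_mem _ _ (h.coeffs_pow hq m k)

/-- Evaluation of polynomials with coefficients in `R` at a scalar. -/
def scalarEval (t : ℂ) : R[X] →ₐ[ℂ] R :=
  { Polynomial.eval₂RingHom' (RingHom.id R) (algebraMap ℂ R t)
      (fun r => (Algebra.commutes t r).symm) with
    commutes' := fun c => by
      change eval₂ (RingHom.id R) (algebraMap ℂ R t) (algebraMap ℂ R[X] c) = _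
      rw [Polynomial.algebraMap_apply, eval₂_C, RingHom.id_apply] }

theorem scalarEval_eq_sum (t : ℂ) (p : R[X]) :
    scalarEval t p = ∑ k ∈ Finset.range (p.natDegree + 1), t ^ k • p.coeff k := by
  change eval₂ (RingHom.id R) (algebraMap ℂ R t) p = _
  rw [eval₂_eq_sum_range]
  refine Finset.sum_congr rfl fun k _ => ?_
  rw [← map_pow, Algebra.smul_def, RingHom.id_apply]
  exact (Algebra.commutes _ _).symm

theorem scalarEval_line (A₀ a : R) (t : ℂ) :
    scalarEval t (C A₀ + C a * X) = A₀ + t • a := by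
  change eval₂ (RingHom.id R) (algebraMap ℂ R t) _ = _
  rw [eval₂_add, eval₂_C, eval₂_mul_X, eval₂_C, Algebra.smul_def]
  congr 1
  exact (Algebra.commutes _ _).symm

theorem scalarEval_aeval (A₀ a : R) (t : ℂ) (f : ℂ[X]) :
    scalarEval t (aeval (lineSquare A₀ a) f) = aeval ((A₀ + t • a) ^ 2) f := by
  rw [← aeval_algHom_apply, lineSquare, map_mul, scalarEval_line, sq]

theorem scalarEval_C_mul (a : R) (t : ℂ) (p : R[X]) :
    scalarEval t (C a * p) = a * scalarEval t p := by
  rw [map_mul]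
  congr 1
  change eval₂ (RingHom.id R) (algebraMap ℂ R t) _ = _
  rw [eval₂_C]; rfl

/-- The transgression formula, with the primitive of `t ↦ τ(a f'((A₀ + t a)²))` given by its
coefficients `c_k / (k + 1)`. -/
theorem IsSupertrace.transgression (h : IsSupertrace G τ) {A₀ a : R} {b : V →ₗ[ℂ] V'}
    {ι : V →ₗ[ℂ] V'} (ha : a ∈ G (-1)) (hsq : A₀ * A₀ ∈ G 1)
    (hA : ∀ x ∈ G (-1), A₀ * x + x * A₀ ∈ G 1 ∧ ι (τ (A₀ * x + x * A₀)) = b (τ x)) (f : ℂ[X]) :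
    ∃ (N : ℕ) (c : ℕ → V),
      (∀ t : ℂ, τ (a * aeval ((A₀ + t • a) ^ 2) (derivative f)) =
        ∑ k ∈ Finset.range N, t ^ k • c k) ∧
      ι (τ (aeval ((A₀ + a) ^ 2) f) - τ (aeval (A₀ ^ 2) f)) =
        b (∑ k ∈ Finset.range N, ((k : ℂ) + 1)⁻¹ • c k) := by
  have hQ : HasCoeffsIn G 1 (lineSquare A₀ a) := by
    have e : lineSquare A₀ a = C (A₀ * A₀) + C (A₀ * a + a * A₀) * X + C (a * a) * X ^ 2 := by
      simp only [lineSquare, C_mul, C_add, add_mul, mul_add, mul_assoc, X_mul_C, sq]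
      simp only [← mul_assoc, X_mul_C]
      abel
    intro k
    rw [e, coeff_add, coeff_add, coeff_C, coeff_C_mul, coeff_C_mul, coeff_X, coeff_X_pow]
    have e1 : a * a ∈ G 1 := by simpa using h.mul_mem ha ha
    have e2 := (hA a ha).1
    refine Submodule.add_mem _ (Submodule.add_mem _ ?_ ?_) ?_
    · split_ifs
      exacts [hsq, Submodule.zero_mem _]
    · rw [mul_ite, mul_one, mul_zero]
      split_ifs
      exacts [e2, Submodule.zero_mem _]
    · rw [mul_ite, mul_one, mul_zero]
      split_ifs
      exacts [e1, Submodule.zero_mem _]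
  set F : R[X] := aeval (lineSquare A₀ a) f with hF
  set T : R[X] := C a * aeval (lineSquare A₀ a) (derivative f) with hT
  have haC : HasCoeffsIn G (-1) (C a) := fun k => by
    rw [coeff_C]
    split_ifs
    exacts [ha, Submodule.zero_mem _]
  have hTG : HasCoeffsIn G (-1) T := by
    simpa using h.coeffs_mul haC (h.coeffs_aeval hQ (derivative f))
  -- the terms with the odd element `a` do not contribute, by cyclicity
  have hderiv : ∀ k : ℕ, ι (((k : ℂ) + 1) • τ (F.coeff (k + 1))) = b (τ (T.coeff k)) := by
    intro k
    have e1 := h.derivative_aeval hQ f k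
    rw [← hF, mul_assoc, ← mul_assoc (C a), ← hT] at e1
    have e2 : (derivative F).coeff k = ((k : ℂ) + 1) • F.coeff (k + 1) := by
      rw [coeff_derivative, Algebra.smul_def, map_add, map_natCast, map_one]
      exact ((Nat.cast_commute k _).add_left (Commute.one_left _)).eq.symm
    have e3 : τ (((C A₀ + C a * X) * T + T * (C A₀ + C a * X)).coeff k) =
        τ (A₀ * T.coeff k + T.coeff k * A₀) := by
      have e4 : (C A₀ + C a * X) * T + T * (C A₀ + C a * X) =
          (C A₀ * T + T * C A₀) + (C a * T + T * C a) * X := by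
        simp only [add_mul, mul_add, mul_assoc, X_mul]
        abel
      have e5 : τ (((C a * T + T * C a) * X).coeff k) = 0 := by
        rcases k with _ | k
        · rw [mul_coeff_zero, coeff_X_zero, mul_zero, map_zero]
        · rw [coeff_mul_X, coeff_add, map_add, h.coeff_comm haC hTG]
          simp [koszul]
      rw [e4, coeff_add, map_add, e5, add_zero, coeff_add, coeff_C_mul, coeff_mul_C]
    rw [e2, map_smul] at e1
    rw [e1, e3, (hA _ (hTG k)).2]
  refine ⟨max (T.natDegree + 1) F.natDegree, fun k => τ (T.coeff k), fun t => ?_, ?_⟩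
  · rw [← scalarEval_aeval, ← scalarEval_C_mul, ← hT, scalarEval_eq_sum, map_sum]
    simp only [map_smul]
    refine Finset.sum_subset (Finset.range_mono (le_max_left _ _)) fun k _ hk => ?_
    rw [coeff_eq_zero_of_natDegree_lt (by simpa using hk), map_zero, smul_zero]
  · have e0 := scalarEval_aeval A₀ a 0 f
    have e1 := scalarEval_aeval A₀ a 1 f
    rw [zero_smul, add_zero, ← hF] at e0
    rw [one_smul, ← hF] at e1
    rw [← e0, ← e1, scalarEval_eq_sum, scalarEval_eq_sum, Finset.sum_range_succ',
      Finset.sum_range_succ' (fun k => (0 : ℂ) ^ k • F.coeff k)]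
    simp only [one_pow, one_smul, mul_one, pow_succ, mul_zero, zero_smul, Finset.sum_const_zero, zero_add,
      pow_zero, map_add, add_sub_cancel_right, map_sum, map_smul]
    have e2 : ∑ k ∈ Finset.range F.natDegree, ι (τ (F.coeff (k + 1))) =
        ∑ k ∈ Finset.range (max (T.natDegree + 1) F.natDegree), ι (τ (F.coeff (k + 1))) := by
      refine Finset.sum_subset (Finset.range_mono (le_max_right _ _)) fun k _ hk => ?_
      rw [coeff_eq_zero_of_natDegree_lt (by simpa [Nat.lt_succ_iff] using hk), map_zero, map_zero]
    rw [e2]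
    refine Finset.sum_congr rfl fun k _ => ?_
    rw [← hderiv, map_smul, smul_smul, inv_mul_cancel₀ (Nat.cast_add_one_ne_zero k), one_smul]

end Transgression

/-! ### Operators on pairs of forms -/

section PairOperators

variable {X : Type*} [AddCommGroup X] [Module ℂ X]

/-- The operator `(α, β) ↦ (c α, e α + s c β)`. -/
def pairOp (s : ℤˣ) (c e : Module.End ℂ X) : Module.End ℂ (X × X) :=
  LinearMap.prod (c ∘ₗ LinearMap.fst ℂ X X)
    (e ∘ₗ LinearMap.fst ℂ X X + ((s : ℤ) : ℂ) • (c ∘ₗ LinearMap.snd ℂ X X))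

/-- The operator `(α, β) ↦ (a α + w β, b α - a β)`. -/
def coneOp (w a b : Module.End ℂ X) : Module.End ℂ (X × X) :=
  LinearMap.prod (a ∘ₗ LinearMap.fst ℂ X X + w ∘ₗ LinearMap.snd ℂ X X)
    (b ∘ₗ LinearMap.fst ℂ X X - a ∘ₗ LinearMap.snd ℂ X X)

theorem pairOp_apply (s : ℤˣ) (c e : Module.End ℂ X) (α β : X) :
    pairOp s c e (α, β) = (c α, e α + ((s : ℤ) : ℂ) • c β) := rfl

theorem coneOp_apply (w a b : Module.End ℂ X) (α β : X) :
    coneOp w a b (α, β) = (a α + w β, b α - a β) := rfl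

theorem pairOp_add (s : ℤˣ) (c e c' e' : Module.End ℂ X) :
    pairOp s c e + pairOp s c' e' = pairOp s (c + c') (e + e') := by
  refine LinearMap.ext fun ⟨α, β⟩ => ?_
  simp only [LinearMap.add_apply, pairOp_apply, Prod.mk_add_mk, smul_add]
  congr 1
  abel

theorem pairOp_smul (s : ℤˣ) (k : ℂ) (c e : Module.End ℂ X) :
    k • pairOp s c e = pairOp s (k • c) (k • e) := by
  refine LinearMap.ext fun ⟨α, β⟩ => ?_
  simp only [LinearMap.smul_apply, pairOp_apply, Prod.smul_mk, smul_add]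
  rw [smul_comm k]

theorem pairOp_sub (s : ℤˣ) (c e c' e' : Module.End ℂ X) :
    pairOp s c e - pairOp s c' e' = pairOp s (c - c') (e - e') := by
  refine LinearMap.ext fun ⟨α, β⟩ => ?_
  simp only [LinearMap.sub_apply, pairOp_apply, Prod.mk_sub_mk, smul_sub]
  congr 1
  abel

theorem pairOp_zero (s : ℤˣ) : pairOp s (0 : Module.End ℂ X) 0 = 0 := by
  refine LinearMap.ext fun ⟨α, β⟩ => ?_
  simp [pairOp_apply]

theorem pairOp_one : pairOp 1 (1 : Module.End ℂ X) 0 = 1 := by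
  refine LinearMap.ext fun ⟨α, β⟩ => ?_
  simp [pairOp_apply]

theorem pairOp_mul (s s' : ℤˣ) (c e c' e' : Module.End ℂ X) :
    pairOp s c e * pairOp s' c' e' =
      pairOp (s * s') (c * c') (e * c' + ((s : ℤ) : ℂ) • (c * e')) := by
  refine LinearMap.ext fun ⟨α, β⟩ => ?_
  simp only [Module.End.mul_apply, pairOp_apply, LinearMap.add_apply, LinearMap.smul_apply, map_add,
    map_smul, smul_add, smul_smul, Units.val_mul, Int.cast_mul, add_assoc]

/-- The supercommutator of two operators identified with pairs. -/
theorem pairOp_supercommutator (s s' : ℤˣ) (c e c' e' : Module.End ℂ X) :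
    pairOp s c e * pairOp s' c' e' -
        ((koszul s s' : ℤ) : ℂ) • (pairOp s' c' e' * pairOp s c e) =
      pairOp (s * s') (c * c' - ((koszul s s' : ℤ) : ℂ) • (c' * c))
        ((e * c' - ((koszul (-s) s' : ℤ) : ℂ) • (c' * e)) +
          ((s : ℤ) : ℂ) • (c * e' - ((koszul s (-s') : ℤ) : ℂ) • (e' * c))) := by
  rw [pairOp_mul, pairOp_mul, mul_comm s' s, pairOp_smul, pairOp_sub]
  congr 1
  rcases Int.units_eq_one_or s with rfl | rfl <;> rcases Int.units_eq_one_or s' with rfl | rfl <;>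
    simp [koszul] <;> abel

/-- The supercommutator of a primitive superconnection with an operator identified with a pair. -/
theorem coneOp_supercommutator {w a b c e : Module.End ℂ X} (s : ℤˣ) (hc : w * c = c * w)
    (he : w * e = e * w) :
    coneOp w a b * pairOp s c e - ((s : ℤ) : ℂ) • (pairOp s c e * coneOp w a b) =
      pairOp (-s) (a * c - ((s : ℤ) : ℂ) • (c * a) + w * e)
        (b * c - c * b - (a * e - (((-s : ℤˣ) : ℤ) : ℂ) • (e * a))) := by
  have hc' : ∀ v, w (c v) = c (w v) := fun v => LinearMap.congr_fun hc v
  have he' : ∀ v, w (e v) = e (w v) := fun v => LinearMap.congr_fun he v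
  refine LinearMap.ext fun ⟨α, β⟩ => ?_
  simp only [Module.End.mul_apply, pairOp_apply, coneOp_apply, LinearMap.add_apply,
    LinearMap.sub_apply, LinearMap.smul_apply, map_add, map_smul, map_sub, hc', he', Prod.smul_mk,
    Prod.mk_sub_mk, smul_add, smul_sub]
  rcases Int.units_eq_one_or s with rfl | rfl <;> simp <;> constructor <;> abel

theorem coneOp_square {w a b : Module.End ℂ X} (ha : a * w = w * a) (hb : w * b = b * w) :
    coneOp w a b * coneOp w a b = pairOp 1 (a * a + w * b) (b * a - a * b) := by
  have ha' : ∀ v, a (w v) = w (a v) := fun v => LinearMap.congr_fun ha v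
  have hb' : ∀ v, w (b v) = b (w v) := fun v => LinearMap.congr_fun hb v
  refine LinearMap.ext fun ⟨α, β⟩ => ?_
  simp only [Module.End.mul_apply, pairOp_apply, coneOp_apply, LinearMap.add_apply,
    LinearMap.sub_apply, map_add, map_sub, ha', hb']
  simp
  abel

theorem coneOp_sub (w a b a' b' : Module.End ℂ X) :
    coneOp w a b - coneOp w a' b' = pairOp (-1) (a - a') (b - b') := by
  refine LinearMap.ext fun ⟨α, β⟩ => ?_
  simp only [LinearMap.sub_apply, pairOp_apply, coneOp_apply]
  simp
  abel

theorem coneOp_line (w a b a' b' : Module.End ℂ X) (t : ℂ) :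
    t • coneOp w a b + (1 - t) • coneOp w a' b' =
      coneOp w (t • a + (1 - t) • a') (t • b + (1 - t) • b') := by
  refine LinearMap.ext fun ⟨α, β⟩ => ?_
  simp only [LinearMap.add_apply, LinearMap.smul_apply, coneOp_apply, Prod.smul_mk, Prod.mk_add_mk,
    Prod.mk.injEq]
  constructor <;> module

end PairOperators

/-! ### Coefficients in one fibre -/

section FibreCoefficients

variable {W W' : Type*} [AddCommGroup W] [Module ℝ W] [AddCommGroup W'] [Module ℝ W']
  {P N P' N' : Type*} [AddCommGroup P] [Module ℂ P] [AddCommGroup N] [Module ℂ N]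
  [AddCommGroup P'] [Module ℂ P'] [AddCommGroup N'] [Module ℂ N']

/-- Contraction of an element of `Λ(W*) ⊗ V` with a covector. -/
def coeffOf (f : (P × N) →ₗ[ℂ] ℂ) : (Ext W ⊗[ℂ] (P × N)) →ₗ[ℂ] Ext W :=
  (TensorProduct.rid ℂ (Ext W)).toLinearMap ∘ₗ LinearMap.lTensor (Ext W) f

theorem sum_coeffOf {κ : Type*} [Fintype κ] (b : Module.Basis κ ℂ (P × N))
    (t : Ext W ⊗[ℂ] (P × N)) :
    ∑ k, extWedge (coeffOf (b.coord k) t) (1 ⊗ₜ[ℂ] b k) = t := by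
  induction t with
  | zero => simp
  | add x y hx hy =>
    simp only [map_add, LinearMap.add_apply, Finset.sum_add_distrib, hx, hy]
  | tmul a v =>
    have h : ∀ k, extWedge (coeffOf (b.coord k) (a ⊗ₜ[ℂ] v)) ((1 : Ext W) ⊗ₜ[ℂ] b k) =
        a ⊗ₜ[ℂ] (b.repr v k • b k) := fun k => by
      simp [coeffOf, extWedge_tmul]
    simp only [h, ← TensorProduct.tmul_sum, b.sum_repr]

theorem map_totalSignEnd (u : W →ₗ[ℝ] W') (c : P →ₗ[ℂ] P') (c' : P' →ₗ[ℂ] P)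
    (e : N →ₗ[ℂ] N') (e' : N' →ₗ[ℂ] N) (γ : Ext W' ⊗[ℂ] Module.End ℂ (P × N)) :
    TensorProduct.map (extPullback u).toLinearMap (conjMap (c.prodMap e) (c'.prodMap e'))
      (totalSignEnd γ) = totalSignEnd (TensorProduct.map (extPullback u).toLinearMap
        (conjMap (c.prodMap e) (c'.prodMap e')) γ) := by
  induction γ with
  | zero => simp
  | add x y hx hy => simp only [map_add, hx, hy]
  | tmul a L =>
    rw [TensorProduct.map_tmul]
    simp only [totalSignEnd, TensorProduct.map_tmul, endParity_eq]
    congr 1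
    · exact extPullback_sign u a
    · ext <;> simp [conjMap, superSign]

theorem totalSign_extAct_of_parity {s r : ℤˣ} {γ : Ext W ⊗[ℂ] Module.End ℂ (P × N)}
    (hγ : totalSignEnd γ = (s : ℤ) • γ) {t : Ext W ⊗[ℂ] (P × N)}
    (ht : totalSign t = (r : ℤ) • t) :
    totalSign (extAct γ t) = ((s * r : ℤˣ) : ℤ) • extAct γ t := by
  rw [totalSign_extAct, hγ, ht, map_zsmul, map_zsmul, LinearMap.smul_apply, smul_smul,
    mul_comm, Units.val_mul]

theorem map_smul_add {X Y : Type*} [AddCommGroup X] [Module ℂ X] [AddCommGroup Y] [Module ℂ Y]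
    (L : X →ₗ[ℂ] Y) (c : ℂ) (u v : X) : L (c • u + v) = c • L u + L v := by
  rw [map_add, map_smul]

theorem eq_zero_smul_add {X : Type*} [AddCommGroup X] [Module ℂ X] {t d w : X} (h : t = w) :
    t = (0 : ℂ) • d + w := by
  rw [zero_smul, zero_add, h]

theorem eq_zero_of_leibniz {κ : ℂ} {s : ℤˣ} {c d : Ext W} {t t₀ t₁ : Ext W ⊗[ℂ] (P × N)}
    (h : t = κ • extWedge d t₀ + extWedge (extSgn s c) t₁) (ht : t = 0) (ht₀ : t₀ = 0)
    (hc : c = 1) : t₁ = 0 := by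
  subst hc ht₀
  simpa [ht] using h.symm

theorem sum_leibniz {κ : Type*} [Fintype κ] (b : Module.Basis κ ℂ (P × N)) {c : ℂ} {s : ℤˣ}
    {a : Ext W ⊗[ℂ] Module.End ℂ (P × N)} (ha : totalSignEnd a = (s : ℤ) • a)
    {ι : Type*} [Fintype ι] (e : ι → Ext W) (D : ι → Ext W ⊗[ℂ] (P × N))
    (t : Ext W ⊗[ℂ] (P × N)) :
    ∑ k, (c • extWedge (∑ i, e i * coeffOf (b.coord k) (D i)) ((1 : Ext W) ⊗ₜ[ℂ] b k) +
      extWedge (extSgn s (coeffOf (b.coord k) t)) (extAct a (1 ⊗ₜ[ℂ] b k))) =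
    c • ∑ i, extWedge (e i) (D i) + extAct a t := by
  conv_rhs => rw [← sum_coeffOf b t]
  simp only [← extAct_extWedge ha, Finset.sum_add_distrib, ← Finset.smul_sum, map_sum,
    LinearMap.sum_apply, extWedge_mul]
  rw [Finset.sum_comm]
  congr 2
  refine Finset.sum_congr rfl fun i _ => ?_
  rw [← map_sum, sum_coeffOf]

/-- Multiplication of an element of `Λ(W*) ⊗ End(V)` by a form from the left. -/
def endWedge (c : Ext W) :
    (Ext W ⊗[ℂ] Module.End ℂ (P × N)) →ₗ[ℂ] (Ext W ⊗[ℂ] Module.End ℂ (P × N)) :=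
  LinearMap.rTensor _ (LinearMap.mulLeft ℂ c)

theorem extAct_endWedge (c : Ext W) (γ : Ext W ⊗[ℂ] Module.End ℂ (P × N))
    (t : Ext W ⊗[ℂ] (P × N)) : extAct (endWedge c γ) t = extWedge c (extAct γ t) := by
  induction γ with
  | zero => simp
  | add x y hx hy => simp only [map_add, LinearMap.add_apply, hx, hy]
  | tmul a L =>
    induction t with
    | zero => simp
    | add x y hx hy => simp only [map_add, hx, hy]
    | tmul b v => simp [endWedge, extAct_tmul, extWedge_tmul, mul_assoc]

theorem extStr_endWedge (c : Ext W) (γ : Ext W ⊗[ℂ] Module.End ℂ (P × N)) :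
    extStr (endWedge c γ) = c * extStr γ := by
  induction γ with
  | zero => simp
  | add x y hx hy => simp only [map_add, mul_add, hx, hy]
  | tmul a L => simp [endWedge, extStr_tmul]

theorem totalSign_one_tmul_superBasis [Module.Finite ℂ P] [Module.Finite ℂ N] (k) :
    totalSign ((1 : Ext W) ⊗ₜ[ℂ] superBasis P N k) =
      (superBasisSgn P N k : ℤ) • ((1 : Ext W) ⊗ₜ[ℂ] superBasis P N k) := by
  simp [totalSign, superSign_superBasis]

end FibreCoefficients

section FibreSupercommutator

variable {W P N : Type*} [AddCommGroup W] [Module ℝ W] [AddCommGroup P] [Module ℂ P]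
  [AddCommGroup N] [Module ℂ N]

theorem koszul_neg_one (s : ℤˣ) : koszul (-1) s = s := by
  rcases Int.units_eq_one_or s with rfl | rfl <;> simp [koszul]

theorem extAct_superconnection {ι : Type*} [Fintype ι] {s : ℤˣ}
    {a g ξ : Ext W ⊗[ℂ] Module.End ℂ (P × N)} (e : ι → Ext W)
    (D : ι → Ext W ⊗[ℂ] Module.End ℂ (P × N))
    (hξ : ∀ t, extAct ξ t = extAct a (extAct g t) - (koszul (-1) s : ℤ) • extAct g (extAct a t))
    {t u v : Ext W ⊗[ℂ] (P × N)}
    (hu : u = (1 : ℂ) • ∑ i, extWedge (e i) (extAct (D i) t) + extAct a (extAct g t))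
    (hv : v = (1 : ℂ) • ∑ i, extWedge (e i) 0 + extAct a t) :
    u - (s : ℤ) • extAct g v = extAct (∑ i, endWedge (e i) (D i) + ξ) t := by
  subst hu hv
  simp only [map_zero, Finset.sum_const_zero, smul_zero, zero_add, one_smul, map_add, map_sum,
    LinearMap.add_apply, LinearMap.sum_apply, extAct_endWedge, hξ, koszul_neg_one]
  abel

end FibreSupercommutator

/-! ### Operators satisfying a Leibniz rule -/

section Operators

variable {n : ℕ} {M : Type*} [TopologicalSpace M] [T2Space M]
  [ChartedSpace (EuclideanSpace ℝ (Fin n)) M] [IsManifold (𝓡 n) ∞ M]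
  {Fp : Type*} [NormedAddCommGroup Fp] [NormedSpace ℂ Fp] [FiniteDimensional ℂ Fp]
  {Ep : M → Type*} [∀ x, AddCommGroup (Ep x)] [∀ x, Module ℂ (Ep x)]
  [∀ x, TopologicalSpace (Ep x)] [TopologicalSpace (TotalSpace Fp Ep)]
  [FiberBundle Fp Ep] [VectorBundle ℂ Fp Ep]
  {Fm : Type*} [NormedAddCommGroup Fm] [NormedSpace ℂ Fm] [FiniteDimensional ℂ Fm]
  {Em : M → Type*} [∀ x, AddCommGroup (Em x)] [∀ x, Module ℂ (Em x)]
  [∀ x, TopologicalSpace (Em x)] [TopologicalSpace (TotalSpace Fm Em)]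
  [FiberBundle Fm Em] [VectorBundle ℂ Fm Em]

variable (Fp Ep Fm Em) in
/-- The value of an `E`-valued form at a point. -/
def evalE (x : M) : EForm (n := n) Fp Ep Fm Em →ₗ[ℂ]
    (Ext (TangentSpace (𝓡 n) x) ⊗[ℂ] (Ep x × Em x)) where
  toFun θ := θ.1 x
  map_add' _ _ := rfl
  map_smul' _ _ := rfl

/-- An operator on `Ω(M, E)` of parity `s` with `T(α ∧ θ) = κ dα ∧ θ + s^{|α|} α ∧ Tθ`. For `κ = 0`
these are the operators of parity `s` commuting with the forms in the graded sense, and for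
`κ = 1`, `s = -1` the superconnections. -/
structure IsLeibniz (κ : ℂ) (s : ℤˣ) (T : Module.End ℂ (EForm (n := n) Fp Ep Fm Em)) : Prop where
  parity : ∀ (r : ℤˣ) (θ : EForm (n := n) Fp Ep Fm Em), HasParity r θ → HasParity (s * r) (T θ)
  leibniz : ∀ (α : Form n M) (θ : EForm (n := n) Fp Ep Fm Em) (x : M),
    (T (wedge α θ)).1 x =
      κ • extWedge (extDeriv n M α x) (θ.1 x) + extWedge (extSgn s (α.1 x)) ((T θ).1 x)

theorem IsSuperconnection.isLeibniz {A : Module.End ℂ (EForm (n := n) Fp Ep Fm Em)}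
    (hA : IsSuperconnection A) : IsLeibniz 1 (-1) A where
  parity r θ h := by simpa using hA.odd r θ h
  leibniz α θ x := by simpa using hA.leibniz α θ x

theorem act_parity {s r : ℤˣ} {γ : EndForm (n := n) Fp Ep Fm Em} (h : EndHasParity s γ)
    {θ : EForm (n := n) Fp Ep Fm Em} (hθ : HasParity r θ) : HasParity (s * r) (act γ θ) :=
  fun x => totalSign_extAct_of_parity (h x) (hθ x)

theorem act_wedge {s : ℤˣ} {γ : EndForm (n := n) Fp Ep Fm Em} (h : EndHasParity s γ) {x : M}
    (a : Ext (TangentSpace (𝓡 n) x)) (t : Ext (TangentSpace (𝓡 n) x) ⊗[ℂ] (Ep x × Em x)) :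
    extAct (γ.1 x) (extWedge a t) = extWedge (extSgn s a) (extAct (γ.1 x) t) :=
  extAct_extWedge (h x) _ _

theorem isLeibniz_act {s : ℤˣ} {γ : EndForm (n := n) Fp Ep Fm Em} (h : EndHasParity s γ) :
    IsLeibniz 0 s (act γ) where
  parity _ _ hθ := act_parity h hθ
  leibniz α θ x := eq_zero_smul_add (act_wedge h (α.1 x) (θ.1 x))

/-- Operators satisfying a Leibniz rule are local. -/
theorem IsLeibniz.congr {κ : ℂ} {s : ℤˣ} {T : Module.End ℂ (EForm (n := n) Fp Ep Fm Em)}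
    (hT : IsLeibniz κ s T) {θ η : EForm (n := n) Fp Ep Fm Em} {p : M}
    (h : ∀ᶠ x in nhds p, θ.1 x = η.1 x) : (T θ).1 p = (T η).1 p := by
  obtain ⟨χ, h1, h2, h3⟩ := exists_bump (n := n) h
  have hsub : ∀ x, (θ - η).1 x = θ.1 x - η.1 x := fun x => map_sub (evalE Fp Ep Fm Em x) θ η
  -- a cut-off of `θ - η` supported where this form vanishes
  have h0 : wedge (funForm χ h1) (θ - η) = 0 := EForm.ext fun x => by
    refine (extWedge_algebraMap (χ x) ((θ - η).1 x)).trans ?_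
    rw [hsub]
    by_cases hx : θ.1 x = η.1 x
    · rw [hx, sub_self, smul_zero]; rfl
    · rw [(h3 x hx).self_of_nhds, zero_smul]; rfl
  have h4 := eq_zero_of_leibniz (hT.leibniz (funForm χ h1) (θ - η) p)
    (by rw [h0, map_zero]; rfl) (by rw [hsub, h.self_of_nhds, sub_self])
    ((congrArg (algebraMap ℂ _) h2.self_of_nhds).trans (map_one _))
  rw [map_sub] at h4
  exact sub_eq_zero.1 h4

theorem IsLeibniz.coord_leibniz {κ : ℂ} {s : ℤˣ} {T : Module.End ℂ (EForm (n := n) Fp Ep Fm Em)}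
    (hT : IsLeibniz κ s T) {α : Form n M} {θ : EForm (n := n) Fp Ep Fm Em} {p x : M}
    {c d : Ext (EuclideanSpace ℝ (Fin n))} {t u : Ext (EuclideanSpace ℝ (Fin n)) ⊗[ℂ] (Fp × Fm)}
    (hc : formCoord p x (α.1 x) = c) (hd : formCoord p x (extDeriv n M α x) = d)
    (ht : eCoord Fp Ep Fm Em p x (θ.1 x) = t) (hu : eCoord Fp Ep Fm Em p x ((T θ).1 x) = u) :
    eCoord Fp Ep Fm Em p x ((T (wedge α θ)).1 x) = κ • extWedge d t + extWedge (extSgn s c) u := by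
  subst hc hd ht hu
  have h1 := eCoord_wedge (Fp := Fp) (Fm := Fm) p x (extDeriv n M α x) (θ.1 x)
  have h2 := eCoord_wedge (Fp := Fp) (Fm := Fm) p x (extSgn s (α.1 x)) ((T θ).1 x)
  refine (congrArg (eCoord Fp Ep Fm Em p x) (hT.leibniz α θ x)).trans
    ((map_smul_add _ κ _ _).trans ?_)
  exact congrArg₂ (fun v w => κ • v + w) h1
    (h2.trans (congrArg (fun c => extWedge c (eCoord Fp Ep Fm Em p x ((T θ).1 x)))
      (formCoord_sgn s p x (α.1 x))))

variable [VectorBundle ℝ Fp Ep] [ContMDiffVectorBundle ∞ Fp Ep (𝓡 n)]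
  [VectorBundle ℝ Fm Em] [ContMDiffVectorBundle ∞ Fm Em (𝓡 n)]

theorem formCoord_extDeriv_of_eventually {α : Form n M} {p : M}
    {g : M → Ext (EuclideanSpace ℝ (Fin n))} {D : Fin n → Ext (EuclideanSpace ℝ (Fin n))}
    (h : ∀ᶠ x in nhds p, formCoord p x (α.1 x) = g x) (hg : HasPartials g D p) :
    formCoord p p (extDeriv n M α p) = ∑ i, dx i * D i :=
  formCoord_extDeriv (hg.congr h)

/-- Global sections which are the constant vector `w` in the coordinates at `p`, near `p`. -/
theorem exists_const_section (p : M) (w : Ext (EuclideanSpace ℝ (Fin n)) ⊗[ℂ] (Fp × Fm)) :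
    ∃ E : EForm (n := n) Fp Ep Fm Em,
      (∀ᶠ x in nhds p, eCoord Fp Ep Fm Em p x (E.1 x) = w) ∧
      ∀ s : ℤˣ, totalSign w = (s : ℤ) • w → HasParity s E := by
  obtain ⟨E, hE, hp⟩ := exists_eForm (n := n) (Ep := Ep) (Em := Em) p w
  refine ⟨E, ?_, hp⟩
  filter_upwards [hE, coordSet_mem (n := n) (Fp := Fp) (Ep := Ep) (Fm := Fm) (Em := Em) p]
    with x hx hxs
  exact (congrArg _ hx).trans (eCoord_frame hxs w)

/-- The coefficients of an `E`-valued form with respect to a covector, as a global form. -/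
theorem exists_coeff (p : M) (θ : EForm (n := n) Fp Ep Fm Em) (f : (Fp × Fm) →ₗ[ℂ] ℂ) :
    ∃ α : Form n M, ∀ᶠ x in nhds p,
      formCoord p x (α.1 x) = coeffOf f (eCoord Fp Ep Fm Em p x (θ.1 x)) := by
  have hmem : coordSet n Fp Ep Fm Em p ∈ nhds p := coordSet_mem p
  obtain ⟨α, hα⟩ := exists_form (n := n) p hmem Set.inter_subset_left
    (fun x => coeffOf f (eCoord Fp Ep Fm Em p x (θ.1 x)))
    (fun q hq => (eForm_smooth_at θ hq).linear _)
  refine ⟨α, ?_⟩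
  filter_upwards [hα, hmem] with x hx hxs
  rw [hx, formCoord_frame hxs.1]

theorem eventually_eq_sum_wedge {κ : Type*} [Fintype κ] (b : Module.Basis κ ℂ (Fp × Fm)) {p : M}
    {θ : EForm (n := n) Fp Ep Fm Em} {α : κ → Form n M} {E : κ → EForm (n := n) Fp Ep Fm Em}
    (hα : ∀ k, ∀ᶠ x in nhds p,
      formCoord p x ((α k).1 x) = coeffOf (b.coord k) (eCoord Fp Ep Fm Em p x (θ.1 x)))
    (hE : ∀ k, ∀ᶠ x in nhds p, eCoord Fp Ep Fm Em p x ((E k).1 x) = 1 ⊗ₜ[ℂ] b k) :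
    ∀ᶠ x in nhds p, θ.1 x = (∑ k, wedge (α k) (E k) : EForm (n := n) Fp Ep Fm Em).1 x := by
  filter_upwards [Filter.eventually_all.2 hE, Filter.eventually_all.2 hα,
    coordSet_mem (n := n) (Fp := Fp) (Ep := Ep) (Fm := Fm) (Em := Em) p] with x hx hy hxs
  refine eCoord_injective hxs ?_
  refine (sum_coeffOf b (eCoord Fp Ep Fm Em p x (θ.1 x))).symm.trans (Eq.trans ?_
    (map_sum (eCoord Fp Ep Fm Em p x ∘ₗ evalE Fp Ep Fm Em x) _ _).symm)
  refine Finset.sum_congr rfl fun k _ => ?_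
  rw [← hx k, ← hy k]
  exact (eCoord_wedge p x ((α k).1 x) ((E k).1 x)).symm

/-- The normal form of an operator satisfying a Leibniz rule: in the coordinates at `p` it is
`κ d` plus the action of an element of `Λ ⊗ End`. -/
theorem IsLeibniz.exists_local {κ : ℂ} {s : ℤˣ} {T : Module.End ℂ (EForm (n := n) Fp Ep Fm Em)}
    (hT : IsLeibniz κ s T) (p : M) :
    ∃ a : Ext (EuclideanSpace ℝ (Fin n)) ⊗[ℂ] Module.End ℂ (Fp × Fm),
      totalSignEnd a = (s : ℤ) • a ∧ ∀ (θ : EForm (n := n) Fp Ep Fm Em)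
        (D : Fin n → Ext (EuclideanSpace ℝ (Fin n)) ⊗[ℂ] (Fp × Fm)),
        HasPartials (fun x => eCoord Fp Ep Fm Em p x (θ.1 x)) D p →
        eCoord Fp Ep Fm Em p p ((T θ).1 p) =
          κ • ∑ i, extWedge (dx i) (D i) + extAct a (eCoord Fp Ep Fm Em p p (θ.1 p)) := by
  let b := superBasis Fp Fm
  choose E hE hEpar using fun k => exists_const_section (n := n) (Ep := Ep) (Em := Em) p
    ((1 : Ext (EuclideanSpace ℝ (Fin n))) ⊗ₜ[ℂ] b k)
  let a : Ext (EuclideanSpace ℝ (Fin n)) ⊗[ℂ] Module.End ℂ (Fp × Fm) :=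
    ∑ k, rankOne (b.coord k) (eCoord Fp Ep Fm Em p p ((T (E k)).1 p))
  have ha : ∀ k, extAct a (1 ⊗ₜ[ℂ] b k) = eCoord Fp Ep Fm Em p p ((T (E k)).1 p) := fun k =>
    extAct_sum_rankOne b _ k
  have hap : totalSignEnd a = (s : ℤ) • a := totalSignEnd_of_basis fun k => by
    have h1 := hT.parity _ _ (hEpar k _ (totalSign_one_tmul_superBasis k)) p
    have h2 := congrArg (eCoord Fp Ep Fm Em p p) h1
    rw [ha]
    exact (eCoord_totalSign p p _).symm.trans (h2.trans (map_zsmul _ _ _))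
  refine ⟨a, hap, fun θ D hD => ?_⟩
  -- the coefficients of `θ` with respect to the frame `E k`
  choose α hα using fun k => exists_coeff (n := n) p θ (b.coord k)
  have hterm : ∀ k, eCoord Fp Ep Fm Em p p ((T (wedge (α k) (E k))).1 p) =
      κ • extWedge (∑ i, dx i * coeffOf (b.coord k) (D i)) (1 ⊗ₜ[ℂ] b k) +
      extWedge (extSgn s (coeffOf (b.coord k) (eCoord Fp Ep Fm Em p p (θ.1 p))))
        (extAct a (1 ⊗ₜ[ℂ] b k)) := fun k =>
    hT.coord_leibniz (hα k).self_of_nhds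
      (formCoord_extDeriv_of_eventually (hα k) (hD.linear (coeffOf (b.coord k))))
      (hE k).self_of_nhds (ha k).symm
  refine (congrArg (eCoord Fp Ep Fm Em p p) (hT.congr (eventually_eq_sum_wedge b hα hE))).trans
    (Eq.trans ?_ (sum_leibniz b hap dx D (eCoord Fp Ep Fm Em p p (θ.1 p))))
  exact (map_sum (eCoord Fp Ep Fm Em p p ∘ₗ evalE Fp Ep Fm Em p ∘ₗ T) _ _).trans
    (Finset.sum_congr rfl fun k _ => hterm k)

/-! ### `End(E)`-valued forms as operators and their supertraces -/

variable (Fp Ep Fm Em) in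
/-- The element of `Λ T_x^*M ⊗ End(E_x)` with a given coordinate expression. -/
def endFrame (p x : M) : (Ext (EuclideanSpace ℝ (Fin n)) ⊗[ℂ] Module.End ℂ (Fp × Fm)) →ₗ[ℂ]
    (Ext (TangentSpace (𝓡 n) x) ⊗[ℂ] Module.End ℂ (Ep x × Em x)) :=
  TensorProduct.map (extPullback (tangentCoframe n M p x)).toLinearMap
    (conjMap ((fibreFrame Fp Ep p x).prodMap (fibreFrame Fm Em p x))
      ((fibreCoord Fp Ep p x).prodMap (fibreCoord Fm Em p x)))

theorem eFrame_act {p x : M} (hx : x ∈ coordSet n Fp Ep Fm Em p)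
    (a : Ext (EuclideanSpace ℝ (Fin n)) ⊗[ℂ] Module.End ℂ (Fp × Fm))
    (w : Ext (EuclideanSpace ℝ (Fin n)) ⊗[ℂ] (Fp × Fm)) :
    eFrame Fp Ep Fm Em p x (extAct a w) =
      extAct (endFrame Fp Ep Fm Em p x a) (eFrame Fp Ep Fm Em p x w) :=
  map_extAct _ _ _ (fibreCoord_frame hx.2.1) _ _ (fibreCoord_frame hx.2.2) _ _

theorem extAct_endFrame {p x : M} (hx : x ∈ coordSet n Fp Ep Fm Em p)
    {a : Ext (EuclideanSpace ℝ (Fin n)) ⊗[ℂ] Module.End ℂ (Fp × Fm)}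
    {t u : Ext (TangentSpace (𝓡 n) x) ⊗[ℂ] (Ep x × Em x)}
    (h : eCoord Fp Ep Fm Em p x u = extAct a (eCoord Fp Ep Fm Em p x t)) :
    u = extAct (endFrame Fp Ep Fm Em p x a) t :=
  (eFrame_coord hx u).symm.trans (((congrArg (eFrame Fp Ep Fm Em p x) h).trans
    (eFrame_act hx a _)).trans
      (congrArg (extAct (endFrame Fp Ep Fm Em p x a)) (eFrame_coord hx t)))

theorem totalSignEnd_endFrame {p x : M} {s : ℤˣ}
    {a : Ext (EuclideanSpace ℝ (Fin n)) ⊗[ℂ] Module.End ℂ (Fp × Fm)}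
    (ha : totalSignEnd a = (s : ℤ) • a) :
    totalSignEnd (endFrame Fp Ep Fm Em p x a) = (s : ℤ) • endFrame Fp Ep Fm Em p x a :=
  (map_totalSignEnd _ _ _ _ _ a).symm.trans
    ((congrArg (endFrame Fp Ep Fm Em p x) ha).trans (map_zsmul _ _ _))

theorem totalSignEnd_endCoord {p x : M} {s : ℤˣ}
    {a : Ext (TangentSpace (𝓡 n) x) ⊗[ℂ] Module.End ℂ (Ep x × Em x)}
    (ha : totalSignEnd a = (s : ℤ) • a) :
    totalSignEnd (endCoord Fp Ep Fm Em p x a) = (s : ℤ) • endCoord Fp Ep Fm Em p x a :=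
  (map_totalSignEnd _ _ _ _ _ a).symm.trans
    ((congrArg (endCoord Fp Ep Fm Em p x) ha).trans (map_zsmul _ _ _))

theorem endCoord_eq_sum {p x : M} (hx : x ∈ coordSet n Fp Ep Fm Em p)
    {κ : Type*} [Fintype κ] (b : Module.Basis κ ℂ (Fp × Fm))
    (γ : Ext (TangentSpace (𝓡 n) x) ⊗[ℂ] Module.End ℂ (Ep x × Em x))
    (t : κ → Ext (TangentSpace (𝓡 n) x) ⊗[ℂ] (Ep x × Em x))
    (ht : ∀ k, eCoord Fp Ep Fm Em p x (t k) = 1 ⊗ₜ[ℂ] b k) :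
    endCoord Fp Ep Fm Em p x γ =
      ∑ k, rankOne (b.coord k) (eCoord Fp Ep Fm Em p x (extAct γ (t k))) :=
  (sum_rankOne_extAct b (endCoord Fp Ep Fm Em p x γ)).symm.trans
    (Finset.sum_congr rfl fun k _ => congrArg (rankOne (b.coord k))
      ((congrArg _ (ht k).symm).trans (eCoord_act hx γ (t k)).symm))

/-- A pointwise family of elements of `Λ T_x^*M ⊗ End(E_x)` is smooth if it maps smooth
`E`-valued forms to smooth `E`-valued forms. -/
theorem endForm_smooth_of_act (T : EForm (n := n) Fp Ep Fm Em → EForm (n := n) Fp Ep Fm Em)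
    (g : ∀ x, Ext (TangentSpace (𝓡 n) x) ⊗[ℂ] Module.End ℂ (Ep x × Em x))
    (hg : ∀ θ x, (T θ).1 x = extAct (g x) (θ.1 x)) (p : M) :
    SmoothCoordAt (n := n) (fun x => endCoord Fp Ep Fm Em p x (g x)) p := by
  let b := superBasis Fp Fm
  choose E hE _hE using fun k => exists_const_section (n := n) (Ep := Ep) (Em := Em) p
    ((1 : Ext (EuclideanSpace ℝ (Fin n))) ⊗ₜ[ℂ] b k)
  refine (SmoothCoordAt.sum Finset.univ fun k _ =>
    ((T (E k)).2 p).linear (rankOne (b.coord k))).congr ?_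
  filter_upwards [Filter.eventually_all.2 hE,
    coordSet_mem (n := n) (Fp := Fp) (Ep := Ep) (Fm := Fm) (Em := Em) p] with x hx hxs
  exact (endCoord_eq_sum hxs b (g x) (fun k => (E k).1 x) hx).trans
    (Finset.sum_congr rfl fun k _ => congrArg
      (fun t => rankOne (b.coord k) (eCoord Fp Ep Fm Em p x t)) (hg (E k) x).symm)

/-- Operators commuting with the forms in the graded sense are given by `End(E)`-valued forms. -/
theorem IsLeibniz.exists_act {s : ℤˣ} {T : Module.End ℂ (EForm (n := n) Fp Ep Fm Em)}
    (hT : IsLeibniz 0 s T) : ∃ γ : EndForm (n := n) Fp Ep Fm Em, EndHasParity s γ ∧ T = act γ := by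
  choose a ha haT using fun p => hT.exists_local p
  have hg : ∀ θ x, (T θ).1 x = extAct (endFrame Fp Ep Fm Em x x (a x)) (θ.1 x) := fun θ x => by
    obtain ⟨D, hD⟩ := (θ.2 x).exists_hasPartials
    exact extAct_endFrame (mem_of_mem_nhds (coordSet_mem x))
      ((haT x θ D hD).trans (eq_zero_smul_add rfl).symm)
  exact ⟨⟨fun x => endFrame Fp Ep Fm Em x x (a x), endForm_smooth_of_act T _ hg⟩,
    fun x => totalSignEnd_endFrame (ha x), LinearMap.ext fun θ => EForm.ext fun x => hg θ x⟩

variable (Fp Ep Fm Em) in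
theorem fibre_finite (p x : M) (hx : x ∈ coordSet n Fp Ep Fm Em p) :
    Module.Finite ℂ (Ep x) ∧ Module.Finite ℂ (Em x) :=
  ⟨Module.Finite.equiv ((trivializationAt Fp Ep p).linearEquivAt ℂ x hx.2.1).symm,
    Module.Finite.equiv ((trivializationAt Fm Em p).linearEquivAt ℂ x hx.2.2).symm⟩

/-- The action of `Ω(M, End E)` on `Ω(M, E)` is faithful, pointwise. -/
theorem endForm_eq_of_act {γ γ' : EndForm (n := n) Fp Ep Fm Em}
    (h : ∀ (θ : EForm (n := n) Fp Ep Fm Em) x, extAct (γ.1 x) (θ.1 x) = extAct (γ'.1 x) (θ.1 x)) :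
    γ = γ' := EndForm.ext fun x => by
  obtain ⟨_f1, _f2⟩ := fibre_finite Fp Ep Fm Em x x (mem_of_mem_nhds (coordSet_mem (n := n) x))
  refine extAct_injective fun t => ?_
  obtain ⟨θ, rfl⟩ := exists_eForm_eq (n := n) (Fp := Fp) (Ep := Ep) (Fm := Fm) (Em := Em) x t
  exact h θ x

/-- The supertrace vanishes on supercommutators of `End(E)`-valued forms. -/
theorem supertrace_supercommutator {s s' : ℤˣ} {γ γ' ζ : EndForm (n := n) Fp Ep Fm Em}
    (hγ : EndHasParity s γ) (hγ' : EndHasParity s' γ')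
    (h : act ζ = act γ * act γ' - (koszul s s' : ℤ) • (act γ' * act γ)) : supertrace ζ = 0 :=
  Form.ext fun x => by
  obtain ⟨_f1, _f2⟩ := fibre_finite Fp Ep Fm Em x x (mem_of_mem_nhds (coordSet_mem (n := n) x))
  obtain ⟨ξ, h1, h2⟩ := exists_supercommutator (hγ x) (hγ' x)
  have : ζ.1 x = ξ := extAct_injective fun t => by
    obtain ⟨θ, rfl⟩ := exists_eForm_eq (n := n) (Fp := Fp) (Ep := Ep) (Fm := Fm) (Em := Em) x t
    refine Eq.trans ?_ (h2 (θ.1 x)).symm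
    refine (congrArg (fun T => evalE (n := n) Fp Ep Fm Em x (T θ)) h).trans ?_
    exact ((evalE (n := n) Fp Ep Fm Em x).map_sub _ _).trans
      (congrArg _ (map_zsmul (evalE (n := n) Fp Ep Fm Em x) _ _))
  exact (congrArg extStr this).trans h1

theorem eCoord_act_of_eq {p x : M} (hx : x ∈ coordSet n Fp Ep Fm Em p)
    (γ : EndForm (n := n) Fp Ep Fm Em) {θ : EForm (n := n) Fp Ep Fm Em}
    {w : Ext (EuclideanSpace ℝ (Fin n)) ⊗[ℂ] (Fp × Fm)}
    (h : eCoord Fp Ep Fm Em p x (θ.1 x) = w) :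
    eCoord Fp Ep Fm Em p x ((act γ θ).1 x) = extAct (endCoord Fp Ep Fm Em p x (γ.1 x)) w :=
  (eCoord_act hx (γ.1 x) (θ.1 x)).trans (congrArg _ h)

theorem hasPartials_act {p : M} {γ : EndForm (n := n) Fp Ep Fm Em}
    {D : Fin n → Ext (EuclideanSpace ℝ (Fin n)) ⊗[ℂ] Module.End ℂ (Fp × Fm)}
    (hD : HasPartials (fun x => endCoord Fp Ep Fm Em p x (γ.1 x)) D p)
    {θ : EForm (n := n) Fp Ep Fm Em} {w : Ext (EuclideanSpace ℝ (Fin n)) ⊗[ℂ] (Fp × Fm)}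
    (h : ∀ᶠ x in nhds p, eCoord Fp Ep Fm Em p x (θ.1 x) = w) :
    HasPartials (fun x => eCoord Fp Ep Fm Em p x ((act γ θ).1 x)) (fun i => extAct (D i) w) p := by
  refine (hD.linear ((extAct (P := Fp) (N := Fm)).flip w)).congr ?_
  filter_upwards [h, coordSet_mem (n := n) (Fp := Fp) (Ep := Ep) (Fm := Fm) (Em := Em) p]
    with x hx hxs
  exact eCoord_act_of_eq hxs γ hx

theorem formCoord_supertrace {p x : M} (hx : x ∈ coordSet n Fp Ep Fm Em p)
    (γ : EndForm (n := n) Fp Ep Fm Em) :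
    formCoord p x ((supertrace γ).1 x) = extStr (endCoord Fp Ep Fm Em p x (γ.1 x)) := by
  obtain ⟨_f1, _f2⟩ := fibre_finite Fp Ep Fm Em p x hx
  exact extStr_map _ _ _ (fibreFrame_comp_coord Fp Ep p x hx.2.1) _ _
    (fibreFrame_comp_coord Fm Em p x hx.2.2) _

/-- In local coordinates the supercommutator of `γ` with a superconnection is
`∑ dxⁱ ∧ ∂γ/∂xⁱ` up to a pointwise supercommutator `ξ`. -/
theorem endCoord_superconnection {s : ℤˣ} {A : Module.End ℂ (EForm (n := n) Fp Ep Fm Em)}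
    (hA : IsLeibniz 1 (-1) A) {γ ζ : EndForm (n := n) Fp Ep Fm Em} (hγ : EndHasParity s γ)
    (h : act ζ = A * act γ - (s : ℤ) • (act γ * A)) {p : M}
    {D : Fin n → Ext (EuclideanSpace ℝ (Fin n)) ⊗[ℂ] Module.End ℂ (Fp × Fm)}
    (hD : HasPartials (fun x => endCoord Fp Ep Fm Em p x (γ.1 x)) D p) :
    ∃ ξ, extStr ξ = 0 ∧
      endCoord Fp Ep Fm Em p p (ζ.1 p) = ∑ i, endWedge (dx i) (D i) + ξ := by
  obtain ⟨a, ha, hloc⟩ := hA.exists_local p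
  have hps : p ∈ coordSet n Fp Ep Fm Em p := mem_of_mem_nhds (coordSet_mem p)
  obtain ⟨ξ, hξ0, hξ⟩ := exists_supercommutator ha (totalSignEnd_endCoord (p := p) (hγ p))
  refine ⟨ξ, hξ0, extAct_ext_basis (superBasis Fp Fm) fun k => ?_⟩
  obtain ⟨E, hE, -⟩ := exists_const_section (n := n) (Ep := Ep) (Em := Em) p
    ((1 : Ext (EuclideanSpace ℝ (Fin n))) ⊗ₜ[ℂ] superBasis Fp Fm k)
  have e1 := hloc E 0 ((HasPartials.const _).congr hE)
  have e2 := hloc (act γ E) _ (hasPartials_act hD hE)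
  have e3 := eCoord_act_of_eq hps γ hE.self_of_nhds
  have e4 := eCoord_act_of_eq hps γ (θ := A E) rfl
  have e5 := eCoord_act_of_eq hps ζ hE.self_of_nhds
  rw [hE.self_of_nhds] at e1
  rw [e3] at e2
  have e6 := congrArg (fun T => (eCoord Fp Ep Fm Em p p ∘ₗ evalE Fp Ep Fm Em p) (T E)) h
  have e7 := e6.trans ((map_sub (eCoord Fp Ep Fm Em p p ∘ₗ evalE Fp Ep Fm Em p) _ _).trans
    (congrArg _ (map_zsmul (eCoord Fp Ep Fm Em p p ∘ₗ evalE Fp Ep Fm Em p) _ _)))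
  refine e5.symm.trans (e7.trans ?_)
  refine (congrArg (fun u => eCoord Fp Ep Fm Em p p ((A (act γ E)).1 p) - (s : ℤ) • u) e4).trans ?_
  exact extAct_superconnection dx D hξ e2 e1

/-- The supertrace of the supercommutator of a superconnection with an `End(E)`-valued form `γ` is
the exterior derivative of the supertrace of `γ`: in local coordinates the superconnection is
`d` plus the action of an odd element of `Λ ⊗ End`, which does not contribute. -/
theorem supertrace_superconnection {s : ℤˣ} {A : Module.End ℂ (EForm (n := n) Fp Ep Fm Em)}
    (hA : IsLeibniz 1 (-1) A) {γ ζ : EndForm (n := n) Fp Ep Fm Em} (hγ : EndHasParity s γ)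
    (h : act ζ = A * act γ - (s : ℤ) • (act γ * A)) :
    (supertrace ζ).1 = extDeriv n M (supertrace γ) := by
  funext p
  have hmem : coordSet n Fp Ep Fm Em p ∈ nhds p := coordSet_mem p
  have hps := mem_of_mem_nhds hmem
  obtain ⟨D, hD⟩ := (γ.2 p).exists_hasPartials
  obtain ⟨ξ, hξ0, hξ⟩ := endCoord_superconnection hA hγ h hD
  refine formCoord_injective hps.1 ?_
  refine (formCoord_supertrace hps ζ).trans ((congrArg extStr hξ).trans ?_)
  refine Eq.trans ?_ (formCoord_extDeriv_of_eventually (g := fun x =>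
    extStr (endCoord Fp Ep Fm Em p x (γ.1 x))) ?_ (hD.linear extStr)).symm
  · simp only [map_add, map_sum, hξ0, add_zero, extStr_endWedge]
  · filter_upwards [hmem] with x hx using formCoord_supertrace hx γ

/-! ### The operator algebra generated by superconnections and endomorphisms -/

/-- An operator which maps `Ω^±(M, E)` to `Ω^{±s}(M, E)`. -/
def ShiftsParity (s : ℤˣ) (T : Module.End ℂ (EForm (n := n) Fp Ep Fm Em)) : Prop :=
  ∀ (r : ℤˣ) (θ : EForm (n := n) Fp Ep Fm Em), HasParity r θ → HasParity (s * r) (T θ)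

/-- An operator `T` such that `Tθ` at a point depends only on `θ` near this point. -/
def IsLocalOp (T : Module.End ℂ (EForm (n := n) Fp Ep Fm Em)) : Prop :=
  ∀ (θ η : EForm (n := n) Fp Ep Fm Em) (p : M), (∀ᶠ x in nhds p, θ.1 x = η.1 x) →
    (T θ).1 p = (T η).1 p

theorem HasParity.sub {r : ℤˣ} {θ η : EForm (n := n) Fp Ep Fm Em} (hθ : HasParity r θ)
    (hη : HasParity r η) : HasParity r (θ - η) := fun x =>
  (map_sub totalSign (θ.1 x) (η.1 x)).trans
    ((congrArg₂ (· - ·) (hθ x) (hη x)).trans (smul_sub (r : ℤ) (θ.1 x) (η.1 x)).symm)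

theorem HasParity.add {r : ℤˣ} {θ η : EForm (n := n) Fp Ep Fm Em} (hθ : HasParity r θ)
    (hη : HasParity r η) : HasParity r (θ + η) := fun x =>
  (map_add totalSign (θ.1 x) (η.1 x)).trans
    ((congrArg₂ (· + ·) (hθ x) (hη x)).trans (smul_add (r : ℤ) (θ.1 x) (η.1 x)).symm)

theorem HasParity.smul {r : ℤˣ} {θ : EForm (n := n) Fp Ep Fm Em} (hθ : HasParity r θ) (c : ℂ) :
    HasParity r (c • θ) := fun x =>
  (map_smul totalSign c (θ.1 x)).trans
    ((congrArg (c • ·) (hθ x)).trans (smul_comm c (r : ℤ) (θ.1 x)))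

theorem ShiftsParity.mul {s s' : ℤˣ} {T T' : Module.End ℂ (EForm (n := n) Fp Ep Fm Em)}
    (h : ShiftsParity s T) (h' : ShiftsParity s' T') : ShiftsParity (s * s') (T * T') :=
  fun r θ hθ => by rw [mul_assoc]; exact h _ _ (h' r θ hθ)

theorem ShiftsParity.sub {s : ℤˣ} {T T' : Module.End ℂ (EForm (n := n) Fp Ep Fm Em)}
    (h : ShiftsParity s T) (h' : ShiftsParity s T') : ShiftsParity s (T - T') :=
  fun r θ hθ => (h r θ hθ).sub (h' r θ hθ)

theorem ShiftsParity.add {s : ℤˣ} {T T' : Module.End ℂ (EForm (n := n) Fp Ep Fm Em)}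
    (h : ShiftsParity s T) (h' : ShiftsParity s T') : ShiftsParity s (T + T') :=
  fun r θ hθ => (h r θ hθ).add (h' r θ hθ)

theorem ShiftsParity.smul {s : ℤˣ} {T : Module.End ℂ (EForm (n := n) Fp Ep Fm Em)}
    (h : ShiftsParity s T) (c : ℂ) : ShiftsParity s (c • T) :=
  fun r θ hθ => (h r θ hθ).smul c

theorem IsLocalOp.mul {T T' : Module.End ℂ (EForm (n := n) Fp Ep Fm Em)}
    (h : IsLocalOp T) (h' : IsLocalOp T') : IsLocalOp (T * T') :=
  fun _ _ p hp => h _ _ p (hp.eventually_nhds.mono fun q hq => h' _ _ q hq)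

theorem IsLocalOp.sub {T T' : Module.End ℂ (EForm (n := n) Fp Ep Fm Em)}
    (h : IsLocalOp T) (h' : IsLocalOp T') : IsLocalOp (T - T') :=
  fun θ η p hp => congrArg₂ (· - ·) (h θ η p hp) (h' θ η p hp)

theorem IsLocalOp.smul {T : Module.End ℂ (EForm (n := n) Fp Ep Fm Em)}
    (h : IsLocalOp T) (c : ℂ) : IsLocalOp (c • T) :=
  fun θ η p hp => congrArg (c • ·) (h θ η p hp)

theorem IsLeibniz.isLocalOp {κ : ℂ} {s : ℤˣ} {T : Module.End ℂ (EForm (n := n) Fp Ep Fm Em)}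
    (hT : IsLeibniz κ s T) : IsLocalOp T := fun _ _ _ hp => hT.congr hp

theorem smul_leibniz {X : Type*} [AddCommGroup X] [Module ℂ X] (c κ : ℂ) (u v : X)
    (L : X →ₗ[ℂ] X) : c • (κ • u + L v) = (c * κ) • u + L (c • v) := by
  rw [smul_add, smul_smul, map_smul]

theorem add_leibniz {X : Type*} [AddCommGroup X] [Module ℂ X] (κ κ' : ℂ) (u v v' : X)
    (L : X →ₗ[ℂ] X) : (κ • u + L v) + (κ' • u + L v') = (κ + κ') • u + L (v + v') := by
  rw [map_add, add_smul]; abel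

theorem IsLeibniz.smul {κ : ℂ} {s : ℤˣ} {T : Module.End ℂ (EForm (n := n) Fp Ep Fm Em)}
    (hT : IsLeibniz κ s T) (c : ℂ) : IsLeibniz (c * κ) s (c • T) where
  parity := ShiftsParity.smul hT.parity c
  leibniz α θ x := (congrArg (c • ·) (hT.leibniz α θ x)).trans
    (smul_leibniz c κ _ ((T θ).1 x) (extWedge (extSgn s (α.1 x))))

theorem IsLeibniz.add {κ κ' : ℂ} {s : ℤˣ} {T T' : Module.End ℂ (EForm (n := n) Fp Ep Fm Em)}
    (hT : IsLeibniz κ s T) (hT' : IsLeibniz κ' s T') : IsLeibniz (κ + κ') s (T + T') where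
  parity := ShiftsParity.add hT.parity hT'.parity
  leibniz α θ x := (congrArg₂ (· + ·) (hT.leibniz α θ x) (hT'.leibniz α θ x)).trans
    (add_leibniz κ κ' _ ((T θ).1 x) ((T' θ).1 x) (extWedge (extSgn s (α.1 x))))

theorem IsLeibniz.wedge_comm {s : ℤˣ} {T : Module.End ℂ (EForm (n := n) Fp Ep Fm Em)}
    (hT : IsLeibniz 0 s T) (α : Form n M) : T * wedge α = wedge (formSgn s α) * T :=
  LinearMap.ext fun θ => EForm.ext fun x => (hT.leibniz α θ x).trans (eq_zero_smul_add rfl).symm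

theorem formSgn_formSgn (s t : ℤˣ) (α : Form n M) : formSgn s (formSgn t α) = formSgn (s * t) α :=
  Form.ext fun x => extSgn_extSgn s t (α.1 x)

theorem formSgn_one (α : Form n M) : formSgn 1 α = α := Form.ext fun x => extSgn_one (α.1 x)

theorem extDeriv_formSgn (s : ℤˣ) (α : Form n M) (x : M) :
    extDeriv n M (formSgn s α) x = (s : ℤ) • extSgn s (extDeriv n M α x) := by
  rcases Int.units_eq_one_or s with rfl | rfl
  · rw [formSgn_one, extSgn_one, Units.val_one, one_smul]
  · rw [extDeriv_sign (α := α) (fun y => extSgn_neg_one (α.1 y)), extSgn_neg_one]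
    simp

theorem leibniz_aux {X Y : Type*} [AddCommGroup X] [Module ℂ X] [AddCommGroup Y] [Module ℂ Y]
    (L : X →ₗ[ℂ] Y →ₗ[ℂ] Y) {d d' : X} (t w : Y) (k : ℤ) (h : d = k • d') :
    (1 : ℂ) • L d t + w = k • L d' t + w := by
  rw [h, one_smul, map_zsmul, LinearMap.smul_apply]

theorem IsLeibniz.wedge_formSgn {A : Module.End ℂ (EForm (n := n) Fp Ep Fm Em)}
    (hA : IsLeibniz 1 (-1) A) {α β : Form n M} (h : β.1 = extDeriv n M α) (s : ℤˣ) :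
    A * wedge (formSgn s α) =
      (s : ℤ) • wedge (formSgn s β) + wedge (formSgn (-s) α) * A :=
  LinearMap.ext fun θ => EForm.ext fun x => by
  refine (hA.leibniz (formSgn s α) θ x).trans ?_
  refine (leibniz_aux extWedge (θ.1 x) _ (s : ℤ) ((extDeriv_formSgn s α x).trans
    (congrArg (fun γ : RawForm n M => (s : ℤ) • extSgn s (γ x)) h.symm))).trans ?_
  refine congrArg (fun a => (s : ℤ) • extWedge (extSgn s (β.1 x)) (θ.1 x) +
    extWedge a ((A θ).1 x)) ?_
  exact (extSgn_extSgn (-1) s (α.1 x)).trans (by rw [neg_one_mul]; rfl)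

/-- Forms with closed smooth differential suffice to test linearity over the forms, for local
operators. -/
theorem isLeibniz_of_closed {s : ℤˣ} {T : Module.End ℂ (EForm (n := n) Fp Ep Fm Em)}
    (hp : ShiftsParity s T) (hl : IsLocalOp T)
    (h : ∀ α β : Form n M, β.1 = extDeriv n M α → extDeriv n M β = 0 →
      T * wedge α = wedge (formSgn s α) * T) : IsLeibniz 0 s T where
  parity := hp
  leibniz α θ x := by
    obtain ⟨α', ⟨β, h1, h2⟩, hα⟩ := exists_hasClosedDeriv α x
    have e1 : (T (wedge α θ)).1 x = (T (wedge α' θ)).1 x :=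
      hl _ _ x (hα.mono fun y hy => congrArg (fun a => extWedge a (θ.1 y)) hy.symm)
    have e2 := congrArg (fun S => evalE (n := n) Fp Ep Fm Em x (S θ)) (h α' β h1 h2)
    refine e1.trans (e2.trans ?_)
    exact (congrArg (fun a => extWedge (extSgn s a) ((T θ).1 x)) hα.self_of_nhds).trans
      (eq_zero_smul_add rfl)

/-- The supercommutator of a superconnection with an operator commuting with the forms commutes
with the forms. -/
theorem IsLeibniz.supercommutator {A T : Module.End ℂ (EForm (n := n) Fp Ep Fm Em)} {s : ℤˣ}
    (hA : IsLeibniz 1 (-1) A) (hT : IsLeibniz 0 s T) :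
    IsLeibniz 0 (-s) (A * T - ((s : ℤ) : ℂ) • (T * A)) := by
  have hA' : ShiftsParity (-1) A := hA.parity
  have hT' : ShiftsParity s T := hT.parity
  refine isLeibniz_of_closed ?_ ?_ fun α β h1 h2 => ?_
  · have e1 := hA'.mul hT'
    have e2 := (hT'.mul hA').smul ((s : ℤ) : ℂ)
    rw [neg_one_mul] at e1
    rw [mul_neg_one] at e2
    exact e1.sub e2
  · exact (hA.isLocalOp.mul hT.isLocalOp).sub ((hT.isLocalOp.mul hA.isLocalOp).smul _)
  · have e1 := hA.wedge_formSgn h1 s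
    have e2 := hA.wedge_formSgn h1 1
    have e3 := hT.wedge_comm α
    have e4 := hT.wedge_comm β
    have e5 := hT.wedge_comm (formSgn (-1) α)
    rw [formSgn_formSgn, mul_neg_one] at e5
    rw [formSgn_one, formSgn_one, Units.val_one, one_smul] at e2
    rw [sub_mul, smul_mul_assoc, mul_assoc A, e3, ← mul_assoc A, e1, mul_assoc T A, e2, mul_add,
      e4, ← mul_assoc T, e5, mul_sub, add_mul, Int.cast_smul_eq_zsmul, mul_smul_comm,
      smul_add, smul_mul_assoc, mul_assoc, mul_assoc]
    abel

/-- The square of a superconnection commutes with the forms. -/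
theorem IsLeibniz.square {A : Module.End ℂ (EForm (n := n) Fp Ep Fm Em)}
    (hA : IsLeibniz 1 (-1) A) : IsLeibniz 0 1 (A * A) := by
  have hA' : ShiftsParity (-1) A := hA.parity
  refine isLeibniz_of_closed (by simpa using hA'.mul hA') (hA.isLocalOp.mul hA.isLocalOp)
    fun α β h1 h2 => ?_
  have e1 := hA.wedge_formSgn h1 1
  have e2 := hA.wedge_formSgn h1 (-1)
  have e3 : (0 : Form n M).1 = extDeriv n M β := h2.symm
  have e4 := hA.wedge_formSgn e3 1
  have e5 : wedge (formSgn 1 (0 : Form n M)) = (0 : Module.End ℂ (EForm (n := n) Fp Ep Fm Em)) :=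
    LinearMap.ext fun θ => EForm.ext fun x =>
      (congrArg (fun a => extWedge a (θ.1 x)) (map_zero (extSgn 1))).trans
        (LinearMap.congr_fun (map_zero extWedge) (θ.1 x))
  rw [e5, smul_zero, zero_add, formSgn_one] at e4
  rw [formSgn_one, formSgn_one, Units.val_one, one_smul] at e1
  rw [neg_neg] at e2
  rw [mul_assoc, e1, mul_add, e4, ← mul_assoc, e2, add_mul, mul_assoc (wedge (formSgn 1 α))]
  simp

/-! ### Exterior multiplication by an even form -/

theorem act_add (γ δ : EndForm (n := n) Fp Ep Fm Em) : act (γ + δ) = act γ + act δ :=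
  LinearMap.ext fun θ => EForm.ext fun x =>
    LinearMap.congr_fun (map_add extAct (γ.1 x) (δ.1 x)) (θ.1 x)

theorem act_smul (c : ℂ) (γ : EndForm (n := n) Fp Ep Fm Em) : act (c • γ) = c • act γ :=
  LinearMap.ext fun θ => EForm.ext fun x =>
    LinearMap.congr_fun (map_smul extAct c (γ.1 x)) (θ.1 x)

theorem supertrace_add (γ δ : EndForm (n := n) Fp Ep Fm Em) :
    supertrace (γ + δ) = supertrace γ + supertrace δ :=
  Form.ext fun x => map_add extStr (γ.1 x) (δ.1 x)

theorem supertrace_smul (c : ℂ) (γ : EndForm (n := n) Fp Ep Fm Em) :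
    supertrace (c • γ) = c • supertrace γ :=
  Form.ext fun x => map_smul extStr c (γ.1 x)

theorem EndHasParity.add {s : ℤˣ} {γ δ : EndForm (n := n) Fp Ep Fm Em} (hγ : EndHasParity s γ)
    (hδ : EndHasParity s δ) : EndHasParity s (γ + δ) := fun x =>
  (map_add totalSignEnd (γ.1 x) (δ.1 x)).trans
    ((congrArg₂ (· + ·) (hγ x) (hδ x)).trans (smul_add (s : ℤ) (γ.1 x) (δ.1 x)).symm)

theorem EndHasParity.smul {s : ℤˣ} {γ : EndForm (n := n) Fp Ep Fm Em} (hγ : EndHasParity s γ)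
    (c : ℂ) : EndHasParity s (c • γ) := fun x =>
  (map_smul totalSignEnd c (γ.1 x)).trans
    ((congrArg (c • ·) (hγ x)).trans (smul_comm c (s : ℤ) (γ.1 x)))

theorem EndHasParity.zero {s : ℤˣ} : EndHasParity s (0 : EndForm (n := n) Fp Ep Fm Em) := fun _ =>
  (map_zero totalSignEnd).trans (smul_zero (s : ℤ)).symm

theorem isLeibniz_of_wedge_comm {s : ℤˣ} {T : Module.End ℂ (EForm (n := n) Fp Ep Fm Em)}
    (hp : ShiftsParity s T) (h : ∀ α : Form n M, T * wedge α = wedge (formSgn s α) * T) :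
    IsLeibniz 0 s T where
  parity := hp
  leibniz α θ x :=
    (congrArg (fun S => evalE (n := n) Fp Ep Fm Em x (S θ)) (h α)).trans (eq_zero_smul_add rfl)

theorem IsLeibniz.mul {s s' : ℤˣ} {T T' : Module.End ℂ (EForm (n := n) Fp Ep Fm Em)}
    (hT : IsLeibniz 0 s T) (hT' : IsLeibniz 0 s' T') : IsLeibniz 0 (s * s') (T * T') :=
  isLeibniz_of_wedge_comm (ShiftsParity.mul hT.parity hT'.parity) fun α => by
    rw [mul_assoc, hT'.wedge_comm, ← mul_assoc, hT.wedge_comm, formSgn_formSgn, mul_assoc]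

theorem isLeibniz_one : IsLeibniz 0 1 (1 : Module.End ℂ (EForm (n := n) Fp Ep Fm Em)) :=
  isLeibniz_of_wedge_comm (fun r θ h => by rw [one_mul]; exact h) fun α => by
    rw [one_mul, formSgn_one, mul_one]

theorem extWedge_extWedge_comm {W P N : Type*} [AddCommGroup W] [Module ℝ W] [AddCommGroup P]
    [Module ℂ P] [AddCommGroup N] [Module ℂ N] {b : Ext W} (hb : extSign b = b) (a : Ext W)
    (t : Ext W ⊗[ℂ] (P × N)) : extWedge b (extWedge a t) = extWedge a (extWedge b t) := by
  rw [← extWedge_mul, ← extWedge_mul,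
    mul_eq_extSgn_mul (u := 1) (by rw [hb, Units.val_one, one_smul]), extSgn_one]

theorem totalSign_extWedge_of_even {W P N : Type*} [AddCommGroup W] [Module ℝ W] [AddCommGroup P]
    [Module ℂ P] [AddCommGroup N] [Module ℂ N] {b : Ext W} (hb : extSign b = b) {r : ℤˣ}
    {t : Ext W ⊗[ℂ] (P × N)} (ht : totalSign t = (r : ℤ) • t) :
    totalSign (extWedge b t) = (r : ℤ) • extWedge b t := by
  rw [totalSign_extWedge, hb, ht, map_zsmul]

/-- Exterior multiplication by an even form. -/
theorem isLeibniz_wedge {σ : Form n M} (hσ : ∀ x, extSign (σ.1 x) = σ.1 x) :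
    IsLeibniz 0 1 (wedge σ : Module.End ℂ (EForm (n := n) Fp Ep Fm Em)) :=
  isLeibniz_of_wedge_comm
    (fun r θ h x => by rw [one_mul]; exact totalSign_extWedge_of_even (hσ x) (h x))
    fun α => by
      rw [formSgn_one]
      exact LinearMap.ext fun θ => EForm.ext fun x =>
        extWedge_extWedge_comm (hσ x) (α.1 x) (θ.1 x)

theorem formSgn_of_even {σ : Form n M} (hσ : ∀ x, extSign (σ.1 x) = σ.1 x) (s : ℤˣ) :
    formSgn s σ = σ := by
  rcases Int.units_eq_one_or s with rfl | rfl
  · exact formSgn_one σ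
  · exact Form.ext fun x => (extSgn_neg_one (σ.1 x)).trans (hσ x)

/-- Superconnections commute with the exterior multiplication by an even closed form. -/
theorem IsLeibniz.wedge_even_comm {A : Module.End ℂ (EForm (n := n) Fp Ep Fm Em)}
    (hA : IsLeibniz 1 (-1) A) {σ : Form n M} (hσ : ∀ x, extSign (σ.1 x) = σ.1 x)
    (hd : extDeriv n M σ = 0) : A * wedge σ = wedge σ * A :=
  LinearMap.ext fun θ => EForm.ext fun x => by
    refine (hA.leibniz σ θ x).trans ?_
    refine (congrArg₂ (fun d c => (1 : ℂ) • extWedge d (θ.1 x) + extWedge c ((A θ).1 x))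
      (congrFun hd x) ((extSgn_neg_one (σ.1 x)).trans (hσ x))).trans ?_
    refine (congrArg (fun u => (1 : ℂ) • u + extWedge (σ.1 x) ((A θ).1 x))
      (LinearMap.congr_fun (map_zero extWedge) (θ.1 x))).trans ?_
    exact (congrArg (· + extWedge (σ.1 x) ((A θ).1 x)) (smul_zero (1 : ℂ))).trans (zero_add _)

theorem supertrace_wedge {σ : Form n M} {γ ζ : EndForm (n := n) Fp Ep Fm Em}
    (h : act ζ = wedge σ * act γ) : supertrace ζ = formMul σ (supertrace γ) :=
  Form.ext fun x => by
    obtain ⟨_f1, _f2⟩ := fibre_finite Fp Ep Fm Em x x (mem_of_mem_nhds (coordSet_mem (n := n) x))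
    have : ζ.1 x = endWedge (σ.1 x) (γ.1 x) := extAct_injective fun t => by
      obtain ⟨θ, rfl⟩ := exists_eForm_eq (n := n) (Fp := Fp) (Ep := Ep) (Fm := Fm) (Em := Em) x t
      exact (congrArg (fun T => evalE (n := n) Fp Ep Fm Em x (T θ)) h).trans
        (extAct_endWedge (σ.1 x) (γ.1 x) (θ.1 x)).symm
    exact (congrArg extStr this).trans (extStr_endWedge (σ.1 x) (γ.1 x))

/-! ### Operators identified with pairs and their supertraces -/

variable (n Fp Ep Fm Em) in
/-- The operators identified with a pair in `Ω^s(M, End E) ⊕ Ω^{-s}(M, End E)`. -/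
def pairSpace (s : ℤˣ) :
    Submodule ℂ (Module.End ℂ (EForm (n := n) Fp Ep Fm Em × EForm (n := n) Fp Ep Fm Em)) where
  carrier := {x | ∃ γ δ : EndForm (n := n) Fp Ep Fm Em, EndHasParity s γ ∧ EndHasParity (-s) δ ∧
    x = pairOp s (act γ) (act δ)}
  zero_mem' := by
    have h : act (0 : EndForm (n := n) Fp Ep Fm Em) = 0 := by
      have := act_smul (0 : ℂ) (0 : EndForm (n := n) Fp Ep Fm Em)
      rwa [zero_smul, zero_smul] at this
    exact ⟨0, 0, EndHasParity.zero, EndHasParity.zero, by rw [h, pairOp_zero]⟩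
  add_mem' := by
    rintro _ _ ⟨γ, δ, h1, h2, rfl⟩ ⟨γ', δ', h1', h2', rfl⟩
    exact ⟨γ + γ', δ + δ', h1.add h1', h2.add h2', by rw [pairOp_add, act_add, act_add]⟩
  smul_mem' := by
    rintro c _ ⟨γ, δ, h1, h2, rfl⟩
    exact ⟨c • γ, c • δ, h1.smul c, h2.smul c, by rw [pairOp_smul, act_smul, act_smul]⟩

theorem pairOp_mem {s : ℤˣ} {c e : Module.End ℂ (EForm (n := n) Fp Ep Fm Em)}
    (hc : IsLeibniz 0 s c) (he : IsLeibniz 0 (-s) e) :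
    pairOp s c e ∈ pairSpace n Fp Ep Fm Em s := by
  obtain ⟨γ, hγ, rfl⟩ := hc.exists_act
  obtain ⟨δ, hδ, rfl⟩ := he.exists_act
  exact ⟨γ, δ, hγ, hδ, rfl⟩

theorem pairSpace_one_mem :
    (1 : Module.End ℂ (EForm (n := n) Fp Ep Fm Em × EForm (n := n) Fp Ep Fm Em)) ∈
      pairSpace n Fp Ep Fm Em 1 := by
  rw [← pairOp_one]
  have h := (isLeibniz_act (EndHasParity.zero (s := -1) (n := n) (Fp := Fp) (Ep := Ep) (Fm := Fm)
    (Em := Em))).smul 0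
  rw [zero_smul, mul_zero] at h
  exact pairOp_mem isLeibniz_one h

theorem pairSpace_mul_mem {s s' : ℤˣ}
    {x y : Module.End ℂ (EForm (n := n) Fp Ep Fm Em × EForm (n := n) Fp Ep Fm Em)}
    (hx : x ∈ pairSpace n Fp Ep Fm Em s) (hy : y ∈ pairSpace n Fp Ep Fm Em s') :
    x * y ∈ pairSpace n Fp Ep Fm Em (s * s') := by
  obtain ⟨γ, δ, h1, h2, rfl⟩ := hx
  obtain ⟨γ', δ', h1', h2', rfl⟩ := hy
  rw [pairOp_mul]
  refine pairOp_mem ((isLeibniz_act h1).mul (isLeibniz_act h1')) ?_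
  have e1 := (isLeibniz_act h2).mul (isLeibniz_act h1')
  have e2 := ((isLeibniz_act h1).mul (isLeibniz_act h2')).smul ((s : ℤ) : ℂ)
  rw [neg_mul] at e1
  rw [mul_neg, mul_zero] at e2
  simpa using e1.add e2

theorem extAct_sign_conj {W P N : Type*} [AddCommGroup W] [Module ℝ W] [AddCommGroup P]
    [Module ℂ P] [AddCommGroup N] [Module ℂ N] {s : ℤˣ} {γ : Ext W ⊗[ℂ] Module.End ℂ (P × N)}
    (hγ : totalSignEnd γ = (s : ℤ) • γ) (t u : Ext W ⊗[ℂ] (P × N)) :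
    u + ((s : ℤ) : ℂ) • extAct γ t = u + totalSign (extAct γ (totalSign t)) := by
  rw [totalSign_extAct, hγ, totalSign_totalSign, map_zsmul, LinearMap.smul_apply]
  exact congrArg (u + ·) (Int.cast_smul_eq_zsmul ℂ (s : ℤ) (extAct γ t))

theorem isIdentifiedWith_pairOp {s : ℤˣ} {γ : EndForm (n := n) Fp Ep Fm Em} (hγ : EndHasParity s γ)
    (δ : EndForm (n := n) Fp Ep Fm Em) :
    IsIdentifiedWith (pairOp s (act γ) (act δ)) (γ, δ) := fun α β x =>
  ⟨rfl, extAct_sign_conj (hγ x) (β.1 x) (extAct (δ.1 x) (α.1 x))⟩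

/-- An operator is identified with at most one pair. -/
theorem IsIdentifiedWith.unique
    {T : Module.End ℂ (EForm (n := n) Fp Ep Fm Em × EForm (n := n) Fp Ep Fm Em)}
    {c c' : EndForm (n := n) Fp Ep Fm Em × EndForm (n := n) Fp Ep Fm Em}
    (h : IsIdentifiedWith T c) (h' : IsIdentifiedWith T c') : c = c' := by
  have e1 : c.1 = c'.1 := endForm_eq_of_act fun θ x => (h θ 0 x).1.symm.trans (h' θ 0 x).1
  refine Prod.ext e1 (endForm_eq_of_act fun θ x => ?_)
  have e2 := (h θ 0 x).2.symm.trans (h' θ 0 x).2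
  rw [e1] at e2
  exact add_right_cancel e2

theorem boldStr_eq {T : Module.End ℂ (EForm (n := n) Fp Ep Fm Em × EForm (n := n) Fp Ep Fm Em)}
    {c : EndForm (n := n) Fp Ep Fm Em × EndForm (n := n) Fp Ep Fm Em}
    (h : IsIdentifiedWith T c) : boldStr T = (supertrace c.1, supertrace c.2) := by
  have hex : ∃ c, IsIdentifiedWith T c := ⟨c, h⟩
  rw [boldStr, dif_pos hex, hex.choose_spec.unique h]

theorem exists_unique_identified {s : ℤˣ}
    {T : Module.End ℂ (EForm (n := n) Fp Ep Fm Em × EForm (n := n) Fp Ep Fm Em)}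
    (hT : T ∈ pairSpace n Fp Ep Fm Em s) :
    ∃ c : EndForm (n := n) Fp Ep Fm Em × EndForm (n := n) Fp Ep Fm Em,
      IsIdentifiedWith T c ∧ (∀ c', IsIdentifiedWith T c' → c' = c) ∧
        EndHasParity s c.1 ∧ EndHasParity (-s) c.2 := by
  obtain ⟨γ, δ, h1, h2, rfl⟩ := hT
  have h := isIdentifiedWith_pairOp h1 δ
  exact ⟨(γ, δ), h, fun c' hc' => hc'.unique h, h1, h2⟩

theorem add_identified {Y : Type*} [AddCommGroup Y] [Module ℂ Y] {Z : Type*} [AddCommGroup Z]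
    [Module ℂ Z] (L : Z →ₗ[ℂ] Y →ₗ[ℂ] Y) (E : Y →ₗ[ℂ] Y) {u u' α β : Y} {d d' g g' : Z}
    (h : u = L d α + E (L g (E β))) (h' : u' = L d' α + E (L g' (E β))) :
    u + u' = L (d + d') α + E (L (g + g') (E β)) := by
  rw [h, h', map_add, map_add, LinearMap.add_apply, LinearMap.add_apply, map_add]; abel

theorem smul_identified {Y : Type*} [AddCommGroup Y] [Module ℂ Y] {Z : Type*} [AddCommGroup Z]
    [Module ℂ Z] (L : Z →ₗ[ℂ] Y →ₗ[ℂ] Y) (E : Y →ₗ[ℂ] Y) {u α β : Y} {d g : Z} (c : ℂ)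
    (h : u = L d α + E (L g (E β))) :
    c • u = L (c • d) α + E (L (c • g) (E β)) := by
  rw [h, map_smul, map_smul, LinearMap.smul_apply, LinearMap.smul_apply, map_smul, smul_add]

theorem IsIdentifiedWith.add
    {T T' : Module.End ℂ (EForm (n := n) Fp Ep Fm Em × EForm (n := n) Fp Ep Fm Em)}
    {c c' : EndForm (n := n) Fp Ep Fm Em × EndForm (n := n) Fp Ep Fm Em}
    (h : IsIdentifiedWith T c) (h' : IsIdentifiedWith T' c') : IsIdentifiedWith (T + T') (c + c') :=
  fun α β x => ⟨(congrArg₂ (· + ·) (h α β x).1 (h' α β x).1).trans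
    (LinearMap.congr_fun (map_add extAct (c.1.1 x) (c'.1.1 x)) (α.1 x)).symm,
    add_identified extAct totalSign (h α β x).2 (h' α β x).2⟩

theorem IsIdentifiedWith.smul
    {T : Module.End ℂ (EForm (n := n) Fp Ep Fm Em × EForm (n := n) Fp Ep Fm Em)}
    {c : EndForm (n := n) Fp Ep Fm Em × EndForm (n := n) Fp Ep Fm Em}
    (h : IsIdentifiedWith T c) (k : ℂ) : IsIdentifiedWith (k • T) (k • c) :=
  fun α β x => ⟨(congrArg (k • ·) (h α β x).1).trans
    (LinearMap.congr_fun (map_smul extAct k (c.1.1 x)) (α.1 x)).symm,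
    smul_identified extAct totalSign k (h α β x).2⟩

variable (n Fp Ep Fm Em) in
/-- The operators on `Ω(M, E) ⊕ Ω(M, E)` which are identified with a pair. -/
def identifiedSpace :
    Submodule ℂ (Module.End ℂ (EForm (n := n) Fp Ep Fm Em × EForm (n := n) Fp Ep Fm Em)) where
  carrier := {T | ∃ c, IsIdentifiedWith T c}
  zero_mem' := by
    obtain ⟨c, hc, -⟩ := exists_unique_identified (pairSpace n Fp Ep Fm Em 1).zero_mem
    exact ⟨c, hc⟩
  add_mem' := fun ⟨c, h⟩ ⟨c', h'⟩ => ⟨c + c', h.add h'⟩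
  smul_mem' := fun k _ ⟨c, h⟩ => ⟨k • c, h.smul k⟩

variable (n Fp Ep Fm Em) in
/-- A linear extension of the supertrace to all operators on `Ω(M, E) ⊕ Ω(M, E)`. -/
theorem exists_linear_boldStr :
    ∃ τ : Module.End ℂ (EForm (n := n) Fp Ep Fm Em × EForm (n := n) Fp Ep Fm Em) →ₗ[ℂ]
        (Form n M × Form n M), ∀ T c, IsIdentifiedWith T c →
      τ T = boldStr T := by
  let τ₀ : identifiedSpace n Fp Ep Fm Em →ₗ[ℂ] (Form n M × Form n M) :=
    { toFun := fun T => boldStr T.1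
      map_add' := by
        rintro ⟨T, c, h⟩ ⟨T', c', h'⟩
        refine (boldStr_eq (h.add h')).trans ?_
        rw [boldStr_eq h, boldStr_eq h']
        exact Prod.ext (supertrace_add _ _) (supertrace_add _ _)
      map_smul' := by
        rintro k ⟨T, c, h⟩
        refine (boldStr_eq (h.smul k)).trans ?_
        rw [boldStr_eq h]
        exact Prod.ext (supertrace_smul _ _) (supertrace_smul _ _) }
  obtain ⟨τ, hτ⟩ := τ₀.exists_extend
  exact ⟨τ, fun T c h => LinearMap.congr_fun hτ ⟨T, c, h⟩⟩

theorem boldStr_pairOp {s : ℤˣ} {γ : EndForm (n := n) Fp Ep Fm Em} (hγ : EndHasParity s γ)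
    (δ : EndForm (n := n) Fp Ep Fm Em) :
    boldStr (pairOp s (act γ) (act δ)) = (supertrace γ, supertrace δ) :=
  boldStr_eq (isIdentifiedWith_pairOp hγ δ)

theorem isLeibniz_supercommutator {s s' : ℤˣ} {T T' : Module.End ℂ (EForm (n := n) Fp Ep Fm Em)}
    (hT : IsLeibniz 0 s T) (hT' : IsLeibniz 0 s' T') (k : ℂ) :
    IsLeibniz 0 (s * s') (T * T' - k • (T' * T)) := by
  have h1 := hT'.mul hT
  rw [mul_comm s' s] at h1
  have h2 := (hT.mul hT').add (h1.smul (-k))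
  rwa [mul_zero, add_zero, neg_smul, ← sub_eq_add_neg] at h2

theorem exists_act_supercommutator {s s' : ℤˣ} {γ γ' : EndForm (n := n) Fp Ep Fm Em}
    (hγ : EndHasParity s γ) (hγ' : EndHasParity s' γ') :
    ∃ ζ : EndForm (n := n) Fp Ep Fm Em, EndHasParity (s * s') ζ ∧ supertrace ζ = 0 ∧
      act ζ = act γ * act γ' - ((koszul s s' : ℤ) : ℂ) • (act γ' * act γ) := by
  obtain ⟨ζ, h1, h2⟩ :=
    (isLeibniz_supercommutator (isLeibniz_act hγ) (isLeibniz_act hγ') _).exists_act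
  exact ⟨ζ, h1, supertrace_supercommutator hγ hγ'
    (h2.symm.trans (by rw [Int.cast_smul_eq_zsmul])), h2.symm⟩

/-- The supertrace vanishes on supercommutators. -/
theorem boldStr_supercommutator {s s' : ℤˣ}
    {x y : Module.End ℂ (EForm (n := n) Fp Ep Fm Em × EForm (n := n) Fp Ep Fm Em)}
    (hx : x ∈ pairSpace n Fp Ep Fm Em s) (hy : y ∈ pairSpace n Fp Ep Fm Em s') :
    boldStr (x * y - ((koszul s s' : ℤ) : ℂ) • (y * x)) = 0 := by
  obtain ⟨γ, δ, h1, h2, rfl⟩ := hx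
  obtain ⟨γ', δ', h1', h2', rfl⟩ := hy
  obtain ⟨ζ, z1, z2, z3⟩ := exists_act_supercommutator h1 h1'
  obtain ⟨ζ', -, z2', z3'⟩ := exists_act_supercommutator h2 h1'
  obtain ⟨ζ'', -, z2'', z3''⟩ := exists_act_supercommutator h1 h2'
  rw [pairOp_supercommutator, ← z3, ← z3', ← z3'', ← act_smul, ← act_add, boldStr_pairOp z1,
    supertrace_add, supertrace_smul, z2, z2', z2'', smul_zero, add_zero]
  rfl

/-! ### Primitive superconnections -/

theorem primitiveOp_eq (σ : Form n M) (A : Module.End ℂ (EForm (n := n) Fp Ep Fm Em))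
    (B : EndForm (n := n) Fp Ep Fm Em) : primitiveOp σ A B = coneOp (wedge σ) A (act B) := rfl

theorem IsLeibniz.isSuperconnection {A : Module.End ℂ (EForm (n := n) Fp Ep Fm Em)}
    (hA : IsLeibniz 1 (-1) A) : IsSuperconnection A where
  odd s θ h := by simpa using hA.parity s θ h
  leibniz α θ x := by simpa using hA.leibniz α θ x

/-- The affine line through two primitive superconnections consists of primitive
superconnections. -/
theorem IsPrimitiveSuperconnection.line {σ : Form n M}
    {A₀ A₁ : Module.End ℂ (EForm (n := n) Fp Ep Fm Em × EForm (n := n) Fp Ep Fm Em)}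
    (h₀ : IsPrimitiveSuperconnection σ A₀) (h₁ : IsPrimitiveSuperconnection σ A₁) (t : ℂ) :
    IsPrimitiveSuperconnection σ (t • A₁ + (1 - t) • A₀) := by
  obtain ⟨A, B, hA, hB, rfl⟩ := h₀
  obtain ⟨A', B', hA', hB', rfl⟩ := h₁
  refine ⟨t • A' + (1 - t) • A, t • B' + (1 - t) • B, ?_, (hB'.smul t).add (hB.smul (1 - t)), ?_⟩
  · have h := (hA'.isLeibniz.smul t).add (hA.isLeibniz.smul (1 - t))
    rw [mul_one, mul_one, add_sub_cancel] at h
    exact h.isSuperconnection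
  · rw [primitiveOp_eq, primitiveOp_eq, primitiveOp_eq, coneOp_line, act_add, act_smul, act_smul]

theorem IsPrimitiveSuperconnection.sub_mem {σ : Form n M}
    {A₀ A₁ : Module.End ℂ (EForm (n := n) Fp Ep Fm Em × EForm (n := n) Fp Ep Fm Em)}
    (h₀ : IsPrimitiveSuperconnection σ A₀) (h₁ : IsPrimitiveSuperconnection σ A₁) :
    A₁ - A₀ ∈ pairSpace n Fp Ep Fm Em (-1) := by
  obtain ⟨A, B, hA, hB, rfl⟩ := h₀
  obtain ⟨A', B', hA', hB', rfl⟩ := h₁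
  rw [primitiveOp_eq, primitiveOp_eq, coneOp_sub]
  have e1 := hA'.isLeibniz.add (hA.isLeibniz.smul (-1))
  have e2 := (isLeibniz_act hB').add ((isLeibniz_act hB).smul (-1))
  rw [mul_one, add_neg_cancel, neg_one_smul, ← sub_eq_add_neg] at e1
  rw [mul_zero, add_zero, neg_one_smul, ← sub_eq_add_neg] at e2
  exact pairOp_mem e1 (by rwa [neg_neg])

theorem isLeibniz_wedge_mul {σ : Form n M} (hσ : ∀ x, extSign (σ.1 x) = σ.1 x) {s : ℤˣ}
    {T : Module.End ℂ (EForm (n := n) Fp Ep Fm Em)} (hT : IsLeibniz 0 s T) :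
    IsLeibniz 0 s (wedge σ * T) := by
  simpa only [one_mul] using (isLeibniz_wedge hσ).mul hT

theorem wedge_act_comm {σ : Form n M} (hσ : ∀ x, extSign (σ.1 x) = σ.1 x) {s : ℤˣ}
    {T : Module.End ℂ (EForm (n := n) Fp Ep Fm Em)} (hT : IsLeibniz 0 s T) :
    wedge σ * T = T * wedge σ := by
  rw [hT.wedge_comm, formSgn_of_even hσ]

/-- The curvature of a primitive superconnection. -/
theorem IsPrimitiveSuperconnection.square_mem {σ : Form n M}
    (hσ : ∀ x, extSign (σ.1 x) = σ.1 x) (hd : extDeriv n M σ = 0)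
    {A : Module.End ℂ (EForm (n := n) Fp Ep Fm Em × EForm (n := n) Fp Ep Fm Em)}
    (h : IsPrimitiveSuperconnection σ A) : A * A ∈ pairSpace n Fp Ep Fm Em 1 := by
  obtain ⟨A, B, hA, hB, rfl⟩ := h
  have hB' := isLeibniz_act hB
  rw [primitiveOp_eq, coneOp_square (hA.isLeibniz.wedge_even_comm hσ hd) (wedge_act_comm hσ hB')]
  have e1 := hA.isLeibniz.square.add (isLeibniz_wedge_mul hσ hB')
  rw [add_zero] at e1
  have e2 := (hA.isLeibniz.supercommutator hB').smul (-1)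
  rw [Units.val_one, Int.cast_one, one_smul, mul_zero, neg_one_smul, neg_sub] at e2
  exact pairOp_mem e1 e2

theorem inclPair_apply (c : Form n M × Form n M) : inclPair n M c = (c.1.1, c.2.1) := rfl

theorem boundary_apply (σ : Form n M) (c : Form n M × Form n M) :
    boundary σ c = (extDeriv n M c.1 + σ.1 * c.2.1, -extDeriv n M c.2) := rfl

theorem exists_superconnection_act {s : ℤˣ} {A : Module.End ℂ (EForm (n := n) Fp Ep Fm Em)}
    (hA : IsLeibniz 1 (-1) A) {γ : EndForm (n := n) Fp Ep Fm Em} (hγ : EndHasParity s γ) :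
    ∃ ζ : EndForm (n := n) Fp Ep Fm Em, EndHasParity (-s) ζ ∧
      (supertrace ζ).1 = extDeriv n M (supertrace γ) ∧
      act ζ = A * act γ - ((s : ℤ) : ℂ) • (act γ * A) := by
  obtain ⟨ζ, h1, h2⟩ := (hA.supercommutator (isLeibniz_act hγ)).exists_act
  exact ⟨ζ, h1, supertrace_superconnection hA hγ (h2.symm.trans (by rw [Int.cast_smul_eq_zsmul])),
    h2.symm⟩

/-- The supertrace intertwines the supercommutator with a primitive superconnection and the
boundary operator of the primitive complex. -/
theorem IsPrimitiveSuperconnection.supercommutator {σ : Form n M}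
    (hσ : ∀ x, extSign (σ.1 x) = σ.1 x)
    {A : Module.End ℂ (EForm (n := n) Fp Ep Fm Em × EForm (n := n) Fp Ep Fm Em)}
    (h : IsPrimitiveSuperconnection σ A) {s : ℤˣ}
    {x : Module.End ℂ (EForm (n := n) Fp Ep Fm Em × EForm (n := n) Fp Ep Fm Em)}
    (hx : x ∈ pairSpace n Fp Ep Fm Em s) :
    A * x - ((s : ℤ) : ℂ) • (x * A) ∈ pairSpace n Fp Ep Fm Em (-s) ∧
      inclPair n M (boldStr (A * x - ((s : ℤ) : ℂ) • (x * A))) = boundary σ (boldStr x) := by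
  obtain ⟨A, B, hA, hB, rfl⟩ := h
  obtain ⟨γ, δ, hγ, hδ, rfl⟩ := hx
  obtain ⟨ζ₁, p1, t1, a1⟩ := exists_superconnection_act hA.isLeibniz hγ
  obtain ⟨ζ₂, p2, a2⟩ := (isLeibniz_wedge_mul hσ (isLeibniz_act hδ)).exists_act
  obtain ⟨ζ₃, p3, t3, a3⟩ := exists_act_supercommutator hB hγ
  obtain ⟨ζ₄, p4, t4, a4⟩ := exists_superconnection_act hA.isLeibniz hδ
  rw [koszul_one_left, Units.val_one, Int.cast_one, one_smul] at a3
  rw [one_mul] at p3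
  rw [neg_neg] at p4
  have key := coneOp_supercommutator (w := wedge σ) (a := A) (b := act B) (c := act γ)
    (e := act δ) s (wedge_act_comm hσ (isLeibniz_act hγ)) (wedge_act_comm hσ (isLeibniz_act hδ))
  have e2 : act ζ₃ - act ζ₄ = act (ζ₃ + (-1 : ℂ) • ζ₄) := by
    rw [act_add, act_smul, neg_one_smul, sub_eq_add_neg]
  rw [← a1, ← a3, ← a4, a2, ← act_add, e2] at key
  have q1 : EndHasParity (-s) (ζ₁ + ζ₂) := p1.add p2
  have q2 : EndHasParity (-(-s)) (ζ₃ + (-1 : ℂ) • ζ₄) := by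
    rw [neg_neg]; exact p3.add (p4.smul _)
  rw [primitiveOp_eq, key]
  refine ⟨⟨_, _, q1, q2, rfl⟩, ?_⟩
  rw [boldStr_pairOp q1, boldStr_pairOp hγ, inclPair_apply, boundary_apply, supertrace_add,
    supertrace_add, supertrace_smul, t3, supertrace_wedge a2.symm, zero_add]
  refine Prod.ext ?_ ?_
  · exact congrArg (· + σ.1 * (supertrace δ).1) t1
  · exact (neg_one_smul ℂ (supertrace ζ₄).1).trans (congrArg Neg.neg t4)

variable (n Fp Ep Fm Em) in
theorem isSupertrace_boldStr
    {τ : Module.End ℂ (EForm (n := n) Fp Ep Fm Em × EForm (n := n) Fp Ep Fm Em) →ₗ[ℂ]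
      (Form n M × Form n M)} (hτ : ∀ T c, IsIdentifiedWith T c → τ T = boldStr T) :
    IsSupertrace (pairSpace n Fp Ep Fm Em) τ where
  one_mem := pairSpace_one_mem
  mul_mem := pairSpace_mul_mem
  comm {s s' x y} hx hy := by
    have h1 := pairSpace_mul_mem hy hx
    rw [mul_comm s' s] at h1
    obtain ⟨c, hc, -⟩ := exists_unique_identified
      (Submodule.sub_mem _ (pairSpace_mul_mem hx hy) (Submodule.smul_mem _ _ h1))
    have h2 := (hτ _ c hc).trans (boldStr_supercommutator hx hy)
    rwa [map_sub, map_smul, sub_eq_zero] at h2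

/-! ### The transgression formula for primitive superconnections -/

theorem IsPrimitiveSuperconnection.aeval_mem {σ : Form n M}
    (hσ : ∀ x, extSign (σ.1 x) = σ.1 x) (hd : extDeriv n M σ = 0)
    {A : Module.End ℂ (EForm (n := n) Fp Ep Fm Em × EForm (n := n) Fp Ep Fm Em)}
    (h : IsPrimitiveSuperconnection σ A) (f : Polynomial ℂ) :
    Polynomial.aeval (A ^ 2) f ∈ pairSpace n Fp Ep Fm Em 1 := by
  have hsq := h.square_mem hσ hd
  rw [← sq] at hsq
  have hpow : ∀ m, (A ^ 2) ^ m ∈ pairSpace n Fp Ep Fm Em 1 := fun m => by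
    induction m with
    | zero => rw [pow_zero]; exact pairSpace_one_mem
    | succ m ih => rw [pow_succ, ← one_mul (1 : ℤˣ)]; exact pairSpace_mul_mem ih hsq
  induction f using Polynomial.induction_on' with
  | add f g hf hg => rw [map_add]; exact Submodule.add_mem _ hf hg
  | monomial m c =>
    rw [Polynomial.aeval_monomial, ← Algebra.smul_def]
    exact Submodule.smul_mem _ _ (hpow m)

/-- The supertrace of a polynomial in the curvature is closed: the polynomial commutes with the
primitive superconnection. -/
theorem IsPrimitiveSuperconnection.boundary_boldStr {σ : Form n M}
    (hσ : ∀ x, extSign (σ.1 x) = σ.1 x) (hd : extDeriv n M σ = 0)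
    {A : Module.End ℂ (EForm (n := n) Fp Ep Fm Em × EForm (n := n) Fp Ep Fm Em)}
    (h : IsPrimitiveSuperconnection σ A) (f : Polynomial ℂ) :
    boundary σ (boldStr (Polynomial.aeval (A ^ 2) f)) = 0 := by
  obtain ⟨-, h1⟩ := h.supercommutator hσ (h.aeval_mem hσ hd f)
  have h2 : Commute A (Polynomial.aeval (A ^ 2) f) := by
    have e : Polynomial.aeval (A ^ 2) f = Polynomial.aeval A (f.comp (Polynomial.X ^ 2)) := by
      rw [Polynomial.aeval_comp, map_pow, Polynomial.aeval_X]
    rw [e]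
    have h2 := (Commute.all Polynomial.X (f.comp (Polynomial.X ^ 2))).map (Polynomial.aeval A)
    rwa [Polynomial.aeval_X] at h2
  rw [← h1, Units.val_one, Int.cast_one, one_smul, h2.eq, sub_self]
  obtain ⟨τ, hτ⟩ := exists_linear_boldStr n Fp Ep Fm Em
  obtain ⟨c, hc, -⟩ := exists_unique_identified (pairSpace n Fp Ep Fm Em 1).zero_mem
  rw [← hτ 0 c hc, map_zero, map_zero]

theorem line_eq {X : Type*} [AddCommGroup X] [Module ℂ X] (t : ℂ) (x y : X) :
    t • x + (1 - t) • y = y + t • (x - y) := by module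

theorem sub_neg_one_smul {X : Type*} [AddCommGroup X] [Module ℂ X] (x y : X) :
    x - (((-1 : ℤˣ) : ℤ) : ℂ) • y = x + y := by simp

/-- The transgression formula: the supertrace of `(𝔸₁ - 𝔸₀) f'(𝔸_t²)` is a polynomial in `t`, and its
primitive from `0` to `1` has the difference of the supertraces of `f(𝔸₁²)` and `f(𝔸₀²)` as its
boundary. -/
theorem IsPrimitiveSuperconnection.transgression {σ : Form n M}
    (hσ : ∀ x, extSign (σ.1 x) = σ.1 x) (hd : extDeriv n M σ = 0)
    {A₀ A₁ : Module.End ℂ (EForm (n := n) Fp Ep Fm Em × EForm (n := n) Fp Ep Fm Em)}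
    (h₀ : IsPrimitiveSuperconnection σ A₀) (h₁ : IsPrimitiveSuperconnection σ A₁)
    (f : Polynomial ℂ) :
    ∃ (N : ℕ) (c : ℕ → Form n M × Form n M),
      (∀ t : ℂ, boldStr ((A₁ - A₀) * Polynomial.aeval ((t • A₁ + (1 - t) • A₀) ^ 2)
        (Polynomial.derivative f)) = ∑ k ∈ Finset.range N, t ^ k • c k) ∧
      inclPair n M (boldStr (Polynomial.aeval (A₁ ^ 2) f) -
        boldStr (Polynomial.aeval (A₀ ^ 2) f)) =
        boundary σ (∑ k ∈ Finset.range N, ((k : ℂ) + 1)⁻¹ • c k) := by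
  obtain ⟨τ, hτ⟩ := exists_linear_boldStr n Fp Ep Fm Em
  have hτ' : ∀ {s T}, T ∈ pairSpace n Fp Ep Fm Em s → τ T = boldStr T := fun hT => by
    obtain ⟨c, hc, -⟩ := exists_unique_identified hT
    exact hτ _ c hc
  have ha := h₀.sub_mem h₁
  have hline : ∀ t : ℂ, t • A₁ + (1 - t) • A₀ = A₀ + t • (A₁ - A₀) := fun t => line_eq t A₁ A₀
  obtain ⟨N, c, hc, hη⟩ := (isSupertrace_boldStr n Fp Ep Fm Em hτ).transgression
    (b := boundary σ) (ι := inclPair n M) ha (h₀.square_mem hσ hd) (fun x hx => by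
      obtain ⟨e1, e2⟩ := h₀.supercommutator hσ hx
      have e3 : A₀ * x - (((-1 : ℤˣ) : ℤ) : ℂ) • (x * A₀) = A₀ * x + x * A₀ := by
        exact sub_neg_one_smul _ _
      rw [e3] at e1 e2
      rw [neg_neg] at e1
      exact ⟨e1, by rw [hτ' e1, hτ' hx, e2]⟩) f
  refine ⟨N, c, fun t => ?_, ?_⟩
  · rw [← hc, ← hline]
    exact (hτ' (pairSpace_mul_mem ha ((h₀.line h₁ t).aeval_mem hσ hd _))).symm
  · rw [← hη, add_sub_cancel, hτ' (h₀.aeval_mem hσ hd f), hτ' (h₁.aeval_mem hσ hd f)]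

end Operators

end

end PrimitiveChernWeil

open PrimitiveChernWeil in
theorem mainTheorem2
    -- a symplectic manifold `(M, σ)`
    {n : ℕ} {M : Type*} [TopologicalSpace M] [T2Space M] [SecondCountableTopology M]
    [ChartedSpace (EuclideanSpace ℝ (Fin n)) M] [IsManifold (𝓡 n) ∞ M]
    (σ : Form n M) (hσ : IsSymplectic σ)
    -- smooth complex vector bundles `E⁺ = Ep` and `E⁻ = Em` over `M`
    {Fp : Type*} [NormedAddCommGroup Fp] [NormedSpace ℂ Fp] [FiniteDimensional ℂ Fp]
    {Ep : M → Type*} [∀ x, AddCommGroup (Ep x)] [∀ x, Module ℂ (Ep x)]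
    [∀ x, TopologicalSpace (Ep x)] [TopologicalSpace (TotalSpace Fp Ep)]
    [FiberBundle Fp Ep] [VectorBundle ℂ Fp Ep] [VectorBundle ℝ Fp Ep]
    [ContMDiffVectorBundle ∞ Fp Ep (𝓡 n)]
    {Fm : Type*} [NormedAddCommGroup Fm] [NormedSpace ℂ Fm] [FiniteDimensional ℂ Fm]
    {Em : M → Type*} [∀ x, AddCommGroup (Em x)] [∀ x, Module ℂ (Em x)]
    [∀ x, TopologicalSpace (Em x)] [TopologicalSpace (TotalSpace Fm Em)]
    [FiberBundle Fm Em] [VectorBundle ℂ Fm Em] [VectorBundle ℝ Fm Em]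
    [ContMDiffVectorBundle ∞ Fm Em (𝓡 n)]
    -- two primitive superconnections and a polynomial
    (A₀ A₁ : Module.End ℂ (EForm (n := n) Fp Ep Fm Em × EForm (n := n) Fp Ep Fm Em))
    (hA₀ : IsPrimitiveSuperconnection σ A₀) (hA₁ : IsPrimitiveSuperconnection σ A₁)
    (f : Polynomial ℂ) :
    let A : ℝ → Module.End ℂ (EForm (n := n) Fp Ep Fm Em × EForm (n := n) Fp Ep Fm Em) :=
      fun t => (t : ℂ) • A₁ + (1 - (t : ℂ)) • A₀
    let fA : ℝ → Module.End ℂ (EForm (n := n) Fp Ep Fm Em × EForm (n := n) Fp Ep Fm Em) :=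
      fun t => Polynomial.aeval (A t ^ 2) f
    let T : ℝ → Module.End ℂ (EForm (n := n) Fp Ep Fm Em × EForm (n := n) Fp Ep Fm Em) :=
      fun t => (A₁ - A₀) * Polynomial.aeval (A t ^ 2) (Polynomial.derivative f)
    -- the path consists of primitive superconnections, and the operators whose supertraces are
    -- taken are identified with unique pairs of `End(E)`-valued forms, of the right parity
    (∀ t, IsPrimitiveSuperconnection σ (A t)) ∧
    (∀ t, ∃ s : EndForm (n := n) Fp Ep Fm Em × EndForm (n := n) Fp Ep Fm Em,
      IsIdentifiedWith (fA t) s ∧ (∀ s', IsIdentifiedWith (fA t) s' → s' = s) ∧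
        EndHasParity 1 s.1 ∧ EndHasParity (-1) s.2) ∧
    (∀ t, ∃ s : EndForm (n := n) Fp Ep Fm Em × EndForm (n := n) Fp Ep Fm Em,
      IsIdentifiedWith (T t) s ∧ (∀ s', IsIdentifiedWith (T t) s' → s' = s) ∧
        EndHasParity (-1) s.1 ∧ EndHasParity 1 s.2) ∧
    -- the transgression formula
    (∃ η : Form n M × Form n M,
      IsFormIntegral (fun t => (boldStr (T t)).1) 0 1 η.1 ∧
      IsFormIntegral (fun t => (boldStr (T t)).2) 0 1 η.2 ∧
      inclPair n M (boldStr (Polynomial.aeval (A₁ ^ 2) f) -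
        boldStr (Polynomial.aeval (A₀ ^ 2) f)) = boundary σ η) ∧
    -- the two supertraces are closed and define the same primitive cohomology classes
    boundary σ (boldStr (Polynomial.aeval (A₀ ^ 2) f)) = 0 ∧
    boundary σ (boldStr (Polynomial.aeval (A₁ ^ 2) f)) = 0 ∧
    ∀ i : ℕ, ∃ (h₀ : pairComponent i (boldStr (Polynomial.aeval (A₀ ^ 2) f)) ∈
          primitiveCocycle σ i)
        (h₁ : pairComponent i (boldStr (Polynomial.aeval (A₁ ^ 2) f)) ∈ primitiveCocycle σ i),
      (Submodule.Quotient.mk ⟨_, h₁⟩ : PrimitiveCohomology σ i) =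
        Submodule.Quotient.mk ⟨_, h₀⟩ := by
  intro A fA T
  have hσe : ∀ x, extSign (σ.1 x) = σ.1 x := fun x => extSign_of_mem_two (hσ.deg_two x)
  have hA : ∀ t, IsPrimitiveSuperconnection σ (A t) := fun t => hA₀.line hA₁ t
  have hclosed₀ := hA₀.boundary_boldStr hσe hσ.closed f
  have hclosed₁ := hA₁.boundary_boldStr hσe hσ.closed f
  obtain ⟨N, c, hc, hη⟩ := hA₀.transgression hσe hσ.closed hA₁ f
  refine ⟨hA, fun t => exists_unique_identified ((hA t).aeval_mem hσe hσ.closed f), fun t => ?_,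
    ⟨∑ k ∈ Finset.range N, ((k : ℂ) + 1)⁻¹ • c k, ?_, ?_, hη⟩, hclosed₀, hclosed₁,
    primitive_class_eq hσ.deg_two hclosed₀ hclosed₁ hη⟩
  · have h := pairSpace_mul_mem (hA₀.sub_mem hA₁)
      ((hA t).aeval_mem hσe hσ.closed (Polynomial.derivative f))
    obtain ⟨s, h1, h2, h3, h4⟩ := exists_unique_identified h
    exact ⟨s, h1, h2, by rwa [mul_one] at h3, by rwa [mul_one, neg_neg] at h4⟩
  · have h := isFormIntegral_polynomial (F := fun t => (boldStr (T t)).1) (N := N)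
      (c := fun k => (c k).1) fun t => by
        rw [show boldStr (T t) = _ from hc t, Prod.fst_sum]; rfl
    rw [Prod.fst_sum]
    exact h
  · have h := isFormIntegral_polynomial (F := fun t => (boldStr (T t)).2) (N := N)
      (c := fun k => (c k).2) fun t => by
        rw [show boldStr (T t) = _ from hc t, Prod.snd_sum]; rfl
    rw [Prod.snd_sum]
    exact h
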